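/- **Setting.** Let $n\in\mathbb N$ and let $\Omega\subseteq\mathbb R^n$ be open. All nets are indexed by $\varepsilon\in(0,1]$; $O(\cdot)$ refers to $\varepsilon\to0$; $K\Subset\Omega$ means that $K$ is a compact subset of $\Omega$; $\langle\xi\rangle=(1+|\xi|^2)^{1/2}$; $\hat f(\xi)=\int e^{-iy\xi}f(y)\,dy$; $T^*\Omega\setminus0=\Omega\times(\mathbb R^n\setminus\{0\})$. A conic neighbourhood of $\xi_0\ne0$ is an open set $\Gamma\subseteq\mathbb R^n\setminus\{0\}$ containing $\xi_0$ with $t\Gamma\subseteq\Gamma$ for all $t>0$. **Generalized functions.** A net $(u_\varepsilon)_\varepsilon$ in $C^\infty(\Omega)$ is *moderate* if for all $K\Subset\Omega$ and $\alpha\in\mathbb N^n$ there is $p\in\mathbb R$ with $\sup_K|\partial^\alpha u_\varepsilon|=O(\varepsilon^{-p})$. It is *negligible* if it is moderate and $\sup_K|u_\varepsilon|=O(\varepsilon^{q})$ for all $K\Subset\Omega$ and $q\in\mathbb R$. The space $\mathcal G(\Omega)$ of Colombeau generalized functions is the quotient of moderate by negligible nets. $\mathcal G^\infty(\Omega)$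 is the set of those $u\in\mathcal G(\Omega)$ that have a representative for which, for each $K\Subset\Omega$, one $p$ serves all $\alpha$. $\mathcal G_c$ denotes generalized functions of compact support; they have representatives supported in a common compact set. $\widetilde{\mathbb C}$ is the ring of generalized complex numbers, i.e. nets in $\mathbb C$ that are $O(\varepsilon^{-p})$ for some $p$, modulo nets that are $O(\varepsilon^q)$ for all $q$. **Symbols.** $S^m(\Omega\times\mathbb R^n)$ is the space of $a\in C^\infty(\Omega\times\mathbb R^n)$ such that all seminorms $|a|^{(m)}_{K,\alpha,\beta}=\sup_{x\in K,\,\xi\in\mathbb R^n}\langle\xi\rangle^{-m+|\alpha|}|\partial_\xi^\alpha\partial_x^\beta a(x,\xi)|$ ($K\Subset\Omega$) are finite. A net $(\omega_\varepsilon)_\varepsilon$ of reals belongs to $\Pi_{\mathrm{sc}}$ if $\omega_\varepsilon\ge c$ for some $c>0$ and all $\varepsilon$, and if for every $p\ge0$ there is $c_p>0$ with $\omega_\varepsilon^p\le c_p\varepsilon^{-1}$ for all $\varepsilon$. A *slow scale generalized symbol* of order $m$ is a class, modulo the nets $(a_\varepsilon)_\varepsilon$ in $S^m(\Omega\times\mathbb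 R^n)$ with $$\forall K\Subset\Omega\ \forall\alpha,\beta\ \forall q\in\mathbb N\ \exists c>0\ \forall\varepsilon:\ |a_\varepsilon|^{(m)}_{K,\alpha,\beta}\le c\,\varepsilon^q,$$ of nets $(a_\varepsilon)_\varepsilon$ in $S^m(\Omega\times\mathbb R^n)$ with $$\forall K\Subset\Omega\ \exists(\omega_\varepsilon)_\varepsilon\in\Pi_{\mathrm{sc}}\ \forall\alpha,\beta\ \exists c>0\ \forall\varepsilon:\ |a_\varepsilon|^{(m)}_{K,\alpha,\beta}\le c\,\omega_\varepsilon .$$ Such a symbol $a$ is *slow scale micro-elliptic* at $(x_0,\xi_0)\in T^*\Omega\setminus0$ if it has a representative $(a_\varepsilon)_\varepsilon$ for which there are an open neighbourhood $U$ of $x_0$ with compact closure in $\Omega$, a conic neighbourhood $\Gamma$ of $\xi_0$, and $(r_\varepsilon)_\varepsilon,(s_\varepsilon)_\varepsilon\in\Pi_{\mathrm{sc}}$ with $|a_\varepsilon(x,\xi)|\ge s_\varepsilon^{-1}\langle\xi\rangle^m$ for all $\varepsilon\in(0,1]$, $x\in U$ and $\xi\in\Gamma$ with $|\xi|\ge r_\varepsilon$.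 $\mathrm{Ell}_{\mathrm{sc}}(a)$ is the set of all such points. **Operators.** For $u\in\mathcal G_c(\Omega)$, $a(x,D)u$ is the class of $\big((2\pi)^{-n}\int e^{ix\xi}a_\varepsilon(x,\xi)\hat u_\varepsilon(\xi)\,d\xi\big)_\varepsilon$. The kernel of $a(x,D)$ is the functional $k:\mathcal G_c(\Omega\times\Omega)\to\widetilde{\mathbb C}$, $k(w)=\int_\Omega a(x,D)(w(x,\cdot))(x)\,dx$. Its support is the complement in $\Omega\times\Omega$ of the largest open set $W$ such that $k$ vanishes on $\mathcal G_c(W)$. The operator is *properly supported* if both projections $\operatorname{supp}k\to\Omega$ are proper maps. It then acts on all of $\mathcal G(\Omega)$: on every open $V$ with compact closure in $\Omega$, $(a(x,D)u)|_V=(a(x,D)(\psi u))|_V$, where $\psi\in C_c^\infty(\Omega)$ equals $1$ near $\{y:(x,y)\in\operatorname{supp}k\text{ for some }x\in\overline V\}$. A *classical* properly supported operator $A\in\Psi^0(\Omega)$ is an operator $A=a(x,D)$ with a single symbol $a\in S^0(\Omega\times\mathbb R^n)$ whose distribution kernel has proper support. It acts on $C^\infty(\Omega)$ in the same way, and on $\mathcal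 G(\Omega)$ by $A[(u_\varepsilon)_\varepsilon]=[(Au_\varepsilon)_\varepsilon]$. Its characteristic set $\mathrm{Char}(A)\subseteq T^*\Omega\setminus0$ is the complement of the set of points $(x_0,\xi_0)$ for which there are $U,\Gamma$ as above and $R,c>0$ with $|a(x,\xi)|\ge c$ for all $x\in U$ and $\xi\in\Gamma$ with $|\xi|\ge R$. **The three sets.** Let $u\in\mathcal G(\Omega)$. All sets are subsets of $T^*\Omega\setminus0$, and complements are taken there. * $\mathrm W_{\mathrm{cl}}(u)=\bigcap\mathrm{Char}(A)$, over all classical properly supported $A\in\Psi^0(\Omega)$ with $Au\in\mathcal G^\infty(\Omega)$. * $\mathrm W_{\mathrm{sc}}(u)=\bigcap\mathrm{Ell}_{\mathrm{sc}}(a)^{\mathrm c}$, over all slow scale generalized symbols $a$ of order $0$ such that $a(x,D)$ is properly supported and $a(x,D)u\in\mathcal G^\infty(\Omega)$. * $\mathrm{WF}_{\mathrm g}(u)$ is the complement of the set of $(x_0,\xi_0)$ for which there are a representative $(u_\varepsilon)_\varepsilon$ of $u$, a function $\phi\in C_c^\infty(\Omega)$ with $\phi(x_0)=1$, a conic neighbourhood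 $\Gamma$ of $\xi_0$ and $N\in\mathbb N$ such that $\sup_{\xi\in\Gamma}\langle\xi\rangle^l|\widehat{\phi u_\varepsilon}(\xi)|=O(\varepsilon^{-N})$ for all $l\in\mathbb R$. **Theorem.** For all $u\in\mathcal G(\Omega)$, $$\mathrm W_{\mathrm{cl}}(u)=\mathrm W_{\mathrm{sc}}(u)=\mathrm{WF}_{\mathrm g}(u).$$ -/

import Mathlib

open scoped ContDiff Topology
open TopologicalSpace (Opens)

namespace Colombeau

noncomputable section

/-- The Euclidean space `ℝⁿ`. -/
abbrev E (n : ℕ) : Type := EuclideanSpace ℝ (Fin n)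

/-- The index set `(0, 1]` of all nets. -/
abbrev Eps : Type := Set.Ioc (0 : ℝ) 1

theorem Eps.pos (ε : Eps) : 0 < (ε : ℝ) := ε.2.1

theorem Eps.le_one (ε : Eps) : (ε : ℝ) ≤ 1 := ε.2.2

/-- `sup_{x ∈ K} ‖f ε x‖ = O(ε ^ r)` as `ε → 0`. -/
def UnifBigO {X V : Type*} [Norm V] (K : Set X) (f : Eps → X → V) (r : ℝ) : Prop :=
  ∃ C : ℝ, ∃ η : ℝ, 0 < η ∧ ∀ ε : Eps, (ε : ℝ) < η → ∀ x ∈ K, ‖f ε x‖ ≤ C * (ε : ℝ) ^ r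

/-! ### Moderate, negligible and regular nets; the Colombeau space -/

section Nets

variable {F : Type*} [NormedAddCommGroup F] [NormedSpace ℝ F]

/-- Moderate nets on `Ω`. Functions are total, only their values on the open set `Ω` matter. The
norm of the `k`-th Fréchet derivative controls, and is controlled by, all partial derivatives of
order `k`. -/
def IsModerate (Ω : Opens F) (u : Eps → F → ℂ) : Prop :=
  (∀ ε, ContDiffOn ℝ ∞ (u ε) Ω) ∧
    ∀ K : Set F, IsCompact K → K ⊆ Ω → ∀ k : ℕ, ∃ p : ℝ,
      UnifBigO K (fun ε => iteratedFDeriv ℝ k (u ε)) (-p)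

/-- Negligible nets on `Ω`. -/
def IsNegligible (Ω : Opens F) (u : Eps → F → ℂ) : Prop :=
  IsModerate Ω u ∧ ∀ K : Set F, IsCompact K → K ⊆ Ω → ∀ q : ℝ, UnifBigO K u q

/-- Regular nets on `Ω`: on each compact set the same power of `ε` serves all derivatives. -/
def IsRegularNet (Ω : Opens F) (u : Eps → F → ℂ) : Prop :=
  (∀ ε, ContDiffOn ℝ ∞ (u ε) Ω) ∧
    ∀ K : Set F, IsCompact K → K ⊆ Ω → ∃ p : ℝ, ∀ k : ℕ,
      UnifBigO K (fun ε => iteratedFDeriv ℝ k (u ε)) (-p)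

theorem UnifBigO.mono {X V : Type*} [SeminormedAddCommGroup V] {K : Set X} {f : Eps → X → V}
    {r s : ℝ} (h : UnifBigO K f r) (hsr : s ≤ r) : UnifBigO K f s := by
  obtain ⟨C, η, hη, h⟩ := h
  refine ⟨|C|, η, hη, fun ε hε x hx => (h ε hε x hx).trans ?_⟩
  have h1 : (ε : ℝ) ^ r ≤ (ε : ℝ) ^ s := Real.rpow_le_rpow_of_exponent_ge ε.pos ε.le_one hsr
  have h2 : 0 ≤ (ε : ℝ) ^ r := (Real.rpow_pos_of_pos ε.pos r).le
  calc C * (ε : ℝ) ^ r ≤ |C| * (ε : ℝ) ^ r := mul_le_mul_of_nonneg_right (le_abs_self C) h2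
    _ ≤ |C| * (ε : ℝ) ^ s := mul_le_mul_of_nonneg_left h1 (abs_nonneg C)

theorem UnifBigO.of_le_add {X V : Type*} [SeminormedAddCommGroup V] {K : Set X}
    {f g h : Eps → X → V} {r : ℝ} (hf : UnifBigO K f r) (hg : UnifBigO K g r)
    (H : ∀ ε, ∀ x ∈ K, ‖h ε x‖ ≤ ‖f ε x‖ + ‖g ε x‖) : UnifBigO K h r := by
  obtain ⟨C, η, hη, hf⟩ := hf
  obtain ⟨D, θ, hθ, hg⟩ := hg
  refine ⟨C + D, min η θ, lt_min hη hθ, fun ε hε x hx => ?_⟩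
  have h1 := hf ε (hε.trans_le (min_le_left _ _)) x hx
  have h2 := hg ε (hε.trans_le (min_le_right _ _)) x hx
  have h3 := H ε x hx
  rw [add_mul]
  linarith

theorem UnifBigO.of_le_mul {X V : Type*} [SeminormedAddCommGroup V] {K : Set X}
    {f h : Eps → X → V} {r : ℝ} (hf : UnifBigO K f r) (c : ℝ) (hc : 0 ≤ c)
    (H : ∀ ε, ∀ x ∈ K, ‖h ε x‖ ≤ c * ‖f ε x‖) : UnifBigO K h r := by
  obtain ⟨C, η, hη, hf⟩ := hf
  refine ⟨c * C, η, hη, fun ε hε x hx => (H ε x hx).trans ?_⟩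
  rw [mul_assoc]
  exact mul_le_mul_of_nonneg_left (hf ε hε x hx) hc

theorem IsModerate.zero (Ω : Opens F) : IsModerate Ω (0 : Eps → F → ℂ) := by
  refine ⟨fun ε => contDiffOn_const, fun K _ _ k => ⟨0, 0, 1, one_pos, fun ε _ x _ => ?_⟩⟩
  simp

theorem IsModerate.add {Ω : Opens F} {u v : Eps → F → ℂ} (hu : IsModerate Ω u)
    (hv : IsModerate Ω v) : IsModerate Ω (u + v) := by
  refine ⟨fun ε => (hu.1 ε).add (hv.1 ε), fun K hK hKΩ k => ?_⟩
  obtain ⟨p, hp⟩ := hu.2 K hK hKΩ k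
  obtain ⟨q, hq⟩ := hv.2 K hK hKΩ k
  refine ⟨max p q, (hp.mono (neg_le_neg (le_max_left p q))).of_le_add
    (hq.mono (neg_le_neg (le_max_right p q))) fun ε x hx => ?_⟩
  have hn : (Ω : Set F) ∈ 𝓝 x := Ω.isOpen.mem_nhds (hKΩ hx)
  have hk : (k : WithTop ℕ∞) ≤ ∞ := by exact_mod_cast le_top
  have h1 : ContDiffAt ℝ k (u ε) x := ((hu.1 ε).contDiffAt hn).of_le hk
  have h2 : ContDiffAt ℝ k (v ε) x := ((hv.1 ε).contDiffAt hn).of_le hk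
  have h3 : iteratedFDeriv ℝ k ((u + v) ε) x
      = iteratedFDeriv ℝ k (u ε) x + iteratedFDeriv ℝ k (v ε) x :=
    iteratedFDeriv_add_apply h1 h2
  rw [h3]
  exact norm_add_le _ _

theorem IsModerate.smul {Ω : Opens F} {u : Eps → F → ℂ} (c : ℂ) (hu : IsModerate Ω u) :
    IsModerate Ω (c • u) := by
  refine ⟨fun ε => (hu.1 ε).const_smul c, fun K hK hKΩ k => ?_⟩
  obtain ⟨p, hp⟩ := hu.2 K hK hKΩ k
  refine ⟨p, hp.of_le_mul ‖c‖ (norm_nonneg c) fun ε x hx => ?_⟩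
  have hn : (Ω : Set F) ∈ 𝓝 x := Ω.isOpen.mem_nhds (hKΩ hx)
  have hk : (k : WithTop ℕ∞) ≤ ∞ := by exact_mod_cast le_top
  have h1 : ContDiffAt ℝ k (u ε) x := ((hu.1 ε).contDiffAt hn).of_le hk
  have h3 : iteratedFDeriv ℝ k ((c • u) ε) x = c • iteratedFDeriv ℝ k (u ε) x :=
    iteratedFDeriv_const_smul_apply (a := c) h1
  rw [h3, norm_smul]

/-- The complex vector space of moderate nets. -/
def moderateNets (Ω : Opens F) : Submodule ℂ (Eps → F → ℂ) where
  carrier := {u | IsModerate Ω u}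
  zero_mem' := IsModerate.zero Ω
  add_mem' := IsModerate.add
  smul_mem' := fun c _ hu => hu.smul c

/-- The complex vector space of negligible nets. -/
def negligibleNets (Ω : Opens F) : Submodule ℂ (Eps → F → ℂ) where
  carrier := {u | IsNegligible Ω u}
  zero_mem' := ⟨IsModerate.zero Ω, fun _ _ _ _ => ⟨0, 1, one_pos, fun _ _ _ _ => by simp⟩⟩
  add_mem' := fun hu hv => ⟨hu.1.add hv.1, fun K hK hKΩ q =>
    (hu.2 K hK hKΩ q).of_le_add (hv.2 K hK hKΩ q) fun _ _ _ => norm_add_le _ _⟩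
  smul_mem' := fun c _ hu => ⟨hu.1.smul c, fun K hK hKΩ q =>
    (hu.2 K hK hKΩ q).of_le_mul ‖c‖ (norm_nonneg c) fun _ _ _ => (norm_mul _ _).le⟩

/-- The space `𝒢(Ω)` of Colombeau generalized functions: moderate modulo negligible nets. -/
abbrev G (Ω : Opens F) : Type _ :=
  (moderateNets Ω) ⧸ (negligibleNets Ω).submoduleOf (moderateNets Ω)

/-- The net `r` is a representative of the generalized function `u`. -/
def IsRep {Ω : Opens F} (r : Eps → F → ℂ) (u : G Ω) : Prop :=
  ∃ h : r ∈ moderateNets Ω,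
    ((negligibleNets Ω).submoduleOf (moderateNets Ω)).mkQ ⟨r, h⟩ = u

/-- The set `𝒢^∞(Ω)` of regular generalized functions. -/
def GInf (Ω : Opens F) : Set (G Ω) :=
  {u | ∃ r, IsRep r u ∧ IsRegularNet Ω r}

/-- `φ ∈ C_c^∞(Ω)`, as a function on the whole space. -/
def IsTest (Ω : Opens F) (φ : F → ℂ) : Prop :=
  ContDiff ℝ ∞ φ ∧ HasCompactSupport φ ∧ tsupport φ ⊆ Ω

/-- Moderate nets whose supports lie in one compact subset of `W`; these are the representing nets
of the elements of `𝒢_c(W)`. -/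
def IsCompactlySupportedNet (W : Opens F) (w : Eps → F → ℂ) : Prop :=
  (∀ ε, ContDiff ℝ ∞ (w ε)) ∧ IsModerate W w ∧
    ∃ L : Set F, IsCompact L ∧ L ⊆ W ∧ ∀ ε, ∀ x, x ∉ L → w ε x = 0

end Nets

/-! ### Symbols -/

/-- The Japanese bracket `⟨ξ⟩ = (1 + |ξ|²)^{1/2}`. -/
def bracket {n : ℕ} (ξ : E n) : ℝ := Real.sqrt (1 + ‖ξ‖ ^ 2)

/-- The partial derivative `∂_ξ^α ∂_x^β a (x, ξ)`. Multi-indices of order `j` and `k` are given by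
the tuples of coordinate directions in which one differentiates. -/
def symDeriv {n j k : ℕ} (α : Fin j → Fin n) (β : Fin k → Fin n) (a : E n → E n → ℂ)
    (x ξ : E n) : ℂ :=
  iteratedFDeriv ℝ (j + k) (fun p : E n × E n => a p.1 p.2) (x, ξ)
    (Fin.append (fun i => ((0 : E n), EuclideanSpace.single (α i) (1 : ℝ)))
      (fun i => (EuclideanSpace.single (β i) (1 : ℝ), (0 : E n))))

/-- `|a|^{(m)}_{K,α,β} ≤ B` for the seminorm
`sup_{x ∈ K, ξ} ⟨ξ⟩^{-m+|α|} |∂_ξ^α ∂_x^β a (x, ξ)|`. -/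
def SeminormLE {n j k : ℕ} (m : ℝ) (K : Set (E n)) (α : Fin j → Fin n) (β : Fin k → Fin n)
    (a : E n → E n → ℂ) (B : ℝ) : Prop :=
  ∀ x ∈ K, ∀ ξ : E n, bracket ξ ^ (-m + (j : ℝ)) * ‖symDeriv α β a x ξ‖ ≤ B

/-- The symbol is smooth on `Ω × ℝⁿ`. -/
def SymSmooth {n : ℕ} (Ω : Opens (E n)) (a : E n → E n → ℂ) : Prop :=
  ContDiffOn ℝ ∞ (fun p : E n × E n => a p.1 p.2) ((Ω : Set (E n)) ×ˢ Set.univ)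

/-- The classical symbol space `S^m(Ω × ℝⁿ)`. -/
def IsSymbol {n : ℕ} (Ω : Opens (E n)) (m : ℝ) (a : E n → E n → ℂ) : Prop :=
  SymSmooth Ω a ∧
    ∀ K : Set (E n), IsCompact K → K ⊆ Ω →
      ∀ (j k : ℕ) (α : Fin j → Fin n) (β : Fin k → Fin n), ∃ C : ℝ, SeminormLE m K α β a C

/-- Strongly positive slow scale nets. -/
def IsSlowScale (σ : Eps → ℝ) : Prop :=
  (∃ c : ℝ, 0 < c ∧ ∀ ε, c ≤ σ ε) ∧
    ∀ p : ℝ, 0 ≤ p → ∃ c : ℝ, 0 < c ∧ ∀ ε : Eps, σ ε ^ p ≤ c * (ε : ℝ)⁻¹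

/-- Slow scale nets of symbols of order `m`. -/
def IsSlowScaleNet {n : ℕ} (Ω : Opens (E n)) (m : ℝ) (a : Eps → E n → E n → ℂ) : Prop :=
  (∀ ε, IsSymbol Ω m (a ε)) ∧
    ∀ K : Set (E n), IsCompact K → K ⊆ Ω → ∃ σ : Eps → ℝ, IsSlowScale σ ∧
      ∀ (j k : ℕ) (α : Fin j → Fin n) (β : Fin k → Fin n), ∃ c : ℝ, 0 < c ∧
        ∀ ε, SeminormLE m K α β (a ε) (c * σ ε)

/-- Negligible nets of symbols of order `m`. -/
def IsNegligibleSymbolNet {n : ℕ} (Ω : Opens (E n)) (m : ℝ) (a : Eps → E n → E n → ℂ) : Prop :=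
  (∀ ε, IsSymbol Ω m (a ε)) ∧
    ∀ K : Set (E n), IsCompact K → K ⊆ Ω →
      ∀ (j k : ℕ) (α : Fin j → Fin n) (β : Fin k → Fin n) (q : ℕ), ∃ c : ℝ, 0 < c ∧
        ∀ ε : Eps, SeminormLE m K α β (a ε) (c * (ε : ℝ) ^ q)

section SymbolLemmas

variable {n : ℕ} {Ω : Opens (E n)} {m : ℝ}

theorem bracket_rpow_nonneg (ξ : E n) (r : ℝ) : 0 ≤ bracket ξ ^ r :=
  Real.rpow_nonneg (Real.sqrt_nonneg _) r

theorem SymSmooth.contDiffAt {a : E n → E n → ℂ} (h : SymSmooth Ω a) (N : ℕ) {x : E n}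
    (hx : x ∈ Ω) (ξ : E n) : ContDiffAt ℝ N (fun p : E n × E n => a p.1 p.2) (x, ξ) := by
  have ho : IsOpen ((Ω : Set (E n)) ×ˢ (Set.univ : Set (E n))) := Ω.isOpen.prod isOpen_univ
  have hk : (N : WithTop ℕ∞) ≤ ∞ := by exact_mod_cast le_top
  exact (ContDiffOn.contDiffAt h (ho.mem_nhds ⟨hx, Set.mem_univ _⟩)).of_le hk

theorem SeminormLE.add {j k : ℕ} {K : Set (E n)} {α : Fin j → Fin n} {β : Fin k → Fin n}
    {a b : E n → E n → ℂ} {A B : ℝ} (hK : K ⊆ Ω) (sa : SymSmooth Ω a) (sb : SymSmooth Ω b)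
    (ha : SeminormLE m K α β a A) (hb : SeminormLE m K α β b B) :
    SeminormLE m K α β (a + b) (A + B) := by
  intro x hx ξ
  have h : symDeriv α β (a + b) x ξ = symDeriv α β a x ξ + symDeriv α β b x ξ := by
    have h0 : iteratedFDeriv ℝ (j + k) (fun p : E n × E n => (a + b) p.1 p.2) (x, ξ)
        = iteratedFDeriv ℝ (j + k) (fun p : E n × E n => a p.1 p.2) (x, ξ)
          + iteratedFDeriv ℝ (j + k) (fun p : E n × E n => b p.1 p.2) (x, ξ) :=
      iteratedFDeriv_add_apply (sa.contDiffAt (j + k) (hK hx) ξ)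
        (sb.contDiffAt (j + k) (hK hx) ξ)
    simp only [symDeriv, h0, add_apply]
  rw [h]
  calc bracket ξ ^ (-m + (j : ℝ)) * ‖symDeriv α β a x ξ + symDeriv α β b x ξ‖
      ≤ bracket ξ ^ (-m + (j : ℝ)) * (‖symDeriv α β a x ξ‖ + ‖symDeriv α β b x ξ‖) :=
        mul_le_mul_of_nonneg_left (norm_add_le _ _) (bracket_rpow_nonneg ξ _)
    _ ≤ A + B := by
        rw [mul_add]
        exact add_le_add (ha x hx ξ) (hb x hx ξ)

theorem SeminormLE.smul {j k : ℕ} {K : Set (E n)} {α : Fin j → Fin n} {β : Fin k → Fin n}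
    {a : E n → E n → ℂ} {A : ℝ} (c : ℂ) (hK : K ⊆ Ω) (sa : SymSmooth Ω a)
    (ha : SeminormLE m K α β a A) : SeminormLE m K α β (c • a) (‖c‖ * A) := by
  intro x hx ξ
  have h : symDeriv α β (c • a) x ξ = c • symDeriv α β a x ξ := by
    have h0 : iteratedFDeriv ℝ (j + k) (fun p : E n × E n => (c • a) p.1 p.2) (x, ξ)
        = c • iteratedFDeriv ℝ (j + k) (fun p : E n × E n => a p.1 p.2) (x, ξ) :=
      iteratedFDeriv_const_smul_apply (a := c) (sa.contDiffAt (j + k) (hK hx) ξ)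
    simp only [symDeriv, h0, smul_apply]
  rw [h, norm_smul, mul_left_comm]
  exact mul_le_mul_of_nonneg_left (ha x hx ξ) (norm_nonneg c)

theorem SeminormLE.mono {j k : ℕ} {K : Set (E n)} {α : Fin j → Fin n} {β : Fin k → Fin n}
    {a : E n → E n → ℂ} {A B : ℝ} (h : SeminormLE m K α β a A) (hAB : A ≤ B) :
    SeminormLE m K α β a B :=
  fun x hx ξ => (h x hx ξ).trans hAB

theorem SeminormLE.zero {j k : ℕ} (K : Set (E n)) (α : Fin j → Fin n) (β : Fin k → Fin n)
    {B : ℝ} (hB : 0 ≤ B) : SeminormLE m K α β (0 : E n → E n → ℂ) B := by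
  intro x _ ξ
  have h0 : iteratedFDeriv ℝ (j + k) (fun p : E n × E n => (0 : E n → E n → ℂ) p.1 p.2) = 0 :=
    iteratedFDeriv_fun_zero
  simpa [symDeriv, h0] using hB

theorem IsSymbol.zero : IsSymbol Ω m (0 : E n → E n → ℂ) :=
  ⟨contDiffOn_const, fun K _ _ _ _ α β => ⟨0, SeminormLE.zero K α β le_rfl⟩⟩

theorem IsSymbol.add {a b : E n → E n → ℂ} (ha : IsSymbol Ω m a) (hb : IsSymbol Ω m b) :
    IsSymbol Ω m (a + b) := by
  refine ⟨ContDiffOn.add ha.1 hb.1, fun K hK hKΩ j k α β => ?_⟩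
  obtain ⟨A, hA⟩ := ha.2 K hK hKΩ j k α β
  obtain ⟨B, hB⟩ := hb.2 K hK hKΩ j k α β
  exact ⟨A + B, hA.add hKΩ ha.1 hb.1 hB⟩

theorem IsSymbol.smul {a : E n → E n → ℂ} (c : ℂ) (ha : IsSymbol Ω m a) :
    IsSymbol Ω m (c • a) := by
  refine ⟨ContDiffOn.const_smul c ha.1, fun K hK hKΩ j k α β => ?_⟩
  obtain ⟨A, hA⟩ := ha.2 K hK hKΩ j k α β
  exact ⟨‖c‖ * A, hA.smul c hKΩ ha.1⟩

theorem IsSlowScale.one : IsSlowScale fun _ => 1 :=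
  ⟨⟨1, one_pos, fun _ => le_rfl⟩, fun p _ => ⟨1, one_pos, fun ε => by
    rw [Real.one_rpow, one_mul]
    exact (one_le_inv₀ ε.pos).2 ε.le_one⟩⟩

theorem IsSlowScale.max {σ θ : Eps → ℝ} (hσ : IsSlowScale σ) (hθ : IsSlowScale θ) :
    IsSlowScale fun ε => max (σ ε) (θ ε) := by
  obtain ⟨⟨c, hc, hcσ⟩, hσ⟩ := hσ
  refine ⟨⟨c, hc, fun ε => (hcσ ε).trans (le_max_left _ _)⟩, fun p hp => ?_⟩
  obtain ⟨A, hA, hσA⟩ := hσ p hp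
  obtain ⟨B, hB, hθB⟩ := hθ.2 p hp
  refine ⟨A + B, add_pos hA hB, fun ε => ?_⟩
  have hi : 0 < (ε : ℝ)⁻¹ := inv_pos.2 ε.pos
  have h1 := mul_pos hA hi
  have h2 := mul_pos hB hi
  have h3 := hσA ε
  have h4 := hθB ε
  rw [add_mul]
  beta_reduce
  rcases max_choice (σ ε) (θ ε) with h | h <;> rw [h] <;> linarith

end SymbolLemmas

/-- The complex vector space of slow scale nets of symbols of order `m`. -/
def slowScaleNets {n : ℕ} (Ω : Opens (E n)) (m : ℝ) : Submodule ℂ (Eps → E n → E n → ℂ) where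
  carrier := {a | IsSlowScaleNet Ω m a}
  zero_mem' := ⟨fun _ => IsSymbol.zero, fun K _ _ => ⟨_, IsSlowScale.one, fun _ _ α β =>
    ⟨1, one_pos, fun _ => SeminormLE.zero K α β (by norm_num)⟩⟩⟩
  add_mem' := by
    intro a b ha hb
    refine ⟨fun ε => (ha.1 ε).add (hb.1 ε), fun K hK hKΩ => ?_⟩
    obtain ⟨σ, hσ, hA⟩ := ha.2 K hK hKΩ
    obtain ⟨θ, hθ, hB⟩ := hb.2 K hK hKΩ
    refine ⟨_, hσ.max hθ, fun j k α β => ?_⟩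
    obtain ⟨c, hc, hA⟩ := hA j k α β
    obtain ⟨d, hd, hB⟩ := hB j k α β
    refine ⟨c + d, add_pos hc hd, fun ε =>
      ((hA ε).add hKΩ (ha.1 ε).1 (hb.1 ε).1 (hB ε)).mono ?_⟩
    rw [add_mul]
    exact add_le_add (mul_le_mul_of_nonneg_left (le_max_left _ _) hc.le)
      (mul_le_mul_of_nonneg_left (le_max_right _ _) hd.le)
  smul_mem' := by
    intro z a ha
    refine ⟨fun ε => (ha.1 ε).smul z, fun K hK hKΩ => ?_⟩
    obtain ⟨σ, hσ, hA⟩ := ha.2 K hK hKΩ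
    refine ⟨σ, hσ, fun j k α β => ?_⟩
    obtain ⟨c, hc, hA⟩ := hA j k α β
    obtain ⟨c₀, hc₀, hσc⟩ := hσ.1
    refine ⟨(‖z‖ + 1) * c, by positivity, fun ε =>
      ((hA ε).smul z hKΩ (ha.1 ε).1).mono ?_⟩
    have : 0 < c * σ ε := mul_pos hc (hc₀.trans_le (hσc ε))
    nlinarith

/-- The complex vector space of negligible nets of symbols of order `m`. -/
def negligibleSymbolNets {n : ℕ} (Ω : Opens (E n)) (m : ℝ) :
    Submodule ℂ (Eps → E n → E n → ℂ) where
  carrier := {a | IsNegligibleSymbolNet Ω m a}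
  zero_mem' := ⟨fun _ => IsSymbol.zero, fun K _ _ _ _ α β q =>
    ⟨1, one_pos, fun ε => SeminormLE.zero K α β (by have := ε.pos; positivity)⟩⟩
  add_mem' := by
    intro a b ha hb
    refine ⟨fun ε => (ha.1 ε).add (hb.1 ε), fun K hK hKΩ j k α β q => ?_⟩
    obtain ⟨c, hc, hA⟩ := ha.2 K hK hKΩ j k α β q
    obtain ⟨d, hd, hB⟩ := hb.2 K hK hKΩ j k α β q
    refine ⟨c + d, add_pos hc hd, fun ε => ?_⟩
    rw [add_mul]
    exact (hA ε).add hKΩ (ha.1 ε).1 (hb.1 ε).1 (hB ε)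
  smul_mem' := by
    intro z a ha
    refine ⟨fun ε => (ha.1 ε).smul z, fun K hK hKΩ j k α β q => ?_⟩
    obtain ⟨c, hc, hA⟩ := ha.2 K hK hKΩ j k α β q
    refine ⟨(‖z‖ + 1) * c, by positivity, fun ε =>
      ((hA ε).smul z hKΩ (ha.1 ε).1).mono ?_⟩
    have : 0 < c * (ε : ℝ) ^ q := mul_pos hc (pow_pos ε.pos q)
    nlinarith

/-- Slow scale generalized symbols of order `m`: slow scale nets modulo negligible nets. -/
abbrev SlowScaleSymbol {n : ℕ} (Ω : Opens (E n)) (m : ℝ) : Type :=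
  (slowScaleNets Ω m) ⧸ (negligibleSymbolNets Ω m).submoduleOf (slowScaleNets Ω m)

/-- The net `r` is a representative of the generalized symbol `a`. -/
def IsSymbolRep {n : ℕ} {Ω : Opens (E n)} {m : ℝ} (r : Eps → E n → E n → ℂ)
    (a : SlowScaleSymbol Ω m) : Prop :=
  ∃ h : r ∈ slowScaleNets Ω m,
    ((negligibleSymbolNets Ω m).submoduleOf (slowScaleNets Ω m)).mkQ ⟨r, h⟩ = a

/-! ### The cotangent bundle without zero section, ellipticity -/

/-- `Ω × (ℝⁿ ∖ {0})`. -/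
def coTangent {n : ℕ} (Ω : Opens (E n)) : Set (E n × E n) :=
  {p | p.1 ∈ Ω ∧ p.2 ≠ 0}

/-- `Γ ⊆ ℝⁿ ∖ {0}` is a conic (open) neighbourhood of `ξ₀`. -/
def IsConicNhd {n : ℕ} (Γ : Set (E n)) (ξ₀ : E n) : Prop :=
  IsOpen Γ ∧ ξ₀ ∈ Γ ∧ (0 : E n) ∉ Γ ∧ ∀ ξ ∈ Γ, ∀ t : ℝ, 0 < t → t • ξ ∈ Γ

/-- `U` is open with compact closure contained in `Ω`. -/
def RelCompact {n : ℕ} (Ω U : Opens (E n)) : Prop :=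
  IsCompact (closure (U : Set (E n))) ∧ closure (U : Set (E n)) ⊆ Ω

/-- The points where the generalized symbol `a` of order `m` is slow scale micro-elliptic. -/
def EllSc {n : ℕ} {Ω : Opens (E n)} {m : ℝ} (a : SlowScaleSymbol Ω m) : Set (E n × E n) :=
  {p | p ∈ coTangent Ω ∧ ∃ r, IsSymbolRep r a ∧
    ∃ U : Opens (E n), RelCompact Ω U ∧ p.1 ∈ U ∧ ∃ Γ : Set (E n), IsConicNhd Γ p.2 ∧
      ∃ R s : Eps → ℝ, IsSlowScale R ∧ IsSlowScale s ∧
        ∀ ε, ∀ x ∈ U, ∀ ξ ∈ Γ, R ε ≤ ‖ξ‖ → 1 / s ε * bracket ξ ^ m ≤ ‖r ε x ξ‖}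

/-- The characteristic set of the operator with the classical symbol `a` of order `m`: the
complement of the set of points where `a` is micro-elliptic. -/
def charSet {n : ℕ} (Ω : Opens (E n)) (m : ℝ) (a : E n → E n → ℂ) : Set (E n × E n) :=
  {p | p ∈ coTangent Ω ∧ ¬ ∃ U : Opens (E n), RelCompact Ω U ∧ p.1 ∈ U ∧
    ∃ Γ : Set (E n), IsConicNhd Γ p.2 ∧ ∃ R c : ℝ, 0 < R ∧ 0 < c ∧
      ∀ x ∈ U, ∀ ξ ∈ Γ, R ≤ ‖ξ‖ → c * bracket ξ ^ m ≤ ‖a x ξ‖}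

/-! ### Pseudodifferential operators -/

/-- `û(ξ) = ∫ e^{-i y ξ} u(y) dy`. -/
def fourierT {n : ℕ} (u : E n → ℂ) (ξ : E n) : ℂ :=
  ∫ y : E n, Complex.exp (-(Complex.I * ((inner ℝ y ξ : ℝ) : ℂ))) * u y

/-- `a(x,D)u (x) = (2π)^{-n} ∫ e^{i x ξ} a(x,ξ) û(ξ) dξ`, for `u` in `C_c^∞`. -/
def quantize {n : ℕ} (a : E n → E n → ℂ) (u : E n → ℂ) (x : E n) : ℂ :=
  (((2 * Real.pi) ^ n : ℝ) : ℂ)⁻¹ *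
    ∫ ξ : E n, Complex.exp (Complex.I * ((inner ℝ x ξ : ℝ) : ℂ)) * a x ξ * fourierT u ξ

/-- `Ω × Ω` as an open set. -/
def prodOpens {n : ℕ} (Ω : Opens (E n)) : Opens (E n × E n) :=
  ⟨(Ω : Set (E n)) ×ˢ (Ω : Set (E n)), Ω.isOpen.prod Ω.isOpen⟩

/-- The kernel of `a(x,D)` tested with `w ∈ C_c^∞(Ω × Ω)`: `∫_Ω a(x,D)(w(x,·))(x) dx`. -/
def kernelPairing {n : ℕ} (Ω : Opens (E n)) (a : E n → E n → ℂ) (w : E n × E n → ℂ) : ℂ :=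
  ∫ x in (Ω : Set (E n)), quantize a (fun y => w (x, y)) x

/-- The support of the (distribution) kernel of the classical operator `a(x,D)`: the complement
in `Ω × Ω` of the largest open set on which the kernel vanishes. -/
def kernelSupport {n : ℕ} (Ω : Opens (E n)) (a : E n → E n → ℂ) : Set (E n × E n) :=
  {p | p ∈ prodOpens Ω ∧ ∀ W : Opens (E n × E n), W ≤ prodOpens Ω → p ∈ W →
    ¬ ∀ w, IsTest W w → kernelPairing Ω a w = 0}

/-- The net of complex numbers represents `0` in the ring of generalized complex numbers. -/
def IsNullNet (z : Eps → ℂ) : Prop :=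
  ∀ q : ℝ, ∃ C : ℝ, ∃ η : ℝ, 0 < η ∧ ∀ ε : Eps, (ε : ℝ) < η → ‖z ε‖ ≤ C * (ε : ℝ) ^ q

/-- The support of the kernel of the operator with generalized symbol represented by `a`; the
kernel is a functional on `𝒢_c(Ω × Ω)` with values in the generalized complex numbers. -/
def genKernelSupport {n : ℕ} (Ω : Opens (E n)) (a : Eps → E n → E n → ℂ) : Set (E n × E n) :=
  {p | p ∈ prodOpens Ω ∧ ∀ W : Opens (E n × E n), W ≤ prodOpens Ω → p ∈ W →
    ¬ ∀ w, IsCompactlySupportedNet W w → IsNullNet fun ε => kernelPairing Ω (a ε) (w ε)}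

/-- `S ⊆ Ω × Ω` is proper: both projections `S → Ω` are proper maps. -/
def IsProperSubset {n : ℕ} (Ω : Opens (E n)) (S : Set (E n × E n)) : Prop :=
  ∀ K : Set (E n), IsCompact K → K ⊆ Ω →
    IsCompact (S ∩ K ×ˢ (Ω : Set (E n))) ∧ IsCompact (S ∩ (Ω : Set (E n)) ×ˢ K)

/-- `ψ ∈ C_c^∞(Ω)` equals `1` near all points `y` that are related by the kernel support `S` to
some point of the closure of `V`. -/
def IsCutoffFor {n : ℕ} (Ω : Opens (E n)) (S : Set (E n × E n)) (V : Opens (E n))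
    (ψ : E n → ℂ) : Prop :=
  IsTest Ω ψ ∧ ∀ x ∈ closure (V : Set (E n)), ∀ y, (x, y) ∈ S → ∀ᶠ z in 𝓝 y, ψ z = 1

/-- `g = a(x,D) f` for a properly supported classical operator and `f ∈ C^∞(Ω)`: on each
relatively compact open `V`, `g` is `a(x,D)(ψ f)` with a cut-off `ψ` adapted to `V`. -/
def IsClassicalImage {n : ℕ} (Ω : Opens (E n)) (a : E n → E n → ℂ) (f g : E n → ℂ) : Prop :=
  ∀ V : Opens (E n), RelCompact Ω V → ∀ ψ, IsCutoffFor Ω (kernelSupport Ω a) V ψ →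
    ∀ x ∈ V, g x = quantize a (fun y => ψ y * f y) x

/-- `v = a(x,D) u` in `𝒢(Ω)` for a properly supported classical operator, which acts on
representatives for each fixed `ε`. -/
def IsClassicalImageG {n : ℕ} {Ω : Opens (E n)} (a : E n → E n → ℂ) (u v : G Ω) : Prop :=
  ∃ ru rv, IsRep ru u ∧ IsRep rv v ∧ ∀ ε, IsClassicalImage Ω a (ru ε) (rv ε)

/-- `v = a(x,D) u` in `𝒢(Ω)` for the extension to `𝒢(Ω)` of a properly supported operator with
generalized symbol represented by the net `a`: on each relatively compact open `V`, the restriction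
of `v` is that of `a(x,D)(ψ u)` with a cut-off `ψ` adapted to `V`. -/
def IsGenImage {n : ℕ} {Ω : Opens (E n)} (a : Eps → E n → E n → ℂ) (u v : G Ω) : Prop :=
  ∃ ru rv, IsRep ru u ∧ IsRep rv v ∧
    ∀ V : Opens (E n), RelCompact Ω V → ∀ ψ, IsCutoffFor Ω (genKernelSupport Ω a) V ψ →
      IsNegligible V fun ε x => rv ε x - quantize (a ε) (fun y => ψ y * ru ε y) x

/-! ### The three sets -/

/-- `u` is `𝒢^∞`-microlocally regular at `(x₀, ξ₀)`. -/
def IsMicroRegular {n : ℕ} {Ω : Opens (E n)} (u : G Ω) (x₀ ξ₀ : E n) : Prop :=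
  ∃ r, IsRep r u ∧ ∃ φ, IsTest Ω φ ∧ φ x₀ = 1 ∧ ∃ Γ, IsConicNhd Γ ξ₀ ∧
    ∃ N : ℕ, ∀ l : ℝ, UnifBigO Γ
      (fun ε ξ => bracket ξ ^ l * ‖fourierT (fun y => φ y * r ε y) ξ‖) (-(N : ℝ))

/-- The generalized wave front set. -/
def WFg {n : ℕ} {Ω : Opens (E n)} (u : G Ω) : Set (E n × E n) :=
  {p | p ∈ coTangent Ω ∧ ¬ IsMicroRegular u p.1 p.2}

/-- `W_sc(u)`: intersection of the complements of `EllSc a` over all properly supported operators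
`a(x,D)` with slow scale generalized symbol `a` of order `0` and `a(x,D)u ∈ 𝒢^∞(Ω)`. -/
def Wsc {n : ℕ} {Ω : Opens (E n)} (u : G Ω) : Set (E n × E n) :=
  {p | p ∈ coTangent Ω ∧ ∀ a : SlowScaleSymbol Ω 0,
    (∃ r, IsSymbolRep r a ∧ IsProperSubset Ω (genKernelSupport Ω r) ∧
      ∃ v ∈ GInf Ω, IsGenImage r u v) → p ∉ EllSc a}

/-- `W_cl(u)`: intersection of the characteristic sets of all properly supported classical
operators `a(x,D)` of order `0` with `a(x,D)u ∈ 𝒢^∞(Ω)`. -/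
def Wcl {n : ℕ} {Ω : Opens (E n)} (u : G Ω) : Set (E n × E n) :=
  {p | p ∈ coTangent Ω ∧ ∀ a : E n → E n → ℂ, IsSymbol Ω 0 a →
    IsProperSubset Ω (kernelSupport Ω a) →
      (∃ v ∈ GInf Ω, IsClassicalImageG a u v) → p ∈ charSet Ω 0 a}

end

end Colombeau

/-! The three sets are compared in a cycle: `Wcl_subset_WFg`, `WFg_subset_Wsc`, `Wsc_subset_Wcl`.

A classical symbol is a constant slow scale net, its kernel support is the same in both senses, and
an ellipticity constant c becomes the slow scale net 1/c. This gives W_sc ⊆ W_cl.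

For W_cl ⊆ WF_g, let φu have a Fourier transform that decreases rapidly on a cone Γ, with one power
of ε. Take a multiplier χ of order 0 supported in Γ and equal to 1 at large frequencies near ξ₀. The
operator A = φ χ(D) φ is classical and properly supported. Its symbol is φ²χ + O(1/⟨ξ⟩), hence
elliptic at (x₀, ξ₀). Moreover Au = φ F⁻¹(χ F(φu)) is regular, because each derivative only costs a
power of ⟨ξ⟩ on Γ. The carrying lemmas are `exists_cone_multiplier`, `notMem_charSet_locSymbol`,
`isRegularNet_locSymbol` and `isClassicalImage_locSymbol`.

The substance is WF_g ⊆ W_sc, a microlocal elliptic regularity statement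
(`isMicroRegular_of_elliptic`), proved without constructing a parametrix. Let w = ψu be cut off and
let g be an amplitude supported near x₀. The Fourier transform at ξ of g · a(x,D)w is (2π)⁻ⁿ ∫ ŵ(η)
F(ga(·,η))(ξ-η) dη. It decreases rapidly with one power of ε because a(x,D)u is regular
(`pairing_regular`). Taylor expansion of the symbol at η = ξ (`expansion_remainder`) turns it into
F(w g a(·,ξ))(ξ) plus terms with j ≥ 1 mixed derivatives, each smaller by ⟨ξ⟩^(-j), plus a
remainder. With g = h/a(·,ξ), the frequency being frozen, the leading term is F(wh)(ξ). Each round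
of this argument gains one power of ⟨ξ⟩ (`elliptic_bootstrap`).

The power of ε must not grow with the number of rounds. The remainder sees w only through its sup
norm, of size ε^(-P). All constants from the symbol and from division by it are O(ε^(-δ)) for every
δ > 0, a class stable under products. The total loss thus stays below ε^(-Q-1) with a fixed Q for
every order of decay. -/

open MeasureTheory

namespace Colombeau

noncomputable section

/-! ### The Japanese bracket -/

section Bracket

variable {n : ℕ}

theorem one_le_bracket (ξ : E n) : 1 ≤ bracket ξ := by
  rw [bracket, Real.one_le_sqrt]
  nlinarith [sq_nonneg ‖ξ‖]

theorem bracket_pos (ξ : E n) : 0 < bracket ξ := one_pos.trans_le (one_le_bracket ξ)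

theorem bracket_sq (ξ : E n) : bracket ξ ^ 2 = 1 + ‖ξ‖ ^ 2 :=
  Real.sq_sqrt (by positivity)

theorem norm_le_bracket (ξ : E n) : ‖ξ‖ ≤ bracket ξ := by
  refine Real.le_sqrt_of_sq_le ?_
  linarith

theorem bracket_le_one_add_norm (ξ : E n) : bracket ξ ≤ 1 + ‖ξ‖ :=
  sqrt_one_add_norm_sq_le ξ

theorem bracket_le_of_norm_le {ξ ζ : E n} (h : ‖ξ‖ ≤ ‖ζ‖) : bracket ξ ≤ bracket ζ := by
  unfold bracket
  gcongr

theorem bracket_add_le (ξ ζ : E n) : bracket (ξ + ζ) ≤ 2 * bracket ξ * bracket ζ := by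
  have h1 := bracket_sq ξ
  have h2 := bracket_sq ζ
  have h3 := bracket_sq (ξ + ζ)
  have h4 := norm_add_le ξ ζ
  have h5 : ‖ξ + ζ‖ ^ 2 ≤ (‖ξ‖ + ‖ζ‖) ^ 2 := by gcongr
  have h6 := (bracket_pos ξ).le
  have h7 := (bracket_pos ζ).le
  refine abs_le_of_sq_le_sq' (a := bracket (ξ + ζ)) ?_ (by positivity) |>.2
  rw [mul_pow, mul_pow, h1, h2, h3]
  nlinarith [sq_nonneg (‖ξ‖ - ‖ζ‖), sq_nonneg (‖ξ‖ * ‖ζ‖), sq_nonneg ‖ξ‖, sq_nonneg ‖ζ‖]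

/-- Peetre's inequality. -/
theorem peetre (ξ ζ : E n) {r : ℝ} (hr : 0 ≤ r) :
    bracket (ξ + ζ) ^ (-r) ≤ 2 ^ r * bracket ξ ^ (-r) * bracket ζ ^ r := by
  -- The case r = 1, from ξ = (ξ + ζ) + (-ζ).
  have h0 : bracket ξ ≤ 2 * bracket (ξ + ζ) * bracket ζ := by
    have := bracket_add_le (ξ + ζ) (-ζ)
    have h2 : bracket (-ζ) = bracket ζ := by simp [bracket]
    rwa [h2, add_neg_cancel_right] at this
  have h1 := bracket_pos ξ
  have h2 := bracket_pos ζ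
  have h3 := bracket_pos (ξ + ζ)
  have h4 : bracket ξ ^ r ≤ 2 ^ r * bracket (ξ + ζ) ^ r * bracket ζ ^ r := by
    rw [← Real.mul_rpow (by positivity) (by positivity),
      ← Real.mul_rpow (by positivity) (by positivity)]
    exact Real.rpow_le_rpow h1.le h0 hr
  rw [Real.rpow_neg h3.le, Real.rpow_neg h1.le]
  have h5 := Real.rpow_pos_of_pos h1 r
  have h6 := Real.rpow_pos_of_pos h3 r
  rw [inv_le_iff_one_le_mul₀ h6]
  calc (1 : ℝ) = bracket ξ ^ r * (bracket ξ ^ r)⁻¹ := (mul_inv_cancel₀ h5.ne').symm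
    _ ≤ (2 ^ r * bracket (ξ + ζ) ^ r * bracket ζ ^ r) * (bracket ξ ^ r)⁻¹ := by gcongr
    _ = _ := by ring

theorem continuous_bracket : Continuous (bracket : E n → ℝ) := by
  unfold bracket
  fun_prop

theorem continuous_bracket_rpow (r : ℝ) : Continuous fun ξ : E n => bracket ξ ^ r :=
  continuous_bracket.rpow_const fun ξ => Or.inl (bracket_pos ξ).ne'

theorem integrable_bracket_rpow {r : ℝ} (hr : (n : ℝ) < r) :
    Integrable fun ξ : E n => bracket ξ ^ (-r) := by
  have h := integrable_rpow_neg_one_add_norm_sq (E := E n) (μ := volume) (r := r)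
    (by simpa using hr)
  refine h.congr (Filter.Eventually.of_forall fun ξ => ?_)
  simp only [bracket]
  rw [Real.sqrt_eq_rpow, ← Real.rpow_mul (by positivity)]
  congr 1
  ring

theorem bracket_rpow_le_rpow (ξ : E n) {r s : ℝ} (h : r ≤ s) : bracket ξ ^ r ≤ bracket ξ ^ s :=
  Real.rpow_le_rpow_of_exponent_le (one_le_bracket ξ) h

end Bracket

/-! ### Iterated directional derivatives -/

section DirectionalDerivatives

variable {F : Type*} [NormedAddCommGroup F] [NormedSpace ℝ F] {J : Type*}

/-- The iterated directional derivative of `f` in the directions `v j`, `j ∈ l`; the head of the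
list is applied first. -/
def dirD (v : J → F) : List J → (F → ℂ) → F → ℂ
  | [], f => f
  | j :: l, f => dirD v l fun x => fderiv ℝ f x (v j)

/-- The standard basis vectors of `ℝⁿ`. -/
def stdB {n : ℕ} (i : Fin n) : E n := EuclideanSpace.single i (1 : ℝ)

end DirectionalDerivatives

/-! ### Fourier transforms of test functions: decay, inversion, convolution -/

section Fourier

variable {n : ℕ}

theorem norm_cexp_I (t : ℝ) : ‖Complex.exp (Complex.I * (t : ℂ))‖ = 1 :=
  Complex.norm_exp_I_mul_ofReal t

theorem norm_cexp_neg_I (t : ℝ) : ‖Complex.exp (-(Complex.I * (t : ℂ)))‖ = 1 := by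
  have := norm_cexp_I (-t)
  simpa using this

theorem fourierT_eq (u : E n → ℂ) (ξ : E n) :
    fourierT u ξ = FourierTransform.fourier u ((2 * Real.pi)⁻¹ • ξ) := by
  rw [fourierT, Real.fourier_eq']
  congr 1
  ext y
  rw [inner_smul_right, smul_eq_mul]
  congr 2
  have : (Real.pi : ℂ) ≠ 0 := by exact_mod_cast Real.pi_ne_zero
  push_cast
  field_simp

theorem norm_fourierT_le {K : Set (E n)} (hK : IsCompact K) {h : E n → ℂ}
    (h0 : ∀ x, x ∉ K → h x = 0) {B : ℝ} (hB : ∀ x, ‖h x‖ ≤ B) (ζ : E n) :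
    ‖fourierT h ζ‖ ≤ volume.real K * B := by
  have hfin : volume K < ⊤ := hK.measure_lt_top
  have h1 : fourierT h ζ
      = ∫ y in K, Complex.exp (-(Complex.I * ((inner ℝ y ζ : ℝ) : ℂ))) * h y := by
    rw [fourierT, setIntegral_eq_integral_of_forall_compl_eq_zero]
    intro x hx
    simp [h0 x hx]
  rw [h1, mul_comm]
  refine norm_setIntegral_le_of_norm_le_const hfin fun x _ => ?_
  rw [norm_mul, norm_cexp_neg_I, one_mul]
  exact hB x

theorem integrable_of_support {K : Set (E n)} (hK : IsCompact K) {h : E n → ℂ}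
    (hc : Continuous h) (h0 : ∀ x, x ∉ K → h x = 0) : Integrable h :=
  hc.integrable_of_hasCompactSupport (HasCompactSupport.intro hK h0)

theorem fderiv_eq_zero_of_support {F : Type*} [NormedAddCommGroup F] [NormedSpace ℝ F]
    {K : Set F} (hK : IsClosed K) {h : F → ℂ}
    (h0 : ∀ x, x ∉ K → h x = 0) (x : F) (hx : x ∉ K) : fderiv ℝ h x = 0 := by
  have : h =ᶠ[𝓝 x] fun _ => 0 := by
    filter_upwards [hK.isOpen_compl.mem_nhds hx] with y hy using h0 y hy
  rw [this.fderiv_eq]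
  simp

theorem contDiff_fderiv_apply {F : Type*} [NormedAddCommGroup F] [NormedSpace ℝ F]
    {h : F → ℂ} (hh : ContDiff ℝ ∞ h) (v : F) : ContDiff ℝ ∞ fun x => fderiv ℝ h x v :=
  (hh.fderiv_right (m := ∞) (by simp)).clm_apply contDiff_const

theorem hasFDerivAt_cexp_inner (ζ y : E n) :
    HasFDerivAt (fun y : E n => Complex.exp (-(Complex.I * ((inner ℝ y ζ : ℝ) : ℂ))))
      (Complex.exp (-(Complex.I * ((inner ℝ y ζ : ℝ) : ℂ))) •
        (-(Complex.I • (Complex.ofRealCLM.comp (innerSL ℝ ζ))))) y := by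
  refine HasFDerivAt.cexp ?_
  refine HasFDerivAt.fun_neg ?_
  refine HasFDerivAt.const_mul ?_ Complex.I
  have := (Complex.ofRealCLM.comp (innerSL ℝ ζ)).hasFDerivAt (x := y)
  refine this.congr_of_eventuallyEq (Filter.Eventually.of_forall fun z => ?_)
  simp [real_inner_comm]

/-- Integration by parts against the exponential; the compact support of `h` makes all products
integrable. -/
theorem fourierT_fderiv {K : Set (E n)} (hK : IsCompact K) {h : E n → ℂ}
    (hh : ContDiff ℝ ∞ h) (h0 : ∀ x, x ∉ K → h x = 0) (v ζ : E n) :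
    fourierT (fun x => fderiv ℝ h x v) ζ = Complex.I * ((inner ℝ v ζ : ℝ) : ℂ) * fourierT h ζ := by
  unfold fourierT
  set e : E n → ℂ := fun y => Complex.exp (-(Complex.I * ((inner ℝ y ζ : ℝ) : ℂ))) with he
  have hd : ∀ y, HasFDerivAt e _ y := hasFDerivAt_cexp_inner ζ
  have hde : Differentiable ℝ e := fun y => (hd y).differentiableAt
  have hfe : ∀ y, fderiv ℝ e y v = -(Complex.I * ((inner ℝ v ζ : ℝ) : ℂ)) * e y := by
    intro y
    rw [(hd y).fderiv]
    simp [he, real_inner_comm]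
    ring
  have hec : Continuous e := hde.continuous
  have hh' := contDiff_fderiv_apply hh v
  have hz : ∀ x, x ∉ K → fderiv ℝ h x v = 0 := fun x hx => by
    rw [fderiv_eq_zero_of_support hK.isClosed h0 x hx]; simp
  have key := integral_mul_fderiv_eq_neg_fderiv_mul_of_integrable (μ := volume) (f := e) (g := h)
    (v := v) (𝕜 := ℂ)
    (by
      simp only [hfe]
      refine integrable_of_support hK (by have := hh.continuous; fun_prop) fun x hx => ?_
      simp [h0 x hx])
    (by
      refine integrable_of_support hK (by have := hh'.continuous; fun_prop) fun x hx => ?_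
      simp [hz x hx])
    (by
      refine integrable_of_support hK (by have := hh.continuous; fun_prop) fun x hx => ?_
      simp [h0 x hx])
    (fun x _ => hde x) (fun x _ => hh.differentiable (by simp) x)
  rw [key, ← integral_neg, ← integral_const_mul]
  congr 1
  ext y
  rw [hfe]
  ring

theorem bracket_le_one_add_sum (ζ : E n) : bracket ζ ≤ 1 + ∑ i, |ζ i| := by
  refine (bracket_le_one_add_norm ζ).trans ?_
  gcongr
  rw [EuclideanSpace.norm_eq]
  refine Real.sqrt_le_iff.2 ⟨by positivity, ?_⟩
  refine (Finset.sum_le_sum fun i _ => ?_).trans (Finset.sum_sq_le_sq_sum_of_nonneg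
    (f := fun i => |ζ i|) fun i _ => abs_nonneg _)
  simp

/-- Rapid decay of Fourier transforms of smooth functions supported in a fixed compact set. -/
theorem fourierT_decay {K : Set (E n)} (hK : IsCompact K) (M : ℕ) {h : E n → ℂ}
    (hh : ContDiff ℝ ∞ h) (h0 : ∀ x, x ∉ K → h x = 0) {B : ℝ}
    (hB : ∀ l : List (Fin n), l.length ≤ M → ∀ x, ‖dirD stdB l h x‖ ≤ B) (ζ : E n) :
    bracket ζ ^ M * ‖fourierT h ζ‖ ≤ (1 + n) ^ M * volume.real K * B := by
  induction M generalizing h with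
  | zero =>
    simpa using norm_fourierT_le hK h0 (fun x => hB [] le_rfl x) ζ
  | succ M ih =>
    have hpos := bracket_pos ζ
    have h1 : bracket ζ ^ M * ‖fourierT h ζ‖ ≤ (1 + n) ^ M * volume.real K * B :=
      ih hh h0 fun l hl x => hB l (by omega) x
    -- Multiplication by |ζ_i| becomes a derivative of `h`. One more power of ⟨ζ⟩ costs 1 + ∑ |ζ_i|,
    -- that is 1 + n bounds of the previous order.
    have h2 : ∀ i, bracket ζ ^ M * (|ζ i| * ‖fourierT h ζ‖) ≤ (1 + n) ^ M * volume.real K * B := by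
      intro i
      have h3 := ih (h := fun x => fderiv ℝ h x (stdB i)) (contDiff_fderiv_apply hh _)
        (fun x hx => by rw [fderiv_eq_zero_of_support hK.isClosed h0 x hx]; simp)
        fun l hl x => hB (i :: l) (by simpa using hl) x
      rw [fourierT_fderiv hK hh h0] at h3
      simpa [stdB, EuclideanSpace.inner_single_left] using h3
    calc bracket ζ ^ (M + 1) * ‖fourierT h ζ‖
        = bracket ζ ^ M * ‖fourierT h ζ‖ * bracket ζ := by ring
      _ ≤ bracket ζ ^ M * ‖fourierT h ζ‖ * (1 + ∑ i, |ζ i|) := by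
          gcongr
          exact bracket_le_one_add_sum ζ
      _ = bracket ζ ^ M * ‖fourierT h ζ‖
          + ∑ i, bracket ζ ^ M * (|ζ i| * ‖fourierT h ζ‖) := by
          rw [mul_add, mul_one, Finset.mul_sum]
          congr 1
          exact Finset.sum_congr rfl fun i _ => by ring
      _ ≤ (1 + n) ^ M * volume.real K * B
          + ∑ _i : Fin n, (1 + n) ^ M * volume.real K * B := by
          exact add_le_add h1 (Finset.sum_le_sum fun i _ => h2 i)
      _ = _ := by
          simp
          ring

theorem continuous_fourierT {u : E n → ℂ} (hu : Integrable u) : Continuous (fourierT u) := by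
  refine continuous_of_dominated (bound := fun y => ‖u y‖) (fun ξ => ?_) (fun ξ => ?_) hu.norm ?_
  · exact (Continuous.aestronglyMeasurable (by fun_prop)).mul hu.aestronglyMeasurable
  · exact Filter.Eventually.of_forall fun y => by rw [norm_mul, norm_cexp_neg_I, one_mul]
  · exact Filter.Eventually.of_forall fun y => by fun_prop

/-- Over a finite index type there are only finitely many lists of bounded length, so individual
bounds merge into one. -/
theorem exists_uniform_bound {J : Type*} [Finite J] (M : ℕ) {P : List J → ℝ → Prop}
    (hmono : ∀ l B B', B ≤ B' → P l B → P l B') (h : ∀ l, ∃ B, P l B) :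
    ∃ B, 0 ≤ B ∧ ∀ l : List J, l.length ≤ M → P l B := by
  choose B hB using h
  have hfin : {l : List J | l.length ≤ M}.Finite := List.finite_length_le J M
  obtain ⟨C, hC⟩ := (hfin.image B).bddAbove
  refine ⟨max C 0, le_max_right _ _, fun l hl => hmono l (B l) _ ?_ (hB l)⟩
  exact (hC ⟨l, hl, rfl⟩).trans (le_max_left _ _)

section

variable {F : Type*} [NormedAddCommGroup F] [NormedSpace ℝ F] {J : Type*}

theorem contDiff_dirD {v : J → F} (l : List J) {h : F → ℂ} (hh : ContDiff ℝ ∞ h) :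
    ContDiff ℝ ∞ (dirD v l h) := by
  induction l generalizing h with
  | nil => exact hh
  | cons j l ih => exact ih (contDiff_fderiv_apply hh _)

theorem dirD_eq_zero_of_support {v : J → F} {K : Set F} (hK : IsClosed K) (l : List J) {h : F → ℂ}
    (h0 : ∀ x, x ∉ K → h x = 0) (x : F) (hx : x ∉ K) : dirD v l h x = 0 := by
  induction l generalizing h with
  | nil => exact h0 x hx
  | cons j l ih => exact ih fun y hy => by rw [fderiv_eq_zero_of_support hK h0 y hy]; simp

theorem exists_bound_dirD {v : J → F} {K : Set F} (hK : IsCompact K) {h : F → ℂ}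
    (hh : ContDiff ℝ ∞ h) (h0 : ∀ x, x ∉ K → h x = 0) (l : List J) :
    ∃ B, ∀ x, ‖dirD v l h x‖ ≤ B := by
  obtain ⟨B, hB⟩ := hK.exists_bound_of_continuousOn (contDiff_dirD l hh (v := v)).continuous.continuousOn
  refine ⟨max B 0, fun x => ?_⟩
  by_cases hx : x ∈ K
  · exact (hB x hx).trans (le_max_left _ _)
  · rw [dirD_eq_zero_of_support hK.isClosed l h0 x hx, norm_zero]
    exact le_max_right _ _

end

theorem exists_fourierT_decay {K : Set (E n)} (hK : IsCompact K) {h : E n → ℂ}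
    (hh : ContDiff ℝ ∞ h) (h0 : ∀ x, x ∉ K → h x = 0) (r : ℝ) :
    ∃ C, 0 ≤ C ∧ ∀ ζ, ‖fourierT h ζ‖ ≤ C * bracket ζ ^ (-r) := by
  obtain ⟨M, hM⟩ := exists_nat_ge r
  obtain ⟨B, hB0, hB⟩ := exists_uniform_bound M (J := Fin n)
    (P := fun l B => ∀ x, ‖dirD stdB l h x‖ ≤ B) (fun l B B' hBB h x => (h x).trans hBB)
    (exists_bound_dirD hK hh h0)
  refine ⟨(1 + n) ^ M * volume.real K * B, by positivity, fun ζ => ?_⟩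
  have h1 := fourierT_decay hK M hh h0 hB ζ
  have h2 : bracket ζ ^ (-(M : ℝ)) ≤ bracket ζ ^ (-r) := bracket_rpow_le_rpow ζ (by linarith)
  have h3 := bracket_pos ζ
  have h4 : bracket ζ ^ (-(M : ℝ)) * bracket ζ ^ M = 1 := by
    rw [Real.rpow_neg h3.le, Real.rpow_natCast, inv_mul_cancel₀ (by positivity)]
  calc ‖fourierT h ζ‖ = bracket ζ ^ (-(M : ℝ)) * (bracket ζ ^ M * ‖fourierT h ζ‖) := by
        rw [← mul_assoc, h4, one_mul]
    _ ≤ bracket ζ ^ (-r) * ((1 + n) ^ M * volume.real K * B) := by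
        gcongr
    _ = _ := mul_comm _ _

theorem integrable_of_le_bracket {f : E n → ℂ} (hf : AEStronglyMeasurable f) {C r : ℝ}
    (hr : (n : ℝ) < r) (h : ∀ ζ, ‖f ζ‖ ≤ C * bracket ζ ^ (-r)) : Integrable f :=
  ((integrable_bracket_rpow hr).const_mul C).mono' hf (Filter.Eventually.of_forall h)

theorem integrable_fourierT {K : Set (E n)} (hK : IsCompact K) {h : E n → ℂ}
    (hh : ContDiff ℝ ∞ h) (h0 : ∀ x, x ∉ K → h x = 0) : Integrable (fourierT h) := by
  obtain ⟨C, _, hC⟩ := exists_fourierT_decay hK hh h0 (n + 1)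
  exact integrable_of_le_bracket
    (continuous_fourierT (integrable_of_support hK hh.continuous h0)).aestronglyMeasurable
    (lt_add_one _) hC

/-- `(2π)⁻ⁿ`. -/
def twoPiInv (n : ℕ) : ℂ := (((2 * Real.pi) ^ n : ℝ) : ℂ)⁻¹

/-- Fourier inversion. -/
theorem quantize_one {K : Set (E n)} (hK : IsCompact K) {w : E n → ℂ}
    (hw : ContDiff ℝ ∞ w) (w0 : ∀ x, x ∉ K → w x = 0) (x : E n) :
    quantize (fun _ _ => 1) w x = w x := by
  have hi := integrable_of_support hK hw.continuous w0
  have hfi := integrable_fourierT hK hw w0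
  have hpi : (2 * Real.pi) ≠ 0 := by positivity
  have hF : (FourierTransform.fourier w : E n → ℂ) = fun ξ => fourierT w ((2 * Real.pi) • ξ) := by
    funext ξ
    rw [fourierT_eq, smul_smul, inv_mul_cancel₀ hpi, one_smul]
  have hFi : Integrable (FourierTransform.fourier w : E n → ℂ) := by
    rw [hF]
    exact (integrable_comp_smul_iff volume (fourierT w) hpi).2 hfi
  have key := congrFun (hw.continuous.fourierInv_fourier_eq hi hFi) x
  rw [Real.fourierInv_eq', hF] at key
  rw [← key, quantize]
  -- The dilation by 2π translates between the two normalizations of the Fourier transform; its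
  -- Jacobian is the factor (2π)⁻ⁿ.
  have h1 := Measure.integral_comp_smul volume (fun ξ : E n =>
    Complex.exp (Complex.I * ((inner ℝ x ξ : ℝ) : ℂ)) * 1 * fourierT w ξ) (2 * Real.pi)
  rw [finrank_euclideanSpace_fin, abs_of_pos (by positivity)] at h1
  rw [← Complex.ofReal_inv, ← Complex.real_smul, ← h1]
  congr 1
  ext ξ
  rw [inner_smul_right, smul_eq_mul, mul_one, real_inner_comm]
  congr 2
  push_cast
  ring

/-- Fubini's theorem for a quantized symbol tested with an amplitude and an exponential. -/
theorem fourierT_quantize_mul {K : Set (E n)} (hK : IsCompact K) {a : E n → E n → ℂ}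
    {w h : E n → ℂ} (hwc : Continuous (fourierT w)) (hw : Integrable (fourierT w))
    (hc : Continuous fun p : E n × E n => a p.1 p.2 * h p.1) (h0 : ∀ x, x ∉ K → h x = 0) {B : ℝ}
    (hB : ∀ x ξ, ‖a x ξ * h x‖ ≤ B) (ξ : E n) :
    Integrable (fun x => Complex.exp (-(Complex.I * ((inner ℝ x ξ : ℝ) : ℂ))) *
      (quantize a w x * h x)) ∧
    fourierT (fun x => quantize a w x * h x) ξ
      = twoPiInv n * ∫ η, fourierT w η * fourierT (fun x => a x η * h x) (ξ - η) := by
  -- Continuity and boundedness are required of the product of `a` and `h` only: symbols are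
  -- controlled over Ω alone, and `h` cuts off the rest.
  set Φ : E n → E n → ℂ := fun x η => Complex.exp (-(Complex.I * ((inner ℝ x (ξ - η) : ℝ) : ℂ))) *
    (a x η * h x) * fourierT w η with hΦ
  have hΦc : Continuous (Function.uncurry Φ) := by
    simp only [hΦ, Function.uncurry_def]
    have h2 : Continuous fun p : E n × E n => fourierT w p.2 := hwc.comp continuous_snd
    have h3 : Continuous fun p : E n × E n =>
      Complex.exp (-(Complex.I * ((inner ℝ p.1 (ξ - p.2) : ℝ) : ℂ))) := by fun_prop
    exact (h3.mul hc).mul h2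
  have hΦi : Integrable (Function.uncurry Φ) (volume.prod volume) := by
    have hg : Integrable (fun p : E n × E n => (K.indicator (fun _ => B) p.1) * ‖fourierT w p.2‖)
        (volume.prod volume) :=
      Integrable.mul_prod ((integrable_indicator_iff hK.measurableSet).2
        (integrableOn_const hK.measure_lt_top.ne)) hw.norm
    refine hg.mono' hΦc.aestronglyMeasurable (Filter.Eventually.of_forall fun p => ?_)
    simp only [hΦ, Function.uncurry_def]
    rw [norm_mul, norm_mul, norm_cexp_neg_I, one_mul]
    by_cases hp : p.1 ∈ K
    · rw [Set.indicator_of_mem hp]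
      gcongr
      exact hB _ _
    · simp [h0 _ hp, Set.indicator_of_notMem hp]
  have hx : ∀ x, Complex.exp (-(Complex.I * ((inner ℝ x ξ : ℝ) : ℂ))) * (quantize a w x * h x)
      = twoPiInv n * ∫ η, Φ x η := by
    intro x
    rw [quantize, ← integral_const_mul, ← integral_mul_const, ← integral_const_mul,
      ← integral_const_mul]
    congr 1
    ext η
    simp only [hΦ]
    rw [inner_sub_right]
    push_cast
    rw [show -(Complex.I * (((inner ℝ x ξ : ℝ) : ℂ) - ((inner ℝ x η : ℝ) : ℂ)))
      = -(Complex.I * ((inner ℝ x ξ : ℝ) : ℂ)) + Complex.I * ((inner ℝ x η : ℝ) : ℂ) by ring,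
      Complex.exp_add, twoPiInv]
    push_cast
    ring
  constructor
  · simp_rw [hx]
    exact hΦi.integral_prod_left.const_mul _
  · rw [fourierT]
    simp_rw [hx]
    rw [integral_const_mul, integral_integral_swap hΦi]
    congr 2
    ext η
    rw [fourierT.eq_def (fun x => a x η * h x), ← integral_const_mul]
    congr 1
    ext x
    simp only [hΦ]
    ring

/-- The convolution theorem is the previous Fubini argument for the symbol 1, whose quantization is
the identity by Fourier inversion. -/
theorem fourierT_mul {K K' : Set (E n)} (hK : IsCompact K) (hK' : IsCompact K') {w h : E n → ℂ}
    (hw : ContDiff ℝ ∞ w) (w0 : ∀ x, x ∉ K' → w x = 0)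
    (hh : ContDiff ℝ ∞ h) (h0 : ∀ x, x ∉ K → h x = 0) (ξ : E n) :
    fourierT (fun x => w x * h x) ξ
      = twoPiInv n * ∫ η, fourierT w η * fourierT h (ξ - η) := by
  obtain ⟨B, hB⟩ := exists_bound_dirD (v := stdB) hK hh h0 []
  have h1 := (fourierT_quantize_mul hK (a := fun _ _ => 1) (w := w) (h := h)
    (continuous_fourierT (integrable_of_support hK' hw.continuous w0))
    (integrable_fourierT hK' hw w0) (by have := hh.continuous; fun_prop) h0
    (B := B) (fun x _ => by simpa [dirD] using hB x) ξ).2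
  simpa only [quantize_one hK' hw w0, one_mul] using h1

end Fourier

/-! ### Calculus of iterated directional derivatives -/

section DirDerivCalculus

variable {F F' : Type*} [NormedAddCommGroup F] [NormedSpace ℝ F] [NormedAddCommGroup F']
  [NormedSpace ℝ F'] {J J' : Type*} {v : J → F} {O : Set F} {f g : F → ℂ}

@[simp] theorem dirD_nil : dirD v [] f = f := rfl

theorem dirD_cons (j : J) (l : List J) :
    dirD v (j :: l) f = dirD v l fun x => fderiv ℝ f x (v j) := rfl

theorem contDiffOn_fderiv_apply (hO : IsOpen O) (hf : ContDiffOn ℝ ∞ f O) (w : F) :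
    ContDiffOn ℝ ∞ (fun x => fderiv ℝ f x w) O :=
  (hf.fderiv_of_isOpen hO (m := ∞) (by simp)).clm_apply contDiffOn_const

theorem differentiableAt_of_contDiffOn (hO : IsOpen O) (hf : ContDiffOn ℝ ∞ f O) {x : F}
    (hx : x ∈ O) : DifferentiableAt ℝ f x :=
  (hf.contDiffAt (hO.mem_nhds hx)).differentiableAt (by simp)

theorem fderiv_eqOn (hO : IsOpen O) (h : Set.EqOn f g O) (w : F) :
    Set.EqOn (fun x => fderiv ℝ f x w) (fun x => fderiv ℝ g x w) O := fun x hx => by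
  have : f =ᶠ[𝓝 x] g := Filter.eventuallyEq_of_mem (hO.mem_nhds hx) h
  simp only [this.fderiv_eq]

theorem dirD_eqOn (hO : IsOpen O) (h : Set.EqOn f g O) (l : List J) :
    Set.EqOn (dirD v l f) (dirD v l g) O := by
  induction l generalizing f g with
  | nil => exact h
  | cons j l ih => exact ih (fderiv_eqOn hO h _)

theorem contDiffOn_dirD (hO : IsOpen O) (hf : ContDiffOn ℝ ∞ f O) (l : List J) :
    ContDiffOn ℝ ∞ (dirD v l f) O := by
  induction l generalizing f with
  | nil => exact hf
  | cons j l ih => exact ih (contDiffOn_fderiv_apply hO hf _)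

theorem dirD_add (hO : IsOpen O) (hf : ContDiffOn ℝ ∞ f O) (hg : ContDiffOn ℝ ∞ g O)
    (l : List J) : Set.EqOn (dirD v l (fun x => f x + g x))
      (fun x => dirD v l f x + dirD v l g x) O := by
  induction l generalizing f g with
  | nil => exact fun _ _ => rfl
  | cons j l ih =>
    intro x hx
    have h1 : Set.EqOn (fun x => fderiv ℝ (fun x => f x + g x) x (v j))
        (fun x => fderiv ℝ f x (v j) + fderiv ℝ g x (v j)) O := fun y hy => by
      simp only
      rw [fderiv_fun_add (differentiableAt_of_contDiffOn hO hf hy)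
        (differentiableAt_of_contDiffOn hO hg hy)]
      rfl
    rw [dirD_cons, dirD_eqOn hO h1 l hx, ih (contDiffOn_fderiv_apply hO hf _)
      (contDiffOn_fderiv_apply hO hg _) hx]
    rfl

theorem dirD_const_mul (c : ℂ) (l : List J) :
    dirD v l (fun x => c * f x) = fun x => c * dirD v l f x := by
  induction l generalizing f with
  | nil => rfl
  | cons j l ih =>
    rw [dirD_cons]
    have : (fun x => fderiv ℝ (fun x => c * f x) x (v j)) = fun x => c * fderiv ℝ f x (v j) := by
      funext x
      have := congrFun (fderiv_const_smul_field (𝕜 := ℝ) c (f := f)) x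
      have h2 : (fun x => c * f x) = c • f := rfl
      rw [h2, this]
      rfl
    rw [this, ih, dirD_cons]

theorem dirD_append (l₁ l₂ : List J) : dirD v (l₁ ++ l₂) f = dirD v l₂ (dirD v l₁ f) := by
  induction l₁ generalizing f with
  | nil => rfl
  | cons j l ih => exact ih

theorem dirD_map (φ : J' → J) (l : List J') : dirD v (l.map φ) f = dirD (v ∘ φ) l f := by
  induction l generalizing f with
  | nil => rfl
  | cons j l ih => exact ih

theorem fderiv_fderiv_comm (hO : IsOpen O) (hf : ContDiffOn ℝ ∞ f O) (w z : F) :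
    Set.EqOn (fun x => fderiv ℝ (fun y => fderiv ℝ f y w) x z)
      (fun x => fderiv ℝ (fun y => fderiv ℝ f y z) x w) O := by
  intro x hx
  have hfx : ContDiffAt ℝ ∞ f x := hf.contDiffAt (hO.mem_nhds hx)
  have hd : DifferentiableAt ℝ (fderiv ℝ f) x :=
    (hfx.fderiv_right (m := 1) (by norm_cast)).differentiableAt (by simp)
  have hs : IsSymmSndFDerivAt ℝ f x := hfx.isSymmSndFDerivAt (by
    rw [minSmoothness_of_isRCLikeNormedField]
    have : ∀ k : ℕ, (k : WithTop ℕ∞) ≤ ∞ := fun k => by exact_mod_cast le_top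
    exact this 2)
  have h1 : ∀ u : F, fderiv ℝ (fun y => fderiv ℝ f y u) x
      = (fderiv ℝ (fderiv ℝ f) x).flip u := fun u => by
    rw [fderiv_clm_apply hd (differentiableAt_const u)]
    simp
  simp only [h1]
  exact hs.eq z w

/-- Schwarz's theorem. It lets any derivative be moved to the front of the list. -/
theorem dirD_perm (hO : IsOpen O) {l l' : List J} (hl : l.Perm l') (hf : ContDiffOn ℝ ∞ f O) :
    Set.EqOn (dirD v l f) (dirD v l' f) O := by
  induction hl generalizing f with
  | nil => exact fun _ _ => rfl
  | cons j _ ih => exact ih (contDiffOn_fderiv_apply hO hf _)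
  | swap j k l => exact dirD_eqOn hO (fderiv_fderiv_comm hO hf _ _) l
  | trans _ _ ih1 ih2 => exact (ih1 hf).trans (ih2 hf)

theorem iteratedFDeriv_apply_eq_dirD (hO : IsOpen O) (hf : ContDiffOn ℝ ∞ f O) (k : ℕ)
    (m : Fin k → F) {x : F} (hx : x ∈ O) :
    iteratedFDeriv ℝ k f x m = dirD id (List.ofFn m) f x := by
  induction k generalizing x with
  | zero => simp
  | succ k ih =>
    have hd : DifferentiableAt ℝ (iteratedFDeriv ℝ k f) x :=
      (hf.contDiffAt (hO.mem_nhds hx)).differentiableAt_iteratedFDeriv (by exact_mod_cast WithTop.coe_lt_top k)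
    rw [hd.iteratedFDeriv_succ_apply_left',
      show fderiv ℝ (fun y => (iteratedFDeriv ℝ k f y) (Fin.tail m)) x (m 0) = _ from
        fderiv_eqOn hO (fun y hy => ih (Fin.tail m) hy) (m 0) hx, List.ofFn_succ]
    -- `dirD` differentiates along the head first, while argument 0 of `iteratedFDeriv` belongs to
    -- the last differentiation; symmetry reconciles the two orders.
    have h2 := dirD_perm (v := id) hO (f := f) (l := m 0 :: List.ofFn fun i => m i.succ)
      (l' := (List.ofFn fun i => m i.succ) ++ [m 0]) (List.perm_append_singleton _ _).symm hf hx
    rw [h2, dirD_append]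
    rfl

theorem norm_dirD_le (hO : IsOpen O) (hf : ContDiffOn ℝ ∞ f O) (l : List J) {x : F} (hx : x ∈ O) :
    ‖dirD v l f x‖ ≤ ‖iteratedFDeriv ℝ l.length f x‖ * ∏ i, ‖v (l.get i)‖ := by
  have h : dirD v l f x = iteratedFDeriv ℝ l.length f x (fun i => v (l.get i)) := by
    rw [iteratedFDeriv_apply_eq_dirD hO hf _ _ hx]
    have h1 : (List.ofFn fun i => v (l.get i)) = l.map v := by
      conv_rhs => rw [← List.ofFn_get l, List.map_ofFn]
      rfl
    rw [h1, dirD_map]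
    rfl
  rw [h]
  exact ContinuousMultilinearMap.le_opNorm _ _

/-- Serves the slices and projections of phase space and the rescaling in
`isMultiplier_comp_div_bracket`. -/
theorem dirD_comp_affine (hO : IsOpen O) (hf : ContDiffOn ℝ ∞ f O) {w : J → F'} (L : F' →L[ℝ] F)
    (c : F) (l : List J) {x : F'} (hx : L x + c ∈ O) :
    dirD w l (fun y => f (L y + c)) x = dirD (L ∘ w) l f (L x + c) := by
  induction l generalizing f with
  | nil => rfl
  | cons j l ih =>
    rw [dirD_cons, dirD_cons, ← ih (contDiffOn_fderiv_apply hO hf _)]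
    have hO' : IsOpen ((fun y => L y + c) ⁻¹' O) := hO.preimage (by fun_prop)
    refine dirD_eqOn hO' (fun y hy => ?_) l hx
    have h1 : HasFDerivAt (fun y => L y + c) L y := L.hasFDerivAt.add_const c
    have h2 : HasFDerivAt f (fderiv ℝ f (L y + c)) (L y + c) :=
      (differentiableAt_of_contDiffOn hO hf hy).hasFDerivAt
    have h3 := h2.comp y h1
    have h4 : fderiv ℝ (fun y => f (L y + c)) y = (fderiv ℝ f (L y + c)).comp L := h3.fderiv
    simp [h4]

end DirDerivCalculus

/-! ### Slow families of constants and of functions -/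

section SlowClass

variable {ι : Type*} {e : ι → Eps}

/-- Families of nonnegative numbers that are `O(ε^{-δ})` as `ε → 0` for every `δ > 0`. -/
def Slow (e : ι → Eps) (σ : ι → ℝ) : Prop :=
  (∀ i, 0 ≤ σ i) ∧ ∀ δ : ℝ, 0 < δ → ∃ C : ℝ, 0 ≤ C ∧ ∃ η : ℝ, 0 < η ∧
    ∀ i, (e i : ℝ) < η → σ i ≤ C * (e i : ℝ) ^ (-δ)

theorem one_le_eps_rpow (ε : Eps) {δ : ℝ} (hδ : 0 ≤ δ) : 1 ≤ (ε : ℝ) ^ (-δ) :=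
  Real.one_le_rpow_of_pos_of_le_one_of_nonpos ε.pos ε.le_one (by linarith)

theorem Slow.const {c : ℝ} (hc : 0 ≤ c) : Slow e fun _ => c :=
  ⟨fun _ => hc, fun _ hδ => ⟨c, hc, 1, one_pos, fun _ _ => le_mul_of_one_le_right hc
    (one_le_eps_rpow _ hδ.le)⟩⟩

theorem Slow.add {σ τ : ι → ℝ} (hσ : Slow e σ) (hτ : Slow e τ) : Slow e fun i => σ i + τ i := by
  refine ⟨fun i => add_nonneg (hσ.1 i) (hτ.1 i), fun δ hδ => ?_⟩
  obtain ⟨C, hC, η, hη, h1⟩ := hσ.2 δ hδ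
  obtain ⟨D, hD, θ, hθ, h2⟩ := hτ.2 δ hδ
  refine ⟨C + D, by positivity, min η θ, lt_min hη hθ, fun i hi => ?_⟩
  rw [add_mul]
  exact add_le_add (h1 i (hi.trans_le (min_le_left _ _))) (h2 i (hi.trans_le (min_le_right _ _)))

/-- Each factor gets half of δ. This stability is the point of the class: finitely many
multiplications still lose only an arbitrarily small power of ε. -/
theorem Slow.mul {σ τ : ι → ℝ} (hσ : Slow e σ) (hτ : Slow e τ) : Slow e fun i => σ i * τ i := by
  refine ⟨fun i => mul_nonneg (hσ.1 i) (hτ.1 i), fun δ hδ => ?_⟩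
  obtain ⟨C, hC, η, hη, h1⟩ := hσ.2 (δ / 2) (by positivity)
  obtain ⟨D, hD, θ, hθ, h2⟩ := hτ.2 (δ / 2) (by positivity)
  refine ⟨C * D, by positivity, min η θ, lt_min hη hθ, fun i hi => ?_⟩
  have hp := (e i).pos
  calc σ i * τ i ≤ (C * (e i : ℝ) ^ (-(δ / 2))) * (D * (e i : ℝ) ^ (-(δ / 2))) :=
        mul_le_mul (h1 i (hi.trans_le (min_le_left _ _))) (h2 i (hi.trans_le (min_le_right _ _)))
          (hτ.1 i) (by positivity)
    _ = C * D * ((e i : ℝ) ^ (-(δ / 2)) * (e i : ℝ) ^ (-(δ / 2))) := by ring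
    _ = _ := by
        rw [← Real.rpow_add hp]
        congr 2
        ring

theorem Slow.pow {σ : ι → ℝ} (hσ : Slow e σ) (m : ℕ) : Slow e fun i => σ i ^ m := by
  induction m with
  | zero => simpa using Slow.const (e := e) zero_le_one
  | succ m ih => simpa [pow_succ] using ih.mul hσ

/-- The slow scale condition for the exponent p = 1/δ, raised to the power δ. -/
theorem IsSlowScale.slow {s : Eps → ℝ} (hs : IsSlowScale s) : Slow e fun i => s (e i) := by
  obtain ⟨⟨c, hc, hcs⟩, h⟩ := hs
  have h0 : ∀ ε, 0 < s ε := fun ε => hc.trans_le (hcs ε)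
  refine ⟨fun i => (h0 _).le, fun δ hδ => ?_⟩
  obtain ⟨A, hA, hAs⟩ := h δ⁻¹ (by positivity)
  refine ⟨A ^ δ, by positivity, 1, one_pos, fun i _ => ?_⟩
  have h1 := Real.rpow_le_rpow (Real.rpow_nonneg (h0 _).le _) (hAs (e i)) hδ.le
  rwa [← Real.rpow_mul (h0 _).le, inv_mul_cancel₀ hδ.ne', Real.rpow_one,
    Real.mul_rpow hA.le (inv_nonneg.2 (e i).pos.le), Real.inv_rpow (e i).pos.le,
    ← Real.rpow_neg (e i).pos.le] at h1

variable {F F' : Type*} [NormedAddCommGroup F] [NormedSpace ℝ F] [NormedAddCommGroup F']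
  [NormedSpace ℝ F'] {J J' : Type*} {v : J → F} {O : Set F} {ρ : J → F → ℝ}
  {W W' : ι → F → ℝ} {f g : ι → F → ℂ}

/-- The bound for a single iterated directional derivative of a family of functions: a slow factor
times the weight `W`, times one further weight `ρ j` per derivative. -/
def SlowBound (e : ι → Eps) (v : J → F) (O : Set F) (ρ : J → F → ℝ) (W : ι → F → ℝ)
    (l : List J) (f : ι → F → ℂ) : Prop :=
  ∃ σ, Slow e σ ∧ ∀ i, ∀ p ∈ O,
    ‖dirD v l (f i) p‖ ≤ σ i * (W i p * (l.map fun j => ρ j p).prod)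

/-- Families of smooth functions on `O` all of whose derivatives are slowly bounded. -/
def SlowFam (e : ι → Eps) (v : J → F) (O : Set F) (ρ : J → F → ℝ) (W : ι → F → ℝ)
    (f : ι → F → ℂ) : Prop :=
  (∀ i, ContDiffOn ℝ ∞ (f i) O) ∧ ∀ l, SlowBound e v O ρ W l f

theorem SlowBound.congr (hO : IsOpen O) {l : List J} (h : SlowBound e v O ρ W l f)
    (hfg : ∀ i, Set.EqOn (f i) (g i) O) : SlowBound e v O ρ W l g := by
  obtain ⟨σ, hσ, h⟩ := h
  exact ⟨σ, hσ, fun i p hp => by rw [← dirD_eqOn hO (hfg i) l hp]; exact h i p hp⟩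

theorem SlowBound.mono {τ : ι → ℝ} (hτ : Slow e τ) (hρ : ∀ j, ∀ p ∈ O, 0 ≤ ρ j p)
    (hW : ∀ i, ∀ p ∈ O, W i p ≤ τ i * W' i p) {l : List J} (h : SlowBound e v O ρ W l f) :
    SlowBound e v O ρ W' l f := by
  obtain ⟨σ, hσ, h⟩ := h
  refine ⟨_, hσ.mul hτ, fun i p hp => (h i p hp).trans ?_⟩
  have h1 : 0 ≤ (l.map fun j => ρ j p).prod := List.prod_nonneg fun a ha => by
    obtain ⟨j, _, rfl⟩ := List.mem_map.1 ha
    exact hρ j p hp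
  rw [mul_assoc, ← mul_assoc (τ i)]
  exact mul_le_mul_of_nonneg_left (mul_le_mul_of_nonneg_right (hW i p hp) h1) (hσ.1 i)

theorem SlowFam.mono {τ : ι → ℝ} (hτ : Slow e τ) (hρ : ∀ j, ∀ p ∈ O, 0 ≤ ρ j p)
    (hW : ∀ i, ∀ p ∈ O, W i p ≤ τ i * W' i p) (h : SlowFam e v O ρ W f) :
    SlowFam e v O ρ W' f :=
  ⟨h.1, fun l => (h.2 l).mono hτ hρ hW⟩

theorem SlowBound.add (hO : IsOpen O) (hf : ∀ i, ContDiffOn ℝ ∞ (f i) O)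
    (hg : ∀ i, ContDiffOn ℝ ∞ (g i) O) {l : List J} (h : SlowBound e v O ρ W l f)
    (h' : SlowBound e v O ρ W l g) : SlowBound e v O ρ W l fun i p => f i p + g i p := by
  obtain ⟨σ, hσ, h⟩ := h
  obtain ⟨τ, hτ, h'⟩ := h'
  refine ⟨_, hσ.add hτ, fun i p hp => ?_⟩
  rw [dirD_add hO (hf i) (hg i) l hp, add_mul]
  exact (norm_add_le _ _).trans (add_le_add (h i p hp) (h' i p hp))

theorem SlowFam.add (hO : IsOpen O) (h : SlowFam e v O ρ W f) (h' : SlowFam e v O ρ W g) :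
    SlowFam e v O ρ W fun i p => f i p + g i p :=
  ⟨fun i => (h.1 i).add (h'.1 i), fun l => (h.2 l).add hO h.1 h'.1 (h'.2 l)⟩

theorem SlowBound.const_mul (c : ℂ) {l : List J} (h : SlowBound e v O ρ W l f) :
    SlowBound e v O ρ W l fun i p => c * f i p := by
  obtain ⟨σ, hσ, h⟩ := h
  refine ⟨_, (Slow.const (norm_nonneg c)).mul hσ, fun i p hp => ?_⟩
  rw [dirD_const_mul, norm_mul, mul_assoc]
  exact mul_le_mul_of_nonneg_left (h i p hp) (norm_nonneg c)

theorem SlowFam.const_mul (c : ℂ) (h : SlowFam e v O ρ W f) :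
    SlowFam e v O ρ W fun i p => c * f i p :=
  ⟨fun i => contDiffOn_const.mul (h.1 i), fun l => (h.2 l).const_mul c⟩

theorem SlowFam.zero (hW : ∀ i, ∀ p ∈ O, 0 ≤ W i p) (hρ : ∀ j, ∀ p ∈ O, 0 ≤ ρ j p) :
    SlowFam e v O ρ W fun _ _ => 0 := by
  refine ⟨fun i => contDiffOn_const, fun l => ⟨_, Slow.const zero_le_one, fun i p hp => ?_⟩⟩
  have h := congrFun (dirD_const_mul (v := v) (f := fun _ => (0 : ℂ)) 0 l) p
  simp only [zero_mul] at h
  rw [h, norm_zero, one_mul]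
  refine mul_nonneg (hW i p hp) (List.prod_nonneg fun a ha => ?_)
  obtain ⟨j, _, rfl⟩ := List.mem_map.1 ha
  exact hρ j p hp

theorem SlowFam.sum (hO : IsOpen O) (hW : ∀ i, ∀ p ∈ O, 0 ≤ W i p)
    (hρ : ∀ j, ∀ p ∈ O, 0 ≤ ρ j p) {κ : Type*} (s : Finset κ) {F : κ → ι → F → ℂ}
    (h : ∀ k ∈ s, SlowFam e v O ρ W (F k)) :
    SlowFam e v O ρ W fun i p => ∑ k ∈ s, F k i p := by
  classical
  induction s using Finset.induction_on with
  | empty => simpa using SlowFam.zero hW hρ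
  | insert k s hk ih =>
    simp only [Finset.sum_insert hk]
    exact (h k (Finset.mem_insert_self _ _)).add hO
      (ih fun k' hk' => h k' (Finset.mem_insert_of_mem hk'))

theorem SlowFam.fderiv (hO : IsOpen O) (h : SlowFam e v O ρ W f) (j : J) :
    SlowFam e v O ρ (fun i p => W i p * ρ j p) fun i p => fderiv ℝ (f i) p (v j) := by
  refine ⟨fun i => contDiffOn_fderiv_apply hO (h.1 i) _, fun l => ?_⟩
  obtain ⟨σ, hσ, h⟩ := h.2 (j :: l)
  refine ⟨σ, hσ, fun i p hp => ?_⟩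
  have := h i p hp
  rwa [dirD_cons, List.map_cons, List.prod_cons, ← mul_assoc (W i p)] at this

/-- The product rule yields two products of the same kind, in which the weight of the derivative has
moved into `W` or into `W'`. Hence the induction runs over all functions and weights. -/
theorem SlowBound.mul (hO : IsOpen O) (hW : ∀ i, ∀ p ∈ O, 0 ≤ W i p)
    (hW' : ∀ i, ∀ p ∈ O, 0 ≤ W' i p)
    (hρ : ∀ j, ∀ p ∈ O, 0 ≤ ρ j p) (h : SlowFam e v O ρ W f) (h' : SlowFam e v O ρ W' g)
    (l : List J) : SlowBound e v O ρ (fun i p => W i p * W' i p) l fun i p => f i p * g i p := by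
  induction l generalizing f g W W' with
  | nil =>
    obtain ⟨σ, hσ, h1⟩ := h.2 []
    obtain ⟨τ, hτ, h2⟩ := h'.2 []
    refine ⟨_, hσ.mul hτ, fun i p hp => ?_⟩
    have h3 := h1 i p hp
    have h4 := h2 i p hp
    simp only [dirD_nil, List.map_nil, List.prod_nil, mul_one, norm_mul] at h3 h4 ⊢
    calc ‖f i p‖ * ‖g i p‖ ≤ (σ i * W i p) * (τ i * W' i p) :=
          mul_le_mul h3 h4 (norm_nonneg _) ((norm_nonneg _).trans h3)
      _ = _ := by ring
  | cons j l ih =>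
    have h1 := ih (fun i p hp => mul_nonneg (hW i p hp) (hρ j p hp)) hW' (h.fderiv hO j) h'
    have h2 := ih hW (fun i p hp => mul_nonneg (hW' i p hp) (hρ j p hp)) h (h'.fderiv hO j)
    have h3 := (h1.mono (W' := fun i p => W i p * W' i p * ρ j p) (Slow.const zero_le_one) hρ
      (fun i p hp => by linarith)).add hO
        (fun i => (contDiffOn_fderiv_apply hO (h.1 i) _).mul (h'.1 i))
        (fun i => (h.1 i).mul (contDiffOn_fderiv_apply hO (h'.1 i) _))
        (h2.mono (W' := fun i p => W i p * W' i p * ρ j p) (Slow.const zero_le_one) hρ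
          (fun i p hp => by linarith))
    obtain ⟨σ, hσ, h4⟩ := h3.congr hO (g := fun i p => _root_.fderiv ℝ (fun p => f i p * g i p) p (v j))
      fun i p hp => by
        simp only
        rw [fderiv_fun_mul (differentiableAt_of_contDiffOn hO (h.1 i) hp)
          (differentiableAt_of_contDiffOn hO (h'.1 i) hp)]
        simp
        ring
    refine ⟨σ, hσ, fun i p hp => ?_⟩
    rw [dirD_cons, List.map_cons, List.prod_cons, ← mul_assoc (W i p * W' i p)]
    exact h4 i p hp

theorem SlowFam.mul (hO : IsOpen O) (hW : ∀ i, ∀ p ∈ O, 0 ≤ W i p)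
    (hW' : ∀ i, ∀ p ∈ O, 0 ≤ W' i p)
    (hρ : ∀ j, ∀ p ∈ O, 0 ≤ ρ j p) (h : SlowFam e v O ρ W f) (h' : SlowFam e v O ρ W' g) :
    SlowFam e v O ρ (fun i p => W i p * W' i p) fun i p => f i p * g i p :=
  ⟨fun i => (h.1 i).mul (h'.1 i), SlowBound.mul hO hW hW' hρ h h'⟩

/-- Division by an elliptic family. -/
theorem SlowFam.mul_inv_pow (hO : IsOpen O) (hW : ∀ i, ∀ p ∈ O, 0 ≤ W i p)
    (hρ : ∀ j, ∀ p ∈ O, 0 ≤ ρ j p) (h : SlowFam e v O ρ W f)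
    (h' : SlowFam e v O ρ (fun _ _ => 1) g) {τ : ι → ℝ} (hτ : Slow e τ)
    (hne : ∀ i, ∀ p ∈ O, g i p ≠ 0) (hg : ∀ i, ∀ p ∈ O, ‖g i p‖⁻¹ ≤ τ i) (m : ℕ) :
    SlowFam e v O ρ W fun i p => f i p * (g i p)⁻¹ ^ m := by
  refine ⟨fun i => (h.1 i).mul (((h'.1 i).inv (hne i)).pow m), fun l => ?_⟩
  induction l generalizing f W m with
  | nil =>
    obtain ⟨σ, hσ, h1⟩ := h.2 []
    refine ⟨_, hσ.mul (hτ.pow m), fun i p hp => ?_⟩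
    have h3 := h1 i p hp
    have h4 := hg i p hp
    simp only [dirD_nil, List.map_nil, List.prod_nil, mul_one, norm_mul, norm_pow, norm_inv]
      at h3 h4 ⊢
    calc ‖f i p‖ * ‖g i p‖⁻¹ ^ m ≤ (σ i * W i p) * τ i ^ m := by gcongr; exact (norm_nonneg _).trans h3
      _ = _ := by ring
  -- The derivative of f g^(-m) is f' g^(-m) - m f g' g^(-m-1). Both summands have the original
  -- form, so `m`, `f` and `W` vary in the induction.
  | cons j l ih =>
    have hWj : ∀ i, ∀ p ∈ O, 0 ≤ W i p * ρ j p := fun i p hp => mul_nonneg (hW i p hp) (hρ j p hp)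
    have h1 := ih hWj (h.fderiv hO j) m
    have h5 := ((h.mul hO hW (fun i p hp => by simpa using hρ j p hp) hρ (h'.fderiv hO j)).const_mul
      (-(m : ℂ)))
    have h6 := h5.mono (W' := fun i p => W i p * ρ j p) (Slow.const zero_le_one) hρ
      (fun i p hp => by simp)
    have h2 := ih hWj h6 (m + 1)
    have hpow : ∀ i k, ContDiffOn ℝ ∞ (fun p => (g i p)⁻¹ ^ k) O :=
      fun i k => ((h'.1 i).inv (hne i)).pow k
    obtain ⟨σ, hσ, h4⟩ := (h1.add hO
      (fun i => (contDiffOn_fderiv_apply hO (h.1 i) _).mul (hpow i m))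
      (fun i => (h6.1 i).mul (hpow i (m + 1))) h2).congr hO
      (g := fun i p => _root_.fderiv ℝ (fun p => f i p * (g i p)⁻¹ ^ m) p (v j))
      fun i p hp => by
        have hgd := (differentiableAt_of_contDiffOn hO (h'.1 i) hp).hasFDerivAt
        have hfd := (differentiableAt_of_contDiffOn hO (h.1 i) hp).hasFDerivAt
        have hid : HasFDerivAt (fun p => (g i p)⁻¹)
            (-((g i p) ^ 2)⁻¹ • _root_.fderiv ℝ (g i) p) p :=
          (hasDerivAt_inv (hne i p hp)).comp_hasFDerivAt p hgd
        have hpd := hid.pow m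
        have := (hfd.mul hpd).fderiv
        simp only
        rw [show (fun p => f i p * (g i p)⁻¹ ^ m) = f i * fun p => (g i p)⁻¹ ^ m from rfl, this]
        have hnz := hne i p hp
        rcases m with _ | m
        · simp
        · simp
          field_simp
          ring
    refine ⟨σ, hσ, fun i p hp => ?_⟩
    rw [dirD_cons, List.map_cons, List.prod_cons, ← mul_assoc (W i p)]
    exact h4 i p hp

end SlowClass

/-! ### Position and frequency derivatives on phase space -/

section JointDirections

variable {n : ℕ}

/-- The coordinate directions in phase space: `inl` for positions, `inr` for frequencies. -/
def phaseDir : Fin n ⊕ Fin n → E n × E n :=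
  Sum.elim (fun i => (stdB i, 0)) fun i => (0, stdB i)

/-- Each frequency derivative gains a power of the Japanese bracket. -/
def phaseWeight : Fin n ⊕ Fin n → E n × E n → ℝ :=
  Sum.elim (fun _ _ => 1) fun _ p => (bracket p.2)⁻¹

theorem phaseWeight_nonneg (j : Fin n ⊕ Fin n) (p : E n × E n) : 0 ≤ phaseWeight j p := by
  rcases j with j | j
  · exact zero_le_one
  · exact (inv_pos.2 (bracket_pos _)).le

theorem prod_phaseWeight_nonneg (l : List (Fin n ⊕ Fin n)) (p : E n × E n) :
    0 ≤ (l.map fun j => phaseWeight j p).prod :=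
  List.prod_nonneg fun a ha => by
    obtain ⟨j, _, rfl⟩ := List.mem_map.1 ha
    exact phaseWeight_nonneg j p

theorem dirD_slice {O : Set (E n × E n)} (hO : IsOpen O) {A : E n × E n → ℂ}
    (hA : ContDiffOn ℝ ∞ A O) (l : List (Fin n)) {x η : E n} (hx : (x, η) ∈ O) :
    dirD stdB l (fun y => A (y, η)) x = dirD phaseDir (l.map Sum.inl) A (x, η) := by
  have h := dirD_comp_affine hO hA (w := stdB) (ContinuousLinearMap.inl ℝ (E n) (E n)) (0, η) l
    (x := x) (by simpa using hx)
  have h1 : ∀ y : E n, ContinuousLinearMap.inl ℝ (E n) (E n) y + (0, η) = (y, η) := fun y => by simp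
  simp only [h1] at h
  rw [h, dirD_map]
  rfl

theorem dirD_comp_fst {U : Set (E n)} (hU : IsOpen U) {g : E n → ℂ}
    (hg : ContDiffOn ℝ ∞ g U) (l : List (Fin n)) {p : E n × E n} (hp : p.1 ∈ U) :
    dirD phaseDir (l.map Sum.inl) (fun q => g q.1) p = dirD stdB l g p.1 := by
  have h := dirD_comp_affine hU hg (w := phaseDir ∘ (Sum.inl : Fin n → Fin n ⊕ Fin n))
    (ContinuousLinearMap.fst ℝ (E n) (E n)) 0 l (x := p) (by simpa using hp)
  simp only [add_zero, ContinuousLinearMap.coe_fst'] at h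
  rw [dirD_map, h]
  rfl

/-- Separates the derivatives that kill every function of position alone from the pure position
derivatives. -/
theorem exists_eq_map_inl {J J' : Type*} (l : List (J ⊕ J')) :
    (∃ j, Sum.inr j ∈ l) ∨ ∃ l' : List J, l = l'.map Sum.inl := by
  induction l with
  | nil => exact Or.inr ⟨[], rfl⟩
  | cons a l ih =>
    rcases ih with ⟨j, hj⟩ | ⟨l', rfl⟩
    · exact Or.inl ⟨j, List.mem_cons_of_mem _ hj⟩
    · rcases a with a | a
      · exact Or.inr ⟨a :: l', rfl⟩
      · exact Or.inl ⟨a, List.mem_cons_self⟩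

end JointDirections

/-! ### Taylor expansion of a symbol in the frequency, after Fourier transform in the position -/

section Expansion

variable {n : ℕ}

/-- The operator `i ∑ ∂_{x_l} ∂_{ξ_l}` on phase space functions. -/
def mixedD (A : E n × E n → ℂ) (p : E n × E n) : ℂ :=
  Complex.I * ∑ l, fderiv ℝ (fun q => fderiv ℝ A q (phaseDir (Sum.inr l))) p (phaseDir (Sum.inl l))

theorem contDiff_mixedD {A : E n × E n → ℂ} (hA : ContDiff ℝ ∞ A) : ContDiff ℝ ∞ (mixedD A) :=
  contDiff_const.mul (ContDiff.sum fun _ _ =>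
    contDiff_fderiv_apply (contDiff_fderiv_apply hA _) _)

theorem mixedD_eq_zero {K : Set (E n)} (hK : IsClosed K) {A : E n × E n → ℂ}
    (h0 : ∀ p : E n × E n, p.1 ∉ K → A p = 0) (p : E n × E n) (hp : p.1 ∉ K) : mixedD A p = 0 := by
  have hK' : IsClosed (Prod.fst ⁻¹' K : Set (E n × E n)) := hK.preimage continuous_fst
  have h1 : ∀ v, ∀ q : E n × E n, q.1 ∉ K → fderiv ℝ A q v = 0 := fun v q hq => by
    rw [fderiv_eq_zero_of_support hK' h0 q hq]; simp
  simp only [mixedD]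
  rw [Finset.sum_eq_zero, mul_zero]
  intro l _
  rw [fderiv_eq_zero_of_support hK' (h1 _) p hp]
  simp

theorem contDiff_iterate_mixedD {A : E n × E n → ℂ} (hA : ContDiff ℝ ∞ A) (j : ℕ) :
    ContDiff ℝ ∞ (mixedD^[j] A) := by
  induction j with
  | zero => exact hA
  | succ j ih =>
    rw [Function.iterate_succ_apply']
    exact contDiff_mixedD ih

theorem iterate_mixedD_eq_zero {K : Set (E n)} (hK : IsClosed K) {A : E n × E n → ℂ}
    (h0 : ∀ p : E n × E n, p.1 ∉ K → A p = 0) (j : ℕ) (p : E n × E n) (hp : p.1 ∉ K) :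
    mixedD^[j] A p = 0 := by
  induction j generalizing p with
  | zero => exact h0 p hp
  | succ j ih =>
    rw [Function.iterate_succ_apply']
    exact mixedD_eq_zero hK ih p hp

/-- The Fourier transform in the position variable. -/
def partialF (A : E n × E n → ℂ) (ζ η : E n) : ℂ := fourierT (fun x => A (x, η)) ζ

theorem partialF_eq {K : Set (E n)} {A : E n × E n → ℂ}
    (h0 : ∀ p : E n × E n, p.1 ∉ K → A p = 0) (ζ η : E n) :
    partialF A ζ η = ∫ y in K, Complex.exp (-(Complex.I * ((inner ℝ y ζ : ℝ) : ℂ))) * A (y, η) := by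
  rw [partialF, fourierT, setIntegral_eq_integral_of_forall_compl_eq_zero]
  intro x hx
  simp [h0 (x, η) hx]

theorem continuous_partialF {K : Set (E n)} (hK : IsCompact K) {A : E n × E n → ℂ}
    (hA : Continuous A) (h0 : ∀ p : E n × E n, p.1 ∉ K → A p = 0) :
    Continuous fun q : E n × E n => partialF A q.1 q.2 := by
  simp only [partialF_eq h0]
  refine continuous_parametric_integral_of_continuous (μ := volume)
    (f := fun (q : E n × E n) y =>
      Complex.exp (-(Complex.I * ((inner ℝ y q.1 : ℝ) : ℂ))) * A (y, q.2)) ?_ hK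
  simp only [Function.uncurry_def]
  fun_prop

/-- Along ξ - tζ the derivative in t is -ζ·∂_η. Under the Fourier transform in x the factor iζ_l is
∂_{x_l}, and -ζ_l = i · (iζ_l); this accounts for the form of `mixedD`. -/
theorem hasDerivAt_partialF {K : Set (E n)} (hK : IsCompact K) {A : E n × E n → ℂ}
    (hA : ContDiff ℝ ∞ A) (h0 : ∀ p : E n × E n, p.1 ∉ K → A p = 0) (ξ ζ : E n) (t : ℝ) :
    HasDerivAt (fun t : ℝ => partialF A ζ (ξ - t • ζ)) (partialF (mixedD A) ζ (ξ - t • ζ)) t := by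
  have hK' : IsClosed (Prod.fst ⁻¹' K : Set (E n × E n)) := hK.isClosed.preimage continuous_fst
  have hd0 : ∀ v, ∀ q : E n × E n, q.1 ∉ K → fderiv ℝ A q v = 0 := fun v q hq => by
    rw [fderiv_eq_zero_of_support hK' h0 q hq]; simp
  set B : E n × E n → ℂ := fun q => fderiv ℝ A q (0, -ζ) with hB
  have hBc : ContDiff ℝ ∞ B := contDiff_fderiv_apply hA _
  have hAd : ∀ x t, HasDerivAt (fun t : ℝ => A (x, ξ - t • ζ)) (B (x, ξ - t • ζ)) t := by
    intro x t
    have h1 : HasDerivAt (fun t : ℝ => ((x, ξ - t • ζ) : E n × E n)) (0, -ζ) t := by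
      refine (hasDerivAt_const t x).prodMk ?_
      simpa using ((hasDerivAt_id t).smul_const ζ).const_sub ξ
    exact ((hA.differentiable (by simp)) (x, ξ - t • ζ)).hasFDerivAt.comp_hasDerivAt t h1
  -- differentiation under the integral sign
  have key : HasDerivAt (fun t : ℝ => partialF A ζ (ξ - t • ζ))
      (∫ y in K, Complex.exp (-(Complex.I * ((inner ℝ y ζ : ℝ) : ℂ))) * B (y, ξ - t • ζ)) t := by
    simp only [partialF_eq h0]
    have hcomp : IsCompact (K ×ˢ Set.Icc (t - 1) (t + 1)) := hK.prod isCompact_Icc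
    obtain ⟨C, hC⟩ := hcomp.exists_bound_of_continuousOn (f := fun q : E n × ℝ =>
      B (q.1, ξ - q.2 • ζ)) (by have := hBc.continuous; fun_prop)
    have hAc := hA.continuous
    have hBc' := hBc.continuous
    refine (hasDerivAt_integral_of_dominated_loc_of_deriv_le
      (F := fun (t : ℝ) (y : E n) =>
        Complex.exp (-(Complex.I * ((inner ℝ y ζ : ℝ) : ℂ))) * A (y, ξ - t • ζ))
      (F' := fun (t : ℝ) (y : E n) =>
        Complex.exp (-(Complex.I * ((inner ℝ y ζ : ℝ) : ℂ))) * B (y, ξ - t • ζ))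
      (bound := fun _ => C) (s := Set.Icc (t - 1) (t + 1))
      (Icc_mem_nhds (by linarith) (by linarith)) ?_ ?_ ?_ ?_ ?_ ?_).2
    · exact Filter.Eventually.of_forall fun s =>
        Continuous.aestronglyMeasurable (by fun_prop)
    · exact ContinuousOn.integrableOn_compact hK (by fun_prop)
    · exact Continuous.aestronglyMeasurable (by fun_prop)
    · refine (ae_restrict_iff' hK.measurableSet).2 (Filter.Eventually.of_forall fun y hy s hs => ?_)
      rw [norm_mul, norm_cexp_neg_I, one_mul]
      exact hC (y, s) ⟨hy, hs⟩
    · exact integrableOn_const hK.measure_lt_top.ne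
    · exact Filter.Eventually.of_forall fun y s _ => (hAd y s).const_mul _
  convert key using 1
  set η := ξ - t • ζ
  have hB0 : ∀ p : E n × E n, p.1 ∉ K → B p = 0 := fun p hp => hd0 _ p hp
  rw [← partialF_eq hB0]
  have hsl : ∀ l : Fin n, ∀ x, fderiv ℝ (fun q => fderiv ℝ A q (phaseDir (Sum.inr l))) (x, η)
      (phaseDir (Sum.inl l))
      = fderiv ℝ (fun y => fderiv ℝ A (y, η) (phaseDir (Sum.inr l))) x (stdB l) := by
    intro l x
    exact (dirD_slice isOpen_univ (contDiff_fderiv_apply hA (phaseDir (Sum.inr l))).contDiffOn [l]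
      (Set.mem_univ (x, η))).symm
  have hcd : ∀ l : Fin n, ContDiff ℝ ∞ fun y => fderiv ℝ A (y, η) (phaseDir (Sum.inr l)) :=
    fun l => (contDiff_fderiv_apply hA (phaseDir (Sum.inr l))).comp
      (contDiff_id.prodMk contDiff_const)
  have hz : ∀ l : Fin n, ∀ y, y ∉ K → fderiv ℝ A (y, η) (phaseDir (Sum.inr l)) = 0 :=
    fun l y hy => hd0 _ (y, η) hy
  have hft := fun l : Fin n => fourierT_fderiv hK (hcd l) (hz l) (stdB l) ζ
  have hint : ∀ l : Fin n, Integrable fun y => Complex.exp (-(Complex.I * ((inner ℝ y ζ : ℝ) : ℂ))) *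
      fderiv ℝ A (y, η) (phaseDir (Sum.inr l)) := fun l =>
    integrable_of_support hK (by have := (hcd l).continuous; fun_prop) fun x hx => by
      rw [hz l x hx, mul_zero]
  have hint' : ∀ l : Fin n, Integrable fun y => Complex.exp (-(Complex.I * ((inner ℝ y ζ : ℝ) : ℂ))) *
      fderiv ℝ (fun y => fderiv ℝ A (y, η) (phaseDir (Sum.inr l))) y (stdB l) := fun l =>
    integrable_of_support hK
      (by have := (contDiff_fderiv_apply (hcd l) (stdB l)).continuous; fun_prop) fun x hx => by
        rw [fderiv_eq_zero_of_support hK.isClosed (hz l) x hx]; simp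
  have hL : partialF (mixedD A) ζ η = Complex.I * ∑ l, fourierT
      (fun y => fderiv ℝ (fun y => fderiv ℝ A (y, η) (phaseDir (Sum.inr l))) y (stdB l)) ζ := by
    simp only [partialF, fourierT, mixedD, hsl]
    rw [← integral_finsetSum _ fun l _ => hint' l, ← integral_const_mul]
    congr 1
    ext y
    rw [Finset.mul_sum, Finset.mul_sum, Finset.mul_sum]
    exact Finset.sum_congr rfl fun l _ => by ring
  have hR : partialF B ζ η = ∑ l, -((ζ l : ℝ) : ℂ) * fourierT
      (fun y => fderiv ℝ A (y, η) (phaseDir (Sum.inr l))) ζ := by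
    have hζ : ((0 : E n), -ζ) = ∑ l, (-(ζ l)) • phaseDir (Sum.inr l) := by
      have : ζ = ∑ l, ζ l • stdB l := by
        ext k
        simp [stdB, Pi.single_apply]
      refine Prod.ext ?_ ?_
      · simp [phaseDir, Prod.fst_sum]
      · conv_lhs => rw [this]
        simp [phaseDir, Prod.snd_sum]
    simp only [partialF, fourierT, hB, hζ, map_sum, map_smul]
    simp_rw [← integral_const_mul]
    rw [← integral_finsetSum _ fun l _ => (hint l).const_mul _]
    congr 1
    ext y
    rw [Finset.mul_sum]
    refine Finset.sum_congr rfl fun l _ => ?_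
    rw [Complex.real_smul]
    push_cast
    ring
  rw [hL, hR, Finset.mul_sum]
  refine Finset.sum_congr rfl fun l _ => ?_
  rw [hft l]
  have : inner ℝ (stdB l) ζ = ζ l := by simp [stdB, EuclideanSpace.inner_single_left]
  rw [this, ← mul_assoc, ← mul_assoc, Complex.I_mul_I]
  ring

/-- Taylor's formula for a sequence of successive derivatives. -/
theorem taylor_chain (k : ℕ) {φ : ℕ → ℝ → ℂ} (h : ∀ j t, HasDerivAt (φ j) (φ (j + 1) t) t)
    {B : ℝ} (hB : ∀ t ∈ Set.Icc (0 : ℝ) 1, ‖φ k t‖ ≤ B) :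
    ∀ t ∈ Set.Icc (0 : ℝ) 1,
      ‖φ 0 t - ∑ j ∈ Finset.range k, ((t ^ j / j.factorial : ℝ) : ℂ) * φ j 0‖ ≤ B := by
  induction k generalizing φ with
  | zero => simpa using hB
  | succ k ih =>
    intro t ht
    -- The derivative of the remainder is the remainder of one order less for the shifted sequence,
    -- and the remainder vanishes at 0. The mean value inequality on [0, 1] then keeps the bound
    -- `B`.
    have h1 := ih (φ := fun j => φ (j + 1)) (fun j t => h (j + 1) t) hB
    have hB0 : 0 ≤ B := (norm_nonneg _).trans (hB t ht)
    set S : ℝ → ℂ := fun t => φ 0 t - ∑ j ∈ Finset.range (k + 1),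
      ((t ^ j / j.factorial : ℝ) : ℂ) * φ j 0 with hS
    have hSd : ∀ s, HasDerivAt S (φ 1 s - ∑ j ∈ Finset.range k,
        ((s ^ j / j.factorial : ℝ) : ℂ) * φ (j + 1) 0) s := by
      intro s
      refine (h 0 s).sub ?_
      simp only [Finset.sum_range_succ' _ k]
      have h2 : HasDerivAt (fun s : ℝ => ∑ j ∈ Finset.range k,
          ((s ^ (j + 1) / (j + 1).factorial : ℝ) : ℂ) * φ (j + 1) 0)
          (∑ j ∈ Finset.range k, ((s ^ j / j.factorial : ℝ) : ℂ) * φ (j + 1) 0) s := by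
        refine HasDerivAt.fun_sum fun j _ => ?_
        have h3 : HasDerivAt (fun s : ℝ => s ^ (j + 1) / ((j + 1).factorial : ℝ))
            (s ^ j / (j.factorial : ℝ)) s := by
          refine ((hasDerivAt_pow (j + 1) s).div_const ((j + 1).factorial : ℝ)).congr_deriv ?_
          rw [Nat.factorial_succ]
          have : (j.factorial : ℝ) ≠ 0 := by positivity
          push_cast
          field_simp
        exact h3.ofReal_comp.mul_const _
      simpa using h2
    have h0 : S 0 = 0 := by
      simp only [hS, Finset.sum_range_succ' _ k]
      simp
    have h4 := (convex_Icc (0 : ℝ) 1).norm_image_sub_le_of_norm_hasDerivWithin_le (f := S)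
      (fun s hs => (hSd s).hasDerivWithinAt) (fun s hs => h1 s hs)
      (Set.left_mem_Icc.2 zero_le_one) ht
    rw [h0, sub_zero, sub_zero, Real.norm_of_nonneg ht.1] at h4
    exact h4.trans (mul_le_of_le_one_right hB0 ht.2)

/-- As t runs from 0 to 1 the frequency ξ - tζ moves from ξ to ξ - ζ. With ζ = ξ - η, a symbol at η
is expanded at ξ. -/
theorem partialF_taylor {K : Set (E n)} (hK : IsCompact K) {A : E n × E n → ℂ}
    (hA : ContDiff ℝ ∞ A) (h0 : ∀ p : E n × E n, p.1 ∉ K → A p = 0) (ξ ζ : E n) (k : ℕ) {B : ℝ}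
    (hB : ∀ t ∈ Set.Icc (0 : ℝ) 1, ‖partialF (mixedD^[k] A) ζ (ξ - t • ζ)‖ ≤ B) :
    ‖partialF A ζ (ξ - ζ) - ∑ j ∈ Finset.range k,
      ((1 / j.factorial : ℝ) : ℂ) * partialF (mixedD^[j] A) ζ ξ‖ ≤ B := by
  have h := taylor_chain k (φ := fun j t => partialF (mixedD^[j] A) ζ (ξ - t • ζ)) (fun j t => by
    simp only [Function.iterate_succ_apply']
    exact hasDerivAt_partialF hK (contDiff_iterate_mixedD hA j)
      (iterate_mixedD_eq_zero hK.isClosed h0 j) ξ ζ t) hB 1 (Set.right_mem_Icc.2 zero_le_one)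
  simpa using h

end Expansion

/-! ### Slowly bounded families of symbols and amplitudes -/

section Families

variable {n : ℕ} {ι : Type*} {e : ι → Eps}

theorem Slow.sum {κ : Type*} (s : Finset κ) {σ : κ → ι → ℝ} (h : ∀ k ∈ s, Slow e (σ k)) :
    Slow e fun i => ∑ k ∈ s, σ k i := by
  classical
  induction s using Finset.induction_on with
  | empty => simpa using Slow.const (e := e) le_rfl
  | insert k s hk ih =>
    simp only [Finset.sum_insert hk]
    exact (h k (Finset.mem_insert_self _ _)).add
      (ih fun k' hk' => h k' (Finset.mem_insert_of_mem hk'))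

/-- One slow family of constants bounds all derivatives up to a given order. -/
theorem SlowFam.exists_uniform {F : Type*} [NormedAddCommGroup F] [NormedSpace ℝ F] {J : Type*}
    [Finite J] {v : J → F} {O : Set F} {ρ : J → F → ℝ} {W : ι → F → ℝ} {f : ι → F → ℂ}
    (hW : ∀ i, ∀ p ∈ O, 0 ≤ W i p) (hρ : ∀ j, ∀ p ∈ O, 0 ≤ ρ j p)
    (h : SlowFam e v O ρ W f) (M : ℕ) :
    ∃ σ, Slow e σ ∧ ∀ l : List J, l.length ≤ M → ∀ i, ∀ p ∈ O,
      ‖dirD v l (f i) p‖ ≤ σ i * (W i p * (l.map fun j => ρ j p).prod) := by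
  choose σ hσ hb using h.2
  have hfin : {l : List J | l.length ≤ M}.Finite := List.finite_length_le J M
  refine ⟨fun i => ∑ l ∈ hfin.toFinset, σ l i, Slow.sum _ fun l _ => hσ l, fun l hl i p hp => ?_⟩
  refine (hb l i p hp).trans (mul_le_mul_of_nonneg_right ?_ (mul_nonneg (hW i p hp) ?_))
  · exact Finset.single_le_sum (f := fun l => σ l i) (fun l _ => (hσ l).1 i)
      (hfin.mem_toFinset.2 hl)
  · refine List.prod_nonneg fun a ha => ?_
    obtain ⟨j, _, rfl⟩ := List.mem_map.1 ha
    exact hρ j p hp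

theorem SlowFam.family_const_mul {F : Type*} [NormedAddCommGroup F] [NormedSpace ℝ F] {J : Type*}
    {v : J → F} {O : Set F} {ρ : J → F → ℝ} {W W' : ι → F → ℝ} {f : ι → F → ℂ}
    (hρ : ∀ j, ∀ p ∈ O, 0 ≤ ρ j p) (h : SlowFam e v O ρ W f) (z : ι → ℂ)
    (hz : ∀ i, ∀ p ∈ O, ‖z i‖ * W i p ≤ W' i p) : SlowFam e v O ρ W' fun i p => z i * f i p := by
  refine ⟨fun i => contDiffOn_const.mul (h.1 i), fun l => ?_⟩
  obtain ⟨σ, hσ, hb⟩ := h.2 l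
  refine ⟨σ, hσ, fun i p hp => ?_⟩
  have hpr : 0 ≤ (l.map fun j => ρ j p).prod := List.prod_nonneg fun a ha => by
    obtain ⟨j, _, rfl⟩ := List.mem_map.1 ha
    exact hρ j p hp
  rw [dirD_const_mul, norm_mul]
  calc ‖z i‖ * ‖dirD v l (f i) p‖ ≤ ‖z i‖ * (σ i * (W i p * (l.map fun j => ρ j p).prod)) := by
        gcongr
        exact hb i p hp
    _ = σ i * ((‖z i‖ * W i p) * (l.map fun j => ρ j p).prod) := by ring
    _ ≤ _ := by
        refine mul_le_mul_of_nonneg_left (mul_le_mul_of_nonneg_right (hz i p hp) hpr) (hσ.1 i)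

/-- Slowly bounded families of functions on an open set of positions, with trivial weights for
the derivatives. -/
abbrev SlowPos (e : ι → Eps) (U : Set (E n)) (W : ι → ℝ) (f : ι → E n → ℂ) : Prop :=
  SlowFam e stdB U (fun _ _ => 1) (fun i _ => W i) f

/-- Slowly bounded families of symbols over an open set of positions. -/
abbrev SlowSym (e : ι → Eps) (U : Set (E n)) (W : ι → E n → ℝ) (A : ι → E n × E n → ℂ) : Prop :=
  SlowFam e phaseDir (U ×ˢ Set.univ) phaseWeight (fun i p => W i p.2) A

variable {U K : Set (E n)} {W : ι → E n → ℝ} {A : ι → E n × E n → ℂ}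

/-- Freezing a frequency, which may depend on the index, turns a symbol into an amplitude: only
position derivatives remain, and these have weight 1. -/
theorem SlowSym.slice (hU : IsOpen U) (h : SlowSym e U W A) (Ξ : ι → E n) :
    SlowPos e U (fun i => W i (Ξ i)) fun i x => A i (x, Ξ i) := by
  have hO : IsOpen (U ×ˢ (Set.univ : Set (E n))) := hU.prod isOpen_univ
  refine ⟨fun i => (h.1 i).comp (contDiff_id.prodMk contDiff_const).contDiffOn
    fun x hx => ⟨hx, Set.mem_univ _⟩, fun l => ?_⟩
  obtain ⟨σ, hσ, hb⟩ := h.2 (l.map Sum.inl)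
  refine ⟨σ, hσ, fun i x hx => ?_⟩
  have := hb i (x, Ξ i) ⟨hx, Set.mem_univ _⟩
  rw [dirD_slice hO (h.1 i) l (x := x) (η := Ξ i) ⟨hx, Set.mem_univ _⟩]
  simpa [List.map_map, Function.comp_def, phaseWeight] using this

theorem SlowPos.comp_fst (hU : IsOpen U) {W : ι → ℝ} (hW : ∀ i, 0 ≤ W i) {g : ι → E n → ℂ}
    (h : SlowPos e U W g) : SlowSym e U (fun i _ => W i) fun i p => g i p.1 := by
  refine ⟨fun i => (h.1 i).comp contDiff_fst.contDiffOn fun p hp => hp.1, fun l => ?_⟩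
  rcases exists_eq_map_inl l with ⟨j, hj⟩ | ⟨l', rfl⟩
  · refine ⟨_, Slow.const zero_le_one, fun i p hp => ?_⟩
    have hO : IsOpen (U ×ˢ (Set.univ : Set (E n))) := hU.prod isOpen_univ
    -- a frequency derivative annihilates the function
    have hz : ∀ l : List (Fin n ⊕ Fin n), Sum.inr j ∈ l →
        dirD phaseDir l (fun q : E n × E n => g i q.1) p = 0 := by
      intro l hl
      obtain ⟨s, t, rfl⟩ := List.append_of_mem hl
      have hcd : ContDiffOn ℝ ∞ (fun q : E n × E n => g i q.1) (U ×ˢ Set.univ) :=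
        (h.1 i).comp contDiff_fst.contDiffOn fun p hp => hp.1
      rw [dirD_perm hO List.perm_middle hcd hp, dirD_cons]
      have h1 : Set.EqOn (fun x => fderiv ℝ (fun q : E n × E n => g i q.1) x
          (phaseDir (Sum.inr j))) (fun _ => 0 * 0) (U ×ˢ Set.univ) := by
        intro q hq
        have hd := (differentiableAt_of_contDiffOn hU (h.1 i) hq.1).hasFDerivAt
        have := (hd.comp q hasFDerivAt_fst).fderiv
        simp only [Function.comp_def] at this
        simp [this, phaseDir]
      rw [dirD_eqOn hO h1 _ hp]
      have := congrFun (dirD_const_mul (v := phaseDir (n := n)) (f := fun _ => (0 : ℂ)) 0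
        (s ++ t)) p
      simpa using this
    rw [hz l hj, norm_zero, one_mul]
    exact mul_nonneg (hW i) (prod_phaseWeight_nonneg _ _)
  · obtain ⟨σ, hσ, hb⟩ := h.2 l'
    refine ⟨σ, hσ, fun i p hp => ?_⟩
    rw [dirD_comp_fst hU (h.1 i) l' hp.1]
    simpa [List.map_map, Function.comp_def, phaseWeight] using hb i p.1 hp.1

/-- The frequency derivative gains one power of the bracket and the position derivative costs
nothing. -/
theorem SlowSym.mixedD (hU : IsOpen U) (hW : ∀ i η, 0 ≤ W i η) (h : SlowSym e U W A) :
    SlowSym e U (fun i η => W i η * (bracket η)⁻¹) fun i => mixedD (A i) := by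
  have hO : IsOpen (U ×ˢ (Set.univ : Set (E n))) := hU.prod isOpen_univ
  have hb : ∀ η : E n, 0 ≤ (bracket η)⁻¹ := fun η => (inv_pos.2 (bracket_pos _)).le
  refine SlowFam.const_mul Complex.I (SlowFam.sum hO (fun i p _ => mul_nonneg (hW i _) (hb _))
    (fun j p _ => phaseWeight_nonneg j p) Finset.univ fun l _ => ?_)
  have h1 := (h.fderiv hO (Sum.inr l)).fderiv hO (Sum.inl l)
  refine h1.mono (Slow.const zero_le_one) (fun j p _ => phaseWeight_nonneg j p) fun i p _ => ?_
  simp [phaseWeight]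

theorem SlowSym.iterate_mixedD (hU : IsOpen U) (h : SlowSym e U (fun _ _ => 1) A) (j : ℕ) :
    SlowSym e U (fun _ η => bracket η ^ (-(j : ℝ))) fun i => Colombeau.mixedD^[j] (A i) := by
  induction j with
  | zero => simpa using h
  | succ j ih =>
    simp only [Function.iterate_succ_apply']
    refine (ih.mixedD hU fun i η => bracket_rpow_nonneg _ _).mono (Slow.const zero_le_one)
      (fun j p _ => phaseWeight_nonneg j p) fun i p _ => ?_
    beta_reduce
    rw [one_mul, ← Real.rpow_neg_one, ← Real.rpow_add (bracket_pos _)]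
    push_cast
    exact bracket_rpow_le_rpow _ (by linarith)

/-- `fourierT_decay` in the position for each fixed frequency; the weight in the frequency is
carried along unchanged. -/
theorem SlowSym.partialF_decay (hK : IsCompact K) (hKU : K ⊆ U) (hU : IsOpen U)
    (hW : ∀ i η, 0 ≤ W i η) (h : SlowSym e U W A) (hA : ∀ i, ContDiff ℝ ∞ (A i))
    (h0 : ∀ i, ∀ p : E n × E n, p.1 ∉ K → A i p = 0) (M : ℕ) :
    ∃ σ, Slow e σ ∧ ∀ i ζ η, bracket ζ ^ M * ‖partialF (A i) ζ η‖ ≤ σ i * W i η := by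
  have hO : IsOpen (U ×ˢ (Set.univ : Set (E n))) := hU.prod isOpen_univ
  obtain ⟨σ, hσ, hb⟩ := h.exists_uniform (fun i p _ => hW i _)
    (fun j p _ => phaseWeight_nonneg j p) M
  have hc : (0 : ℝ) ≤ (1 + n) ^ M * volume.real K := by positivity
  refine ⟨_, (Slow.const hc).mul hσ, fun i ζ η => ?_⟩
  have h1 := fourierT_decay hK M (h := fun x => A i (x, η))
    ((hA i).comp (contDiff_id.prodMk contDiff_const)) (fun x hx => h0 i (x, η) hx)
    (B := σ i * W i η) (fun l hl x => ?_) ζ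
  · exact h1.trans_eq (by ring)
  · by_cases hx : x ∈ K
    · rw [dirD_slice hO (h.1 i) l ⟨hKU hx, Set.mem_univ _⟩]
      have := hb (l.map Sum.inl) (by simpa using hl) i (x, η) ⟨hKU hx, Set.mem_univ _⟩
      simpa [List.map_map, Function.comp_def, phaseWeight] using this
    · rw [dirD_eq_zero_of_support hK.isClosed l (fun y hy => h0 i (y, η) hy) x hx, norm_zero]
      exact mul_nonneg (hσ.1 i) (hW i η)

/-- `X = O(ε^{-P-δ} Y)` as `ε → 0` for every `δ > 0`. -/
def OSlow (e : ι → Eps) (P : ℝ) (X Y : ι → ℝ) : Prop :=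
  ∀ δ : ℝ, 0 < δ → ∃ C : ℝ, 0 ≤ C ∧ ∃ η : ℝ, 0 < η ∧ ∀ i, (e i : ℝ) < η →
    X i ≤ C * (e i : ℝ) ^ (-(P + δ)) * Y i

variable {P : ℝ} {X X' Y Y' : ι → ℝ}

theorem OSlow.add (h : OSlow e P X Y) (h' : OSlow e P X' Y) :
    OSlow e P (fun i => X i + X' i) Y := by
  intro δ hδ
  obtain ⟨C, hC, η, hη, h⟩ := h δ hδ
  obtain ⟨D, hD, θ, hθ, h'⟩ := h' δ hδ
  refine ⟨C + D, by positivity, min η θ, lt_min hη hθ, fun i hi => ?_⟩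
  have h1 := h i (hi.trans_le (min_le_left _ _))
  have h2 := h' i (hi.trans_le (min_le_right _ _))
  rw [add_mul, add_mul]
  exact add_le_add h1 h2

theorem OSlow.mono_left (h : OSlow e P X Y) (hX : ∀ i, X' i ≤ X i) : OSlow e P X' Y := by
  intro δ hδ
  obtain ⟨C, hC, η, hη, h⟩ := h δ hδ
  exact ⟨C, hC, η, hη, fun i hi => (hX i).trans (h i hi)⟩

theorem OSlow.mono_exp {Q : ℝ} (h : OSlow e P X Y) (hY : ∀ i, 0 ≤ Y i) (hPQ : P ≤ Q) :
    OSlow e Q X Y := by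
  intro δ hδ
  obtain ⟨C, hC, η, hη, h⟩ := h δ hδ
  refine ⟨C, hC, η, hη, fun i hi => (h i hi).trans ?_⟩
  refine mul_le_mul_of_nonneg_right (mul_le_mul_of_nonneg_left ?_ hC) (hY i)
  exact Real.rpow_le_rpow_of_exponent_ge (e i).pos (e i).le_one (by linarith)

theorem OSlow.sum {κ : Type*} (s : Finset κ) {X : κ → ι → ℝ}
    (h : ∀ k ∈ s, OSlow e P (X k) Y) : OSlow e P (fun i => ∑ k ∈ s, X k i) Y := by
  classical
  induction s using Finset.induction_on with
  | empty =>
    intro δ _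
    refine ⟨0, le_rfl, 1, one_pos, fun i _ => by simp⟩
  | insert k s hk ih =>
    simp only [Finset.sum_insert hk]
    exact (h k (Finset.mem_insert_self _ _)).add
      (ih fun k' hk' => h k' (Finset.mem_insert_of_mem hk'))

/-- Nets of test functions supported in `K` with sup norm `O(ε^{-P})`. -/
structure IsTestNet (K : Set (E n)) (P : ℝ) (w : Eps → E n → ℂ) : Prop where
  smooth : ∀ ε, ContDiff ℝ ∞ (w ε)
  support : ∀ ε, ∀ x, x ∉ K → w ε x = 0
  bound : ∃ C : ℝ, 0 ≤ C ∧ ∃ η : ℝ, 0 < η ∧ ∀ ε : Eps, (ε : ℝ) < η →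
    ∀ x, ‖w ε x‖ ≤ C * (ε : ℝ) ^ (-P)

end Families

/-! ### Asymptotic expansion and the elliptic bootstrap -/

section Bootstrap

variable {n : ℕ} {ι : Type*} {e : ι → Eps} {U K K' : Set (E n)} {P : ℝ} {w : Eps → E n → ℂ}

/-- Reduces asymptotic estimates to inequalities that are linear in the sup norm of `w` with a slow
factor. Since no derivative of `w` enters, the exponent `P` never deteriorates. -/
theorem IsTestNet.oSlow (hw : IsTestNet K' P w) {τ X Y : ι → ℝ} (hτ : Slow e τ)
    (hY : ∀ i, 0 ≤ Y i)
    (h : ∀ i B, (∀ x, ‖w (e i) x‖ ≤ B) → X i ≤ τ i * B * Y i) : OSlow e P X Y := by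
  obtain ⟨C, hC, η, hη, hb⟩ := hw.bound
  intro δ hδ
  obtain ⟨D, hD, θ, hθ, h'⟩ := hτ.2 δ hδ
  refine ⟨D * C, by positivity, min η θ, lt_min hη hθ, fun i hi =>
    (h i _ (hb (e i) (hi.trans_le (min_le_left _ _)))).trans ?_⟩
  have hp := (e i).pos
  have h1 := hY i
  calc τ i * (C * (e i : ℝ) ^ (-P)) * Y i
      ≤ (D * (e i : ℝ) ^ (-δ)) * (C * (e i : ℝ) ^ (-P)) * Y i := by
        gcongr
        exact h' i (hi.trans_le (min_le_right _ _))
    _ = D * C * ((e i : ℝ) ^ (-δ) * (e i : ℝ) ^ (-P)) * Y i := by ring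
    _ = _ := by
        rw [← Real.rpow_add hp]
        congr 3
        ring

theorem integral_bracket_sub (ξ : E n) (r : ℝ) :
    ∫ η : E n, bracket (ξ - η) ^ r = ∫ η : E n, bracket η ^ r :=
  integral_sub_left_eq_self (fun η : E n => bracket η ^ r) volume ξ

theorem continuous_fourierT_of_support (hK : IsCompact K) {h : E n → ℂ} (hh : ContDiff ℝ ∞ h)
    (h0 : ∀ x, x ∉ K → h x = 0) : Continuous (fourierT h) :=
  continuous_fourierT (integrable_of_support hK hh.continuous h0)

theorem integrable_fourierT_mul_partialF (hK : IsCompact K) (hK' : IsCompact K') {v : E n → ℂ}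
    (hv : ContDiff ℝ ∞ v) (v0 : ∀ x, x ∉ K' → v x = 0) {A : E n × E n → ℂ} (hA : ContDiff ℝ ∞ A)
    (h0 : ∀ p : E n × E n, p.1 ∉ K → A p = 0) {B : ℝ} {φ : E n → E n} (hφ : Continuous φ)
    (hB : ∀ ζ η, ‖partialF A ζ η‖ ≤ B) (ξ : E n) :
    Integrable fun η => fourierT v η * partialF A (ξ - η) (φ η) := by
  have hc := continuous_partialF hK hA.continuous h0
  refine (integrable_fourierT hK' hv v0).mul_bdd (c := B) ?_
    (Filter.Eventually.of_forall fun η => hB _ _)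
  exact (hc.comp ((continuous_const.sub continuous_id).prodMk hφ)).aestronglyMeasurable

/-- The asymptotic expansion of a symbol acting on a test net, tested with an exponential. -/
theorem expansion_remainder (hU : IsOpen U) (hK : IsCompact K) (hKU : K ⊆ U) (hK' : IsCompact K')
    (hw : IsTestNet K' P w) {A : ι → E n × E n → ℂ} (hA : ∀ i, ContDiff ℝ ∞ (A i))
    (h0 : ∀ i, ∀ p : E n × E n, p.1 ∉ K → A i p = 0) (hS : SlowSym e U (fun _ _ => 1) A)
    (Ξ : ι → E n) (k : ℕ) :
    OSlow e P (fun i => ‖twoPiInv n * (∫ η, fourierT (w (e i)) η * partialF (A i) (Ξ i - η) η)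
      - ∑ j ∈ Finset.range k, ((1 / j.factorial : ℝ) : ℂ) *
        fourierT (fun x => w (e i) x * mixedD^[j] (A i) (x, Ξ i)) (Ξ i)‖)
      fun i => bracket (Ξ i) ^ (-(k : ℝ)) := by
  have hdec := fun j : ℕ => (hS.iterate_mixedD hU j).partialF_decay hK hKU hU
    (fun i η => bracket_rpow_nonneg _ _) (fun i => contDiff_iterate_mixedD (hA i) j)
    (fun i => iterate_mixedD_eq_zero hK.isClosed (h0 i) j)
  have hbd : ∀ j i, ∃ B, ∀ ζ η, ‖partialF (mixedD^[j] (A i)) ζ η‖ ≤ B := by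
    intro j i
    obtain ⟨σ, hσ, hb⟩ := hdec j 0
    refine ⟨σ i, fun ζ η => ?_⟩
    have h1 := hb i ζ η
    rw [pow_zero, one_mul] at h1
    refine h1.trans (mul_le_of_le_one_right (hσ.1 i) ?_)
    exact Real.rpow_le_one_of_one_le_of_nonpos (one_le_bracket _) (by simp)
  -- Of these powers of ⟨ζ⟩, k pay for Peetre's inequality, which moves ⟨ξ - tζ⟩^(-k) to ⟨ξ⟩^(-k),
  -- and n + 1 make the bound integrable.
  obtain ⟨σ, hσ, hb⟩ := hdec k (k + n + 1)
  set I : ℝ := ∫ η : E n, bracket η ^ (-((n : ℝ) + 1)) with hI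
  have hI0 : 0 ≤ I := integral_nonneg fun η => bracket_rpow_nonneg _ _
  have hc0 : 0 ≤ ‖twoPiInv n‖ * volume.real K' * 2 ^ (k : ℝ) * I := by positivity
  refine hw.oSlow ((Slow.const hc0).mul hσ) (fun i => bracket_rpow_nonneg _ _) fun i B hB => ?_
  -- pointwise bound of the remainder
  have hpt : ∀ η, ‖partialF (A i) (Ξ i - η) η - ∑ j ∈ Finset.range k,
      ((1 / j.factorial : ℝ) : ℂ) * partialF (mixedD^[j] (A i)) (Ξ i - η) (Ξ i)‖
      ≤ σ i * 2 ^ (k : ℝ) * bracket (Ξ i) ^ (-(k : ℝ)) * bracket (Ξ i - η) ^ (-((n : ℝ) + 1)) := by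
    intro η
    have h1 := partialF_taylor hK (hA i) (h0 i) (Ξ i) (Ξ i - η) k
      (B := σ i * 2 ^ (k : ℝ) * bracket (Ξ i) ^ (-(k : ℝ)) * bracket (Ξ i - η) ^ (-((n : ℝ) + 1)))
      (fun t ht => ?_)
    · rwa [sub_sub_cancel] at h1
    · set ζ := Ξ i - η
      have hζ := bracket_pos ζ
      have h2 := hb i ζ (Ξ i - t • ζ)
      have h3 := peetre (Ξ i) (-(t • ζ)) (r := (k : ℝ)) (by positivity)
      rw [← sub_eq_add_neg] at h3
      have h4 : bracket (-(t • ζ)) ≤ bracket ζ := by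
        refine bracket_le_of_norm_le ?_
        rw [norm_neg, norm_smul, Real.norm_of_nonneg ht.1]
        exact mul_le_of_le_one_left (norm_nonneg _) ht.2
      have h5 : bracket (-(t • ζ)) ^ (k : ℝ) ≤ bracket ζ ^ (k : ℝ) :=
        Real.rpow_le_rpow (bracket_pos _).le h4 (by positivity)
      have hσi := hσ.1 i
      have hΞ := bracket_rpow_nonneg (Ξ i) (-(k : ℝ))
      have h6 : bracket ζ ^ (k + n + 1) * ‖partialF (mixedD^[k] (A i)) ζ (Ξ i - t • ζ)‖
          ≤ σ i * (2 ^ (k : ℝ) * bracket (Ξ i) ^ (-(k : ℝ)) * bracket ζ ^ (k : ℝ)) := by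
        refine h2.trans (mul_le_mul_of_nonneg_left (h3.trans ?_) hσi)
        gcongr
      have h7 : bracket ζ ^ (k + n + 1) = bracket ζ ^ (k : ℝ) * bracket ζ ^ ((n : ℝ) + 1) := by
        rw [← Real.rpow_add hζ, ← Real.rpow_natCast]
        congr 1
        push_cast
        ring
      rw [Real.rpow_neg hζ.le, ← div_eq_mul_inv, le_div_iff₀ (Real.rpow_pos_of_pos hζ _)]
      rw [h7] at h6
      have h8 := Real.rpow_pos_of_pos hζ (k : ℝ)
      refine le_of_mul_le_mul_left ?_ h8
      calc _ = bracket ζ ^ (k : ℝ) * bracket ζ ^ ((n : ℝ) + 1) *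
            ‖partialF (mixedD^[k] (A i)) ζ (Ξ i - t • ζ)‖ := by ring
        _ ≤ _ := h6
        _ = _ := by ring
  -- In the Taylor coefficients the frequency is frozen, so their integrals are convolutions, that
  -- is, Fourier transforms of products.
  have hmain : ∀ j, fourierT (fun x => w (e i) x * mixedD^[j] (A i) (x, Ξ i)) (Ξ i)
      = twoPiInv n * ∫ η, fourierT (w (e i)) η * partialF (mixedD^[j] (A i)) (Ξ i - η) (Ξ i) :=
    fun j => fourierT_mul hK hK' (hw.smooth _) (hw.support _)
      ((contDiff_iterate_mixedD (hA i) j).comp (contDiff_id.prodMk contDiff_const))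
      (fun x hx => iterate_mixedD_eq_zero hK.isClosed (h0 i) j (x, Ξ i) hx) (Ξ i)
  have hint0 : Integrable fun η => fourierT (w (e i)) η * partialF (A i) (Ξ i - η) η := by
    obtain ⟨B', hB'⟩ := hbd 0 i
    exact integrable_fourierT_mul_partialF hK hK' (hw.smooth _) (hw.support _) (hA i) (h0 i)
      continuous_id hB' (Ξ i)
  have hintj : ∀ j, Integrable fun η =>
      fourierT (w (e i)) η * partialF (mixedD^[j] (A i)) (Ξ i - η) (Ξ i) := by
    intro j
    obtain ⟨B', hB'⟩ := hbd j i
    exact integrable_fourierT_mul_partialF hK hK' (hw.smooth _) (hw.support _)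
      (contDiff_iterate_mixedD (hA i) j) (iterate_mixedD_eq_zero hK.isClosed (h0 i) j)
      (φ := fun _ => Ξ i) continuous_const hB' (Ξ i)
  have heq : twoPiInv n * (∫ η, fourierT (w (e i)) η * partialF (A i) (Ξ i - η) η)
      - ∑ j ∈ Finset.range k, ((1 / j.factorial : ℝ) : ℂ) *
        fourierT (fun x => w (e i) x * mixedD^[j] (A i) (x, Ξ i)) (Ξ i)
      = twoPiInv n * ∫ η, fourierT (w (e i)) η * (partialF (A i) (Ξ i - η) η -
        ∑ j ∈ Finset.range k, ((1 / j.factorial : ℝ) : ℂ) *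
          partialF (mixedD^[j] (A i)) (Ξ i - η) (Ξ i)) := by
    simp only [hmain]
    have h1 : ∀ η, fourierT (w (e i)) η * (partialF (A i) (Ξ i - η) η -
        ∑ j ∈ Finset.range k, ((1 / j.factorial : ℝ) : ℂ) *
          partialF (mixedD^[j] (A i)) (Ξ i - η) (Ξ i))
        = fourierT (w (e i)) η * partialF (A i) (Ξ i - η) η - ∑ j ∈ Finset.range k,
          ((1 / j.factorial : ℝ) : ℂ) *
            (fourierT (w (e i)) η * partialF (mixedD^[j] (A i)) (Ξ i - η) (Ξ i)) := by
      intro η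
      rw [mul_sub, Finset.mul_sum]
      congr 1
      exact Finset.sum_congr rfl fun j _ => by ring
    simp only [h1]
    rw [integral_sub hint0 (integrable_finsetSum _ fun j _ => (hintj j).const_mul _),
      integral_finsetSum _ fun j _ => (hintj j).const_mul _, mul_sub, Finset.mul_sum]
    congr 1
    refine Finset.sum_congr rfl fun j _ => ?_
    rw [integral_const_mul]
    ring
  rw [heq, norm_mul]
  have hBw : ∀ η, ‖fourierT (w (e i)) η‖ ≤ volume.real K' * B :=
    norm_fourierT_le hK' (hw.support _) hB
  have hB0 : 0 ≤ B := (norm_nonneg _).trans (hB 0)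
  have hσi := hσ.1 i
  have hle : ‖∫ η, fourierT (w (e i)) η * (partialF (A i) (Ξ i - η) η -
        ∑ j ∈ Finset.range k, ((1 / j.factorial : ℝ) : ℂ) *
          partialF (mixedD^[j] (A i)) (Ξ i - η) (Ξ i))‖
      ≤ (volume.real K' * B) * (σ i * 2 ^ (k : ℝ) * bracket (Ξ i) ^ (-(k : ℝ))) * I := by
    have hint : Integrable fun η : E n => bracket (Ξ i - η) ^ (-((n : ℝ) + 1)) :=
      (integrable_bracket_rpow (lt_add_one (n : ℝ))).comp_sub_left (Ξ i)
    rw [hI, ← integral_bracket_sub (Ξ i), ← integral_const_mul]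
    refine norm_integral_le_of_norm_le (hint.const_mul _) (Filter.Eventually.of_forall fun η => ?_)
    rw [norm_mul, mul_assoc]
    exact mul_le_mul (hBw η) (hpt η) (norm_nonneg _) (by positivity)
  calc _ ≤ ‖twoPiInv n‖ *
        ((volume.real K' * B) * (σ i * 2 ^ (k : ℝ) * bracket (Ξ i) ^ (-(k : ℝ))) * I) := by gcongr
    _ = _ := by ring

/-- Slowly bounded families of test functions supported in `K`. -/
structure IsAmplitude (e : ι → Eps) (U K : Set (E n)) (h : ι → E n → ℂ) : Prop where
  smooth : ∀ i, ContDiff ℝ ∞ (h i)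
  support : ∀ i, ∀ x, x ∉ K → h i x = 0
  slow : SlowPos e U (fun _ => 1) h

theorem contDiff_of_contDiffOn_of_support {F : Type*} [NormedAddCommGroup F] [NormedSpace ℝ F]
    {O C : Set F} (hO : IsOpen O) (hC : IsClosed C) (hCO : C ⊆ O) {f : F → ℂ}
    (hf : ContDiffOn ℝ ∞ f O) (h0 : ∀ x, x ∉ C → f x = 0) : ContDiff ℝ ∞ f := by
  rw [contDiff_iff_contDiffAt]
  intro x
  by_cases hx : x ∈ O
  · exact hf.contDiffAt (hO.mem_nhds hx)
  · have : f =ᶠ[𝓝 x] fun _ => 0 := by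
      filter_upwards [hC.isOpen_compl.mem_nhds fun h => hx (hCO h)] with y hy using h0 y hy
    exact contDiffAt_const.congr_of_eventuallyEq this

/-- The cut-off in position makes a symbol, known to be smooth over `U` only, smooth on the whole
phase space. -/
theorem IsAmplitude.mul_sym (hU : IsOpen U) (hK : IsCompact K) (hKU : K ⊆ U) {g : ι → E n → ℂ}
    (hg : IsAmplitude e U K g) {a : ι → E n × E n → ℂ} (ha : SlowSym e U (fun _ _ => 1) a) :
    (∀ i, ContDiff ℝ ∞ fun p : E n × E n => a i p * g i p.1) ∧
      SlowSym e U (fun _ _ => 1) fun i p => a i p * g i p.1 := by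
  have hO : IsOpen (U ×ˢ (Set.univ : Set (E n))) := hU.prod isOpen_univ
  have h1 := ha.mul hO (fun _ _ _ => zero_le_one) (fun _ _ _ => zero_le_one)
    (fun j p _ => phaseWeight_nonneg j p) (hg.slow.comp_fst hU fun _ => zero_le_one)
  simp only [mul_one] at h1
  refine ⟨fun i => contDiff_of_contDiffOn_of_support hO (hK.isClosed.preimage continuous_fst)
    (fun p hp => ⟨hKU hp, Set.mem_univ _⟩) (h1.1 i) fun p hp => ?_, h1⟩
  rw [hg.support i p.1 hp, mul_zero]

/-- Microlocal elliptic regularity, by bootstrapping: gain of one power of the frequency at each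
step. -/
theorem elliptic_bootstrap (hU : IsOpen U) (hK : IsCompact K) (hKU : K ⊆ U) (hK' : IsCompact K')
    (hw : IsTestNet K' P w) {a : ι → E n × E n → ℂ} (ha : SlowSym e U (fun _ _ => 1) a)
    (Ξ : ι → E n) {τ : ι → ℝ} (hτ : Slow e τ) (hne : ∀ i, ∀ x ∈ U, a i (x, Ξ i) ≠ 0)
    (hell : ∀ i, ∀ x ∈ U, ‖a i (x, Ξ i)‖⁻¹ ≤ τ i)
    (hreg : ∀ g : ι → E n → ℂ, IsAmplitude e U K g → ∀ k : ℕ,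
      OSlow e P (fun i => ‖twoPiInv n * ∫ η, fourierT (w (e i)) η *
        partialF (fun p => a i p * g i p.1) (Ξ i - η) η‖) fun i => bracket (Ξ i) ^ (-(k : ℝ)))
    (k : ℕ) (h : ι → E n → ℂ) (hh : IsAmplitude e U K h) :
    OSlow e P (fun i => ‖fourierT (fun x => w (e i) x * h i x) (Ξ i)‖)
      fun i => bracket (Ξ i) ^ (-(k : ℝ)) := by
  induction k generalizing h with
  -- Without decay, the sup norm of `w` and a slow bound for `h` suffice; this fixes the exponent
  -- `P`.
  | zero =>
    obtain ⟨σ, hσ, hb⟩ := hh.slow.2 []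
    have hc : 0 ≤ volume.real K := by positivity
    refine hw.oSlow ((Slow.const hc).mul hσ) (fun i => bracket_rpow_nonneg _ _) fun i B hB => ?_
    have hB0 : 0 ≤ B := (norm_nonneg _).trans (hB 0)
    have h1 := norm_fourierT_le hK (h := fun x => w (e i) x * h i x) (B := B * σ i)
      (fun x hx => by rw [hh.support i x hx, mul_zero]) (fun x => ?_) (Ξ i)
    · simpa [mul_assoc, mul_comm, mul_left_comm] using h1
    · rw [norm_mul]
      by_cases hx : x ∈ K
      · have := hb i x (hKU hx)
        simp only [dirD_nil, List.map_nil, List.prod_nil, mul_one] at this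
        exact mul_le_mul (hB x) this (norm_nonneg _) hB0
      · rw [hh.support i x hx, norm_zero, mul_zero]
        exact mul_nonneg hB0 (hσ.1 i)
  | succ k ih =>
    -- divide by the symbol
    set g : ι → E n → ℂ := fun i x => h i x * (a i (x, Ξ i))⁻¹ ^ 1 with hgdef
    have hgs : SlowPos e U (fun _ => 1) g :=
      hh.slow.mul_inv_pow hU (fun _ _ _ => zero_le_one) (fun _ _ _ => zero_le_one)
        (ha.slice hU Ξ) hτ hne hell 1
    have hg : IsAmplitude e U K g :=
      ⟨fun i => contDiff_of_contDiffOn_of_support hU hK.isClosed hKU (hgs.1 i) fun x hx => by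
        simp only [hgdef, hh.support i x hx, zero_mul], fun i x hx => by
        simp only [hgdef, hh.support i x hx, zero_mul], hgs⟩
    set A : ι → E n × E n → ℂ := fun i p => a i p * g i p.1 with hAdef
    obtain ⟨hA, hAS⟩ := hg.mul_sym hU hK hKU ha
    have hA0 : ∀ i, ∀ p : E n × E n, p.1 ∉ K → A i p = 0 := fun i p hp => by
      simp only [hAdef, hg.support i p.1 hp, mul_zero]
    -- Division by the symbol at the frozen frequency makes the leading term of the expansion
    -- exactly the transform to be estimated.
    have hAh : ∀ i x, A i (x, Ξ i) = h i x := fun i x => by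
      simp only [hAdef, hgdef, pow_one]
      by_cases hx : x ∈ K
      · have := hne i x (hKU hx)
        field_simp
      · simp [hh.support i x hx]
    have hrem := expansion_remainder hU hK hKU hK' hw hA hA0 hAS Ξ (k + 1)
    have hlhs := hreg g hg (k + 1)
    have hterm : ∀ j, OSlow e P (fun i =>
        ‖fourierT (fun x => w (e i) x * mixedD^[j + 1] (A i) (x, Ξ i)) (Ξ i)‖)
        fun i => bracket (Ξ i) ^ (-((k + 1 : ℕ) : ℝ)) := by
      intro j
      -- The factor ⟨Ξ⟩^(j+1) normalizes the mixed derivative to an amplitude, so that the induction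
      -- hypothesis applies. Removing it gives decay of order k + j + 1 ≥ k + 1.
      set z : ι → ℝ := fun i => bracket (Ξ i) ^ ((j + 1 : ℕ) : ℝ) with hz
      have hz0 : ∀ i, 0 < z i := fun i => Real.rpow_pos_of_pos (bracket_pos _) _
      have hs := ((hAS.iterate_mixedD hU (j + 1)).slice hU Ξ).family_const_mul
        (fun _ _ _ => zero_le_one) (W' := fun _ _ => 1) (fun i => (z i : ℂ)) fun i x _ => by
          simp only [hz, Complex.norm_real, Real.norm_eq_abs]
          rw [abs_of_nonneg (bracket_rpow_nonneg _ _), ← Real.rpow_add (bracket_pos _)]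
          simp
      have hamp : IsAmplitude e U K fun i x => (z i : ℂ) * mixedD^[j + 1] (A i) (x, Ξ i) :=
        ⟨fun i => contDiff_const.mul
          ((contDiff_iterate_mixedD (hA i) (j + 1)).comp (contDiff_id.prodMk contDiff_const)),
          fun i x hx => by
            rw [iterate_mixedD_eq_zero hK.isClosed (hA0 i) (j + 1) (x, Ξ i) hx, mul_zero], hs⟩
      intro δ hδ
      obtain ⟨C, hC, η, hη, hb⟩ := ih _ hamp δ hδ
      refine ⟨C, hC, η, hη, fun i hi => ?_⟩
      have h1 := hb i hi
      have h2 : fourierT (fun x => w (e i) x * ((z i : ℂ) * mixedD^[j + 1] (A i) (x, Ξ i))) (Ξ i)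
          = (z i : ℂ) * fourierT (fun x => w (e i) x * mixedD^[j + 1] (A i) (x, Ξ i)) (Ξ i) := by
        simp only [fourierT]
        rw [← integral_const_mul]
        congr 1
        ext x
        ring
      beta_reduce at h1 ⊢
      rw [h2, norm_mul, Complex.norm_real, Real.norm_of_nonneg (hz0 i).le] at h1
      have hp := (e i).pos
      refine le_of_mul_le_mul_left (h1.trans ?_) (hz0 i)
      rw [mul_left_comm]
      gcongr
      rw [hz, ← Real.rpow_add (bracket_pos _)]
      refine bracket_rpow_le_rpow _ ?_
      push_cast
      linarith [(Nat.cast_nonneg j : (0 : ℝ) ≤ j)]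
    refine ((hrem.add hlhs).add (OSlow.sum (Finset.range k) fun j _ => hterm j)).mono_left
      fun i => ?_
    set X := twoPiInv n * ∫ η, fourierT (w (e i)) η * partialF (A i) (Ξ i - η) η
    set T : ℕ → ℂ := fun j => fourierT (fun x => w (e i) x * mixedD^[j] (A i) (x, Ξ i)) (Ξ i)
      with hT
    have hT0 : fourierT (fun x => w (e i) x * h i x) (Ξ i) = T 0 := by
      simp only [hT, Function.iterate_zero, id, hAh]
    rw [hT0]
    have hsplit : ∑ j ∈ Finset.range (k + 1), ((1 / j.factorial : ℝ) : ℂ) * T j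
        = (∑ j ∈ Finset.range k, ((1 / (j + 1).factorial : ℝ) : ℂ) * T (j + 1)) + T 0 := by
      rw [Finset.sum_range_succ']
      simp
    have hsum : ‖∑ j ∈ Finset.range k, ((1 / (j + 1).factorial : ℝ) : ℂ) * T (j + 1)‖
        ≤ ∑ j ∈ Finset.range k, ‖T (j + 1)‖ := by
      refine (norm_sum_le _ _).trans (Finset.sum_le_sum fun j _ => ?_)
      rw [norm_mul, Complex.norm_real, Real.norm_of_nonneg (by positivity)]
      refine mul_le_of_le_one_left (norm_nonneg _) ?_
      rw [div_le_one (by positivity)]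
      exact_mod_cast Nat.succ_le_of_lt (Nat.factorial_pos _)
    -- The leading term is the pairing, minus the Taylor remainder, minus the higher terms; each of
    -- the three has already been bounded.
    have hid : T 0 = X - (X - ∑ j ∈ Finset.range (k + 1), ((1 / j.factorial : ℝ) : ℂ) * T j)
        - ∑ j ∈ Finset.range k, ((1 / (j + 1).factorial : ℝ) : ℂ) * T (j + 1) := by
      rw [hsplit]
      ring
    have h1 := norm_sub_le (X - (X - ∑ j ∈ Finset.range (k + 1), ((1 / j.factorial : ℝ) : ℂ) * T j))
      (∑ j ∈ Finset.range k, ((1 / (j + 1).factorial : ℝ) : ℂ) * T (j + 1))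
    have h2 := norm_sub_le X (X - ∑ j ∈ Finset.range (k + 1), ((1 / j.factorial : ℝ) : ℂ) * T j)
    rw [← hid] at h1
    linarith

end Bootstrap

/-! ### From nets of symbols and functions to slow families -/

section SymbolNets

variable {n : ℕ} {ι : Type*} {Ω U : Opens (E n)}

/-- Brings mixed derivatives into the order used by `symDeriv`, frequency directions before position
directions. -/
theorem exists_perm_inr_inl {J J' : Type*} (l : List (J ⊕ J')) :
    ∃ (α : List J') (β : List J), l.Perm (α.map Sum.inr ++ β.map Sum.inl) := by
  induction l with
  | nil => exact ⟨[], [], by simp⟩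
  | cons a l ih =>
    obtain ⟨α, β, h⟩ := ih
    rcases a with a | a
    · exact ⟨α, a :: β, (h.cons _).trans (by simpa using List.perm_middle.symm)⟩
    · exact ⟨a :: α, β, by simpa using h⟩

theorem dirD_phaseDir_eq_symDeriv {a : E n → E n → ℂ} (ha : SymSmooth Ω a) (α β : List (Fin n))
    {x : E n} (hx : x ∈ Ω) (ξ : E n) :
    dirD phaseDir (α.map Sum.inr ++ β.map Sum.inl) (fun p : E n × E n => a p.1 p.2) (x, ξ)
      = symDeriv α.get β.get a x ξ := by
  rw [symDeriv, iteratedFDeriv_apply_eq_dirD (Ω.isOpen.prod isOpen_univ) ha _ _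
    (x := (x, ξ)) ⟨hx, Set.mem_univ _⟩, List.ofFn_fin_append]
  have h1 : (List.ofFn fun i => ((0 : E n), EuclideanSpace.single (α.get i) (1 : ℝ)))
      = (α.map Sum.inr).map (phaseDir (n := n)) := by
    conv_rhs => rw [← List.ofFn_get α, List.map_ofFn, List.map_ofFn]
    rfl
  have h2 : (List.ofFn fun i => (EuclideanSpace.single (β.get i) (1 : ℝ), (0 : E n)))
      = (β.map Sum.inl).map (phaseDir (n := n)) := by
    conv_rhs => rw [← List.ofFn_get β, List.map_ofFn, List.map_ofFn]
    rfl
  rw [h1, h2, ← List.map_append, dirD_map]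
  rfl

theorem prod_phaseWeight_inr_inl (α β : List (Fin n)) (p : E n × E n) :
    ((α.map Sum.inr ++ β.map Sum.inl).map fun j => phaseWeight j p).prod
      = (bracket p.2)⁻¹ ^ α.length := by
  simp [List.map_append, List.map_map, Function.comp_def, phaseWeight, List.prod_append,
    List.prod_replicate]

theorem slowSym_of_isSlowScaleNet {a : Eps → E n → E n → ℂ} (ha : IsSlowScaleNet Ω 0 a)
    (hU : RelCompact Ω U) (e : ι → Eps) :
    SlowSym e (U : Set (E n)) (fun _ _ => 1) fun i p => a (e i) p.1 p.2 := by
  have hUΩ : (U : Set (E n)) ⊆ Ω := subset_closure.trans hU.2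
  obtain ⟨s, hs, hb⟩ := ha.2 _ hU.1 hU.2
  have hO : IsOpen ((Ω : Set (E n)) ×ˢ (Set.univ : Set (E n))) := Ω.isOpen.prod isOpen_univ
  refine ⟨fun i => (ha.1 (e i)).1.mono (Set.prod_mono hUΩ subset_rfl), fun l => ?_⟩
  obtain ⟨α, β, hl⟩ := exists_perm_inr_inl l
  obtain ⟨c, hc, h⟩ := hb α.length β.length α.get β.get
  refine ⟨_, (Slow.const hc.le).mul hs.slow, fun i p hp => ?_⟩
  have hpΩ : p.1 ∈ Ω := hUΩ hp.1
  rw [(hl.map _).prod_eq, prod_phaseWeight_inr_inl, dirD_perm hO hl (ha.1 (e i)).1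
    (show p ∈ (Ω : Set (E n)) ×ˢ Set.univ from ⟨hpΩ, Set.mem_univ _⟩)]
  have h1 := h (e i) p.1 (subset_closure hp.1) p.2
  rw [neg_zero, zero_add, Real.rpow_natCast] at h1
  rw [one_mul, dirD_phaseDir_eq_symDeriv (ha.1 (e i)).1 α β hpΩ p.2, inv_pow, ← div_eq_mul_inv,
    le_div_iff₀ (pow_pos (bracket_pos _) _), mul_comm]
  exact h1

theorem exists_unifBigO_sum {X κ : Type*} {K : Set X} (s : Finset κ) {f : κ → Eps → X → ℝ}
    (h : ∀ k ∈ s, ∃ p : ℝ, UnifBigO K (f k) (-p)) :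
    ∃ p : ℝ, UnifBigO K (fun ε x => ∑ k ∈ s, ‖f k ε x‖) (-p) := by
  classical
  induction s using Finset.induction_on with
  | empty => exact ⟨0, 0, 1, one_pos, fun ε _ x _ => by simp⟩
  | insert k s hk ih =>
    obtain ⟨p, hp⟩ := h k (Finset.mem_insert_self _ _)
    obtain ⟨q, hq⟩ := ih fun k' hk' => h k' (Finset.mem_insert_of_mem hk')
    refine ⟨max p q, (hp.mono (neg_le_neg (le_max_left p q))).of_le_add
      (hq.mono (neg_le_neg (le_max_right p q))) fun ε x _ => ?_⟩
    simp only [Finset.sum_insert hk]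
    refine (norm_add_le _ _).trans ?_
    rw [norm_norm]

theorem UnifBigO.of_norm_le_mul {X V V' : Type*} [Norm V] [Norm V'] {K : Set X}
    {f : Eps → X → V} {h : Eps → X → V'} {r : ℝ} (hf : UnifBigO K f r) (c : ℝ) (hc : 0 ≤ c)
    (H : ∀ ε, ∀ x ∈ K, ‖h ε x‖ ≤ c * ‖f ε x‖) : UnifBigO K h r := by
  obtain ⟨C, η, hη, hf⟩ := hf
  refine ⟨c * C, η, hη, fun ε hε x hx => (H ε x hx).trans ?_⟩
  rw [mul_assoc]
  exact mul_le_mul_of_nonneg_left (hf ε hε x hx) hc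

theorem UnifBigO.exists_nonneg {X V : Type*} [Norm V] {K : Set X} {f : Eps → X → V} {r : ℝ}
    (h : UnifBigO K f r) : ∃ C : ℝ, 0 ≤ C ∧ ∃ η : ℝ, 0 < η ∧ ∀ ε : Eps, (ε : ℝ) < η →
      ∀ x ∈ K, ‖f ε x‖ ≤ C * (ε : ℝ) ^ r := by
  obtain ⟨C, η, hη, h⟩ := h
  refine ⟨|C|, abs_nonneg C, η, hη, fun ε hε x hx => (h ε hε x hx).trans ?_⟩
  exact mul_le_mul_of_nonneg_right (le_abs_self C) (Real.rpow_pos_of_pos ε.pos r).le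

theorem norm_stdB (i : Fin n) : ‖(stdB i : E n)‖ = 1 := by simp [stdB]

theorem norm_dirD_stdB_le {O : Set (E n)} {f : E n → ℂ} (hO : IsOpen O) (hf : ContDiffOn ℝ ∞ f O)
    (l : List (Fin n)) {x : E n} (hx : x ∈ O) :
    ‖dirD stdB l f x‖ ≤ ‖iteratedFDeriv ℝ l.length f x‖ := by
  simpa [norm_stdB] using norm_dirD_le (v := stdB) hO hf l hx

/-- Regularity of the net enters here: the exponent `N` is common to all derivatives, so it can sit
in the weight. -/
theorem slowPos_of_isRegularNet {r : Eps → E n → ℂ} (hr : IsRegularNet Ω r)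
    (hU : RelCompact Ω U) (e : ι → Eps) : ∃ N : ℝ, 0 ≤ N ∧
      SlowPos e (U : Set (E n)) (fun i => (e i : ℝ) ^ (-N)) fun i => r (e i) := by
  classical
  have hUΩ : (U : Set (E n)) ⊆ Ω := subset_closure.trans hU.2
  obtain ⟨p, hp⟩ := hr.2 _ hU.1 hU.2
  refine ⟨max p 0, le_max_right _ _, fun i => (hr.1 (e i)).mono hUΩ, fun l => ?_⟩
  obtain ⟨C, hC, η, hη, h⟩ := (hp l.length).exists_nonneg
  have hb : ∀ ε, ∃ b, 0 ≤ b ∧ ∀ x ∈ U, ‖dirD stdB l (r ε) x‖ ≤ b := by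
    intro ε
    obtain ⟨b, hb⟩ := hU.1.exists_bound_of_continuousOn
      ((contDiffOn_dirD (v := stdB) Ω.isOpen (hr.1 ε) l).continuousOn.mono hU.2)
    exact ⟨max b 0, le_max_right _ _,
      fun x hx => (hb x (subset_closure hx)).trans (le_max_left _ _)⟩
  choose b hb0 hb using hb
  -- The regularity estimate is available for ε < η only. For larger ε any finite bound will do,
  -- since `Slow` restricts small ε alone.
  refine ⟨fun i => if (e i : ℝ) < η then C else b (e i), ⟨fun i => ?_, fun δ hδ =>
    ⟨C, hC, η, hη, fun i hi => ?_⟩⟩, fun i x hx => ?_⟩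
  · beta_reduce
    split_ifs
    · exact hC
    · exact hb0 _
  · beta_reduce
    rw [if_pos hi]
    exact le_mul_of_one_le_right hC (one_le_eps_rpow _ hδ.le)
  · simp only [List.map_const', List.prod_replicate, one_pow, mul_one]
    split_ifs with hi
    · refine (norm_dirD_stdB_le Ω.isOpen (hr.1 _) l (hUΩ hx)).trans
        ((h (e i) hi x (subset_closure hx)).trans (mul_le_mul_of_nonneg_left ?_ hC))
      exact Real.rpow_le_rpow_of_exponent_ge (e i).pos (e i).le_one
        (neg_le_neg (le_max_left p 0))
    · exact (hb (e i) x hx).trans (le_mul_of_one_le_right (hb0 _)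
        (one_le_eps_rpow _ (le_max_right p 0)))

theorem IsTest.contDiff_mul {F : Type*} [NormedAddCommGroup F] [NormedSpace ℝ F] {Ω : Opens F}
    {ψ r : F → ℂ} (hψ : IsTest Ω ψ) (hr : ContDiffOn ℝ ∞ r Ω) :
    ContDiff ℝ ∞ fun x => ψ x * r x :=
  contDiff_of_contDiffOn_of_support Ω.isOpen (isClosed_tsupport ψ) hψ.2.2
    (hψ.1.contDiffOn.mul hr) fun x hx => by
      rw [image_eq_zero_of_notMem_tsupport hx, zero_mul]

/-- All derivatives of `ψ u_ε`, `ψ` a test function, are of moderate growth on the whole space. -/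
theorem IsTest.unifBigO_iteratedFDeriv_mul {F : Type*} [NormedAddCommGroup F] [NormedSpace ℝ F]
    {Ω : Opens F} {ψ : F → ℂ} (hψ : IsTest Ω ψ) {r : Eps → F → ℂ} (hr : IsModerate Ω r) (k : ℕ) :
    ∃ p : ℝ, UnifBigO Set.univ (fun ε => iteratedFDeriv ℝ k fun x => ψ x * r ε x) (-p) := by
  have hk : ∀ j : ℕ, (j : WithTop ℕ∞) ≤ ∞ := fun j => by exact_mod_cast le_top
  have hK : IsCompact (tsupport ψ) := hψ.2.1
  obtain ⟨p, hp⟩ := exists_unifBigO_sum (K := tsupport ψ) (Finset.range (k + 1))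
    (f := fun j ε x => (k.choose j : ℝ) * ‖iteratedFDeriv ℝ j ψ x‖ *
      ‖iteratedFDeriv ℝ (k - j) (r ε) x‖) fun j _ => by
    obtain ⟨p, hp⟩ := hr.2 _ hK hψ.2.2 (k - j)
    obtain ⟨b, hb⟩ := hK.exists_bound_of_continuousOn
      (hψ.1.continuous_iteratedFDeriv (hk j)).continuousOn
    refine ⟨p, hp.of_norm_le_mul ((k.choose j : ℝ) * |b|) (by positivity) fun ε x hx => ?_⟩
    rw [norm_mul, norm_mul, norm_norm, norm_norm, Real.norm_natCast]
    gcongr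
    exact (hb x hx).trans (le_abs_self b)
  refine ⟨p, ?_⟩
  obtain ⟨C, hC, η, hη, h⟩ := hp.exists_nonneg
  refine ⟨C, η, hη, fun ε hε x _ => ?_⟩
  by_cases hx : x ∈ tsupport ψ
  · refine le_trans ?_ (h ε hε x hx)
    have hxΩ := hψ.2.2 hx
    have h1 := norm_iteratedFDerivWithin_mul_le (𝕜 := ℝ) (s := (Ω : Set F)) (n := k) (N := k)
      (hψ.1.contDiffOn.of_le (hk k)) ((hr.1 ε).of_le (hk k)) Ω.isOpen.uniqueDiffOn hxΩ le_rfl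
    rw [iteratedFDerivWithin_of_isOpen k Ω.isOpen hxΩ] at h1
    refine h1.trans ((Finset.sum_le_sum fun j _ => ?_).trans (le_abs_self _))
    rw [iteratedFDerivWithin_of_isOpen _ Ω.isOpen hxΩ,
      iteratedFDerivWithin_of_isOpen _ Ω.isOpen hxΩ]
    exact le_abs_self _
  · have h0 : (fun x => ψ x * r ε x) =ᶠ[𝓝 x] fun _ => 0 := by
      filter_upwards [(isClosed_tsupport ψ).isOpen_compl.mem_nhds hx] with y hy
      rw [image_eq_zero_of_notMem_tsupport hy, zero_mul]
    beta_reduce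
    rw [(h0.iteratedFDeriv ℝ k).eq_of_nhds]
    have := ε.pos
    simp only [iteratedFDeriv_fun_zero, Pi.zero_apply, norm_zero]
    positivity

/-- Moderate nets of test functions supported in `K`. -/
structure IsModerateTestNet (K : Set (E n)) (w : Eps → E n → ℂ) : Prop where
  smooth : ∀ ε, ContDiff ℝ ∞ (w ε)
  support : ∀ ε, ∀ x, x ∉ K → w ε x = 0
  moderate : ∀ k : ℕ, ∃ p : ℝ, UnifBigO Set.univ (fun ε => iteratedFDeriv ℝ k (w ε)) (-p)

theorem IsTest.isModerateTestNet {ψ : E n → ℂ} (hψ : IsTest Ω ψ) {r : Eps → E n → ℂ}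
    (hr : IsModerate Ω r) : IsModerateTestNet (tsupport ψ) fun ε x => ψ x * r ε x :=
  ⟨fun ε => hψ.contDiff_mul (hr.1 ε), fun ε x hx => by
    rw [image_eq_zero_of_notMem_tsupport hx, zero_mul], hψ.unifBigO_iteratedFDeriv_mul hr⟩

variable {K : Set (E n)} {w : Eps → E n → ℂ}

theorem IsModerateTestNet.exists_isTestNet (hw : IsModerateTestNet K w) :
    ∃ P : ℝ, 0 ≤ P ∧ IsTestNet K P w := by
  obtain ⟨p, hp⟩ := hw.moderate 0
  obtain ⟨C, hC, η, hη, h⟩ := (hp.mono (neg_le_neg (le_max_left p 0))).exists_nonneg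
  exact ⟨max p 0, le_max_right _ _, hw.smooth, hw.support, C, hC, η, hη, fun ε hε x => by
    simpa using h ε hε x (Set.mem_univ _)⟩

/-- The exponent depends on `M`. This is harmless where another factor is smaller than every power
of ε, which is how the estimate is used. -/
theorem IsModerateTestNet.fourierT_decay (hK : IsCompact K) (hw : IsModerateTestNet K w) (M : ℕ) :
    ∃ p : ℝ, 0 ≤ p ∧ ∃ C : ℝ, 0 ≤ C ∧ ∃ η : ℝ, 0 < η ∧ ∀ ε : Eps, (ε : ℝ) < η → ∀ ζ,
      bracket ζ ^ M * ‖fourierT (w ε) ζ‖ ≤ C * (ε : ℝ) ^ (-p) := by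
  have hfin : {l : List (Fin n) | l.length ≤ M}.Finite := List.finite_length_le _ M
  obtain ⟨p, hp⟩ := exists_unifBigO_sum (K := (Set.univ : Set (E n))) hfin.toFinset
    (f := fun l ε x => ‖dirD stdB l (w ε) x‖) fun l _ => by
    obtain ⟨p, hp⟩ := hw.moderate l.length
    refine ⟨p, hp.of_norm_le_mul 1 zero_le_one fun ε x _ => ?_⟩
    rw [norm_norm, one_mul]
    exact norm_dirD_stdB_le isOpen_univ (hw.smooth ε).contDiffOn l (Set.mem_univ x)
  obtain ⟨C, hC, η, hη, h⟩ := (hp.mono (neg_le_neg (le_max_left p 0))).exists_nonneg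
  refine ⟨max p 0, le_max_right _ _, (1 + n) ^ M * volume.real K * C, by positivity, η, hη,
    fun ε hε ζ => ?_⟩
  have h1 := Colombeau.fourierT_decay hK M (hw.smooth ε) (hw.support ε)
    (B := C * (ε : ℝ) ^ (-max p 0)) (fun l hl x => ?_) ζ
  · exact h1.trans_eq (by ring)
  · refine le_trans ?_ (h ε hε x (Set.mem_univ _))
    refine le_trans ?_ (le_abs_self _)
    have := Finset.single_le_sum (f := fun l : List (Fin n) => ‖‖dirD stdB l (w ε) x‖‖)
      (fun _ _ => norm_nonneg _) (hfin.mem_toFinset.2 hl)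
    simpa using this

end SymbolNets

/-! ### Fourier decay for localizations of a regular image -/

section Regularity

variable {n : ℕ} {ι : Type*} {e : ι → Eps} {U K K' : Set (E n)} {w : Eps → E n → ℂ}

/-- A function of position is a symbol independent of the frequency, so the decay of partial
transforms applies. -/
theorem SlowPos.fourierT_decay (hU : IsOpen U) (hK : IsCompact K) (hKU : K ⊆ U) {W : ι → ℝ}
    (hW : ∀ i, 0 ≤ W i) {h : ι → E n → ℂ} (hh : ∀ i, ContDiff ℝ ∞ (h i))
    (h0 : ∀ i, ∀ x, x ∉ K → h i x = 0) (hs : SlowPos e U W h) (M : ℕ) :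
    ∃ σ, Slow e σ ∧ ∀ i ζ, bracket ζ ^ M * ‖fourierT (h i) ζ‖ ≤ σ i * W i := by
  obtain ⟨σ, hσ, hb⟩ := (hs.comp_fst hU hW).partialF_decay hK hKU hU (fun i _ => hW i)
    (fun i => (hh i).comp contDiff_fst) (fun i p hp => h0 i p.1 hp) M
  exact ⟨σ, hσ, fun i ζ => hb i ζ 0⟩

theorem bracket_pow_le (M : ℕ) (ξ η : E n) :
    bracket ξ ^ M ≤ 2 ^ M * bracket η ^ M * bracket (ξ - η) ^ M := by
  have h := bracket_add_le η (ξ - η)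
  rw [add_sub_cancel] at h
  rw [← mul_pow, ← mul_pow]
  exact pow_le_pow_left₀ (bracket_pos _).le h M

/-- Crude decay of a symbol acting on a moderate net. -/
theorem pairing_crude (hU : IsOpen U) (hK : IsCompact K) (hKU : K ⊆ U) (hK' : IsCompact K')
    (hw : IsModerateTestNet K' w) {A : ι → E n × E n → ℂ} (hA : ∀ i, ContDiff ℝ ∞ (A i))
    (h0 : ∀ i, ∀ p : E n × E n, p.1 ∉ K → A i p = 0) (hS : SlowSym e U (fun _ _ => 1) A) (M : ℕ) :
    ∃ p : ℝ, 0 ≤ p ∧ ∃ C : ℝ, 0 ≤ C ∧ ∃ θ : ℝ, 0 < θ ∧ ∀ i, (e i : ℝ) < θ → ∀ ξ : E n,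
      bracket ξ ^ M * ‖twoPiInv n * ∫ η, fourierT (w (e i)) η * partialF (A i) (ξ - η) η‖
        ≤ C * (e i : ℝ) ^ (-p) := by
  -- The weight ⟨ξ⟩^M is split between η and ξ - η: M powers are absorbed by each factor, and n + 1
  -- further powers of ⟨η⟩ give integrability.
  obtain ⟨p, hp, C, hC, θ, hθ, hwd⟩ := hw.fourierT_decay hK' (M + n + 1)
  obtain ⟨σ, hσ, hAd⟩ := hS.partialF_decay hK hKU hU (fun _ _ => zero_le_one) hA h0 M
  obtain ⟨D, hD, θ', hθ', hσb⟩ := hσ.2 1 one_pos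
  set I : ℝ := ∫ η : E n, bracket η ^ (-((n : ℝ) + 1)) with hI
  have hI0 : 0 ≤ I := integral_nonneg fun η => bracket_rpow_nonneg _ _
  refine ⟨p + 1, by positivity, ‖twoPiInv n‖ * (2 ^ M * C * D) * I, by positivity, min θ θ',
    lt_min hθ hθ', fun i hi ξ => ?_⟩
  have hp0 := (e i).pos
  have h1 := hwd (e i) (hi.trans_le (min_le_left _ _))
  have h2 := hσb i (hi.trans_le (min_le_right _ _))
  have h3 : ‖∫ η, ((bracket ξ ^ M : ℝ) : ℂ) * (fourierT (w (e i)) η * partialF (A i) (ξ - η) η)‖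
      ≤ ∫ η : E n, 2 ^ M * (C * (e i : ℝ) ^ (-p)) * (D * (e i : ℝ) ^ (-(1 : ℝ))) *
        bracket η ^ (-((n : ℝ) + 1)) := by
    refine norm_integral_le_of_norm_le
      ((integrable_bracket_rpow (lt_add_one (n : ℝ))).const_mul _)
      (Filter.Eventually.of_forall fun η => ?_)
    have hη := bracket_pos η
    have h4 := bracket_pow_le M ξ η
    have h5 := h1 η
    have h6 := hAd i (ξ - η) η
    rw [mul_one] at h6
    have h7 : bracket η ^ (M + n + 1) = bracket η ^ M * bracket η ^ ((n : ℝ) + 1) := by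
      rw [pow_add, pow_add, mul_assoc]
      congr 1
      rw [← pow_add, ← Real.rpow_natCast]
      push_cast
      rfl
    rw [h7] at h5
    rw [norm_mul, norm_mul, Complex.norm_real, Real.norm_of_nonneg (pow_nonneg (bracket_pos ξ).le _)]
    have h8 : bracket η ^ M * ‖fourierT (w (e i)) η‖ ≤
        C * (e i : ℝ) ^ (-p) * bracket η ^ (-((n : ℝ) + 1)) := by
      rw [Real.rpow_neg hη.le, ← div_eq_mul_inv, le_div_iff₀ (Real.rpow_pos_of_pos hη _)]
      linarith
    calc bracket ξ ^ M * (‖fourierT (w (e i)) η‖ * ‖partialF (A i) (ξ - η) η‖)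
        ≤ (2 ^ M * bracket η ^ M * bracket (ξ - η) ^ M) *
          (‖fourierT (w (e i)) η‖ * ‖partialF (A i) (ξ - η) η‖) := by gcongr
      _ = 2 ^ M * (bracket η ^ M * ‖fourierT (w (e i)) η‖) *
          (bracket (ξ - η) ^ M * ‖partialF (A i) (ξ - η) η‖) := by ring
      _ ≤ 2 ^ M * (C * (e i : ℝ) ^ (-p) * bracket η ^ (-((n : ℝ) + 1))) *
          (D * (e i : ℝ) ^ (-(1 : ℝ))) := by
          refine mul_le_mul (mul_le_mul_of_nonneg_left h8 (by positivity)) (h6.trans h2)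
            (mul_nonneg (pow_nonneg (bracket_pos _).le _) (norm_nonneg _)) ?_
          have := bracket_rpow_nonneg η (-((n : ℝ) + 1))
          positivity
      _ = _ := by ring
  rw [integral_const_mul, integral_const_mul, norm_mul, Complex.norm_real,
    Real.norm_of_nonneg (pow_nonneg (bracket_pos ξ).le _)] at h3
  rw [norm_mul, mul_left_comm]
  calc _ ≤ ‖twoPiInv n‖ * (2 ^ M * (C * (e i : ℝ) ^ (-p)) * (D * (e i : ℝ) ^ (-(1 : ℝ))) * I) := by
        gcongr
    _ = ‖twoPiInv n‖ * (2 ^ M * C * D) * I * ((e i : ℝ) ^ (-p) * (e i : ℝ) ^ (-(1 : ℝ))) := by ring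
    _ = _ := by
        rw [← Real.rpow_add hp0]
        congr 2
        ring

/-- If `a(x,D)w` agrees with a regular net up to errors smaller than any power of `ε`, then its
localizations have rapidly decreasing Fourier transforms, at the cost of one power of `ε`. -/
theorem pairing_regular (hU : IsOpen U) (hK : IsCompact K) (hKU : K ⊆ U) (hK' : IsCompact K')
    (hw : IsModerateTestNet K' w) {a : Eps → E n → E n → ℂ}
    (ha : SlowSym e U (fun _ _ => 1) fun i p => a (e i) p.1 p.2) {f : Eps → E n → ℂ} {N : ℝ}
    (hN : 0 ≤ N) (hf : SlowPos e U (fun i => (e i : ℝ) ^ (-N)) fun i => f (e i))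
    (herr : ∀ q : ℝ, UnifBigO K (fun ε x => quantize (a ε) (w ε) x - f ε x) q)
    (Ξ : ι → E n) (g : ι → E n → ℂ) (hg : IsAmplitude e U K g) (k : ℕ) :
    OSlow e N (fun i => ‖twoPiInv n * ∫ η, fourierT (w (e i)) η *
      partialF (fun p => a (e i) p.1 p.2 * g i p.1) (Ξ i - η) η‖)
      fun i => bracket (Ξ i) ^ (-(k : ℝ)) := by
  obtain ⟨hA, hAS⟩ := hg.mul_sym hU hK hKU ha
  have hA0 : ∀ i, ∀ p : E n × E n, p.1 ∉ K → a (e i) p.1 p.2 * g i p.1 = 0 := fun i p hp => by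
    rw [hg.support i p.1 hp, mul_zero]
  set X : ι → ℂ := fun i => twoPiInv n * ∫ η, fourierT (w (e i)) η *
      partialF (fun p => a (e i) p.1 p.2 * g i p.1) (Ξ i - η) η with hX
  obtain ⟨σA, hσA, hbA⟩ := hAS.2 []
  have hAb : ∀ i x ξ, ‖a (e i) x ξ * g i x‖ ≤ σA i := fun i x ξ => by
    by_cases hx : x ∈ K
    · simpa using hbA i (x, ξ) ⟨hKU hx, Set.mem_univ _⟩
    · rw [hA0 i (x, ξ) hx, norm_zero]
      exact hσA.1 i
  -- By Fubini the pairing is the Fourier transform of `g` times the quantization, which can be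
  -- compared with that of `g` times the regular net `f`.
  have hfub := fun i => fourierT_quantize_mul hK (a := a (e i)) (w := w (e i)) (h := g i)
    (continuous_fourierT_of_support hK' (hw.smooth _) (hw.support _))
    (integrable_fourierT hK' (hw.smooth _) (hw.support _)) (hA i).continuous
    (hg.support i) (hAb i) (Ξ i)
  -- the regular part
  have hW : ∀ i, 0 ≤ (e i : ℝ) ^ (-N) := fun i => Real.rpow_nonneg (e i).pos.le _
  have hfg : SlowPos e U (fun i => (e i : ℝ) ^ (-N)) fun i x => f (e i) x * g i x := by
    have h1 := hf.mul hU (fun i _ _ => hW i) (fun _ _ _ => zero_le_one)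
      (fun _ _ _ => zero_le_one) hg.slow
    simpa only [mul_one] using h1
  have hfg0 : ∀ i, ∀ x, x ∉ K → f (e i) x * g i x = 0 := fun i x hx => by
    rw [hg.support i x hx, mul_zero]
  have hfgs : ∀ i, ContDiff ℝ ∞ fun x => f (e i) x * g i x := fun i =>
    contDiff_of_contDiffOn_of_support hU hK.isClosed hKU (hfg.1 i) (hfg0 i)
  set Y : ι → ℂ := fun i => fourierT (fun x => f (e i) x * g i x) (Ξ i) with hY
  have hYdec := hfg.fourierT_decay hU hK hKU hW hfgs hfg0
  have hdiff : ∀ i, X i - Y i = fourierT (fun x => (quantize (a (e i)) (w (e i)) x - f (e i) x) *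
      g i x) (Ξ i) := by
    intro i
    rw [hX, hY]
    simp only
    rw [show (twoPiInv n * ∫ η, fourierT (w (e i)) η *
      partialF (fun p => a (e i) p.1 p.2 * g i p.1) (Ξ i - η) η) = _ from (hfub i).2.symm]
    simp only [fourierT]
    rw [← integral_sub (hfub i).1]
    · congr 1
      ext x
      ring
    · exact integrable_of_support hK (by have := (hfgs i).continuous; fun_prop) fun x hx => by
        rw [hfg0 i x hx, mul_zero]
  -- collect the bounds
  obtain ⟨p, hp, C₁, hC₁, θ₁, hθ₁, hXc⟩ := pairing_crude hU hK hKU hK' hw hA hA0 hAS (2 * k)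
  obtain ⟨σ₂, hσ₂, hY2⟩ := hYdec (2 * k)
  obtain ⟨C₂, hC₂, θ₂, hθ₂, hσ₂b⟩ := hσ₂.2 1 one_pos
  obtain ⟨σg, hσg, hgb⟩ := hg.slow.2 []
  obtain ⟨C₃, hC₃, θ₃, hθ₃, hσgb⟩ := hσg.2 1 one_pos
  -- ε^(-Q) dominates both the crude bound ε^(-p) for the pairing and the bound ε^(-N-1) for the
  -- regular part.
  set Q : ℝ := p + N + 1 with hQ
  -- The additional power of ε compensates the slow bound of `g`, taken with δ = 1.
  obtain ⟨C₄, hC₄, θ₄, hθ₄, herr'⟩ := (herr (Q + 1)).exists_nonneg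
  obtain ⟨σ₅, hσ₅, hY5⟩ := hYdec k
  set C₆ : ℝ := Real.sqrt ((C₁ + C₂) * (volume.real K * (C₄ * C₃))) with hC₆
  intro δ hδ
  obtain ⟨C₅, hC₅, θ₅, hθ₅, hσ₅b⟩ := hσ₅.2 δ hδ
  refine ⟨C₆ + C₅, by positivity, min θ₁ (min θ₂ (min θ₃ (min θ₄ θ₅))), by positivity,
    fun i hi => ?_⟩
  simp only [lt_min_iff] at hi
  obtain ⟨hi1, hi2, hi3, hi4, hi5⟩ := hi
  have he := (e i).pos
  have hle1 := (e i).le_one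
  set b := bracket (Ξ i) with hb
  have hb0 : 0 < b := bracket_pos _
  have hsmall : ‖X i - Y i‖ ≤ volume.real K * (C₄ * C₃) * (e i : ℝ) ^ Q := by
    rw [hdiff]
    refine (norm_fourierT_le hK (B := C₄ * (e i : ℝ) ^ (Q + 1) * (C₃ * (e i : ℝ) ^ (-(1 : ℝ))))
      (fun x hx => by rw [hg.support i x hx, mul_zero]) (fun x => ?_) (Ξ i)).trans_eq ?_
    · rw [norm_mul]
      by_cases hx : x ∈ K
      · have h1 := hgb i x (hKU hx)
        simp only [dirD_nil, List.map_nil, List.prod_nil, mul_one] at h1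
        exact mul_le_mul (herr' (e i) hi4 x hx) (h1.trans (hσgb i hi3)) (norm_nonneg _)
          (by positivity)
      · rw [hg.support i x hx, norm_zero, mul_zero]
        positivity
    · have : (e i : ℝ) ^ (Q + 1) * (e i : ℝ) ^ (-(1 : ℝ)) = (e i : ℝ) ^ Q := by
        rw [← Real.rpow_add he]
        congr 1
        ring
      rw [← this]
      ring
  have hbig : b ^ (2 * k) * ‖X i - Y i‖ ≤ (C₁ + C₂) * (e i : ℝ) ^ (-Q) := by
    have h1 := hXc i hi1 (Ξ i)
    have h2 := (hY2 i (Ξ i)).trans (mul_le_mul_of_nonneg_right (hσ₂b i hi2) (hW i))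
    have h3 : (e i : ℝ) ^ (-p) ≤ (e i : ℝ) ^ (-Q) :=
      Real.rpow_le_rpow_of_exponent_ge he hle1 (by linarith)
    have h4 : (e i : ℝ) ^ (-(1 : ℝ)) * (e i : ℝ) ^ (-N) ≤ (e i : ℝ) ^ (-Q) := by
      rw [← Real.rpow_add he]
      exact Real.rpow_le_rpow_of_exponent_ge he hle1 (by linarith)
    calc b ^ (2 * k) * ‖X i - Y i‖ ≤ b ^ (2 * k) * (‖X i‖ + ‖Y i‖) := by
          gcongr
          exact norm_sub_le _ _
      _ = b ^ (2 * k) * ‖X i‖ + b ^ (2 * k) * ‖Y i‖ := mul_add _ _ _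
      _ ≤ C₁ * (e i : ℝ) ^ (-p) + C₂ * (e i : ℝ) ^ (-(1 : ℝ)) * (e i : ℝ) ^ (-N) :=
          add_le_add h1 h2
      _ ≤ C₁ * (e i : ℝ) ^ (-Q) + C₂ * (e i : ℝ) ^ (-Q) := by
          rw [mul_assoc C₂]
          gcongr
      _ = _ := by ring
  -- Interpolation: the square is the product of a bound of order 2k with loss ε^(-Q) and a bound
  -- without decay but with gain ε^Q. The difference thus decays at order k with no loss in ε,
  -- whatever the exponent p was.
  have hmid : b ^ k * ‖X i - Y i‖ ≤ C₆ := by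
    refine Real.le_sqrt_of_sq_le ?_
    calc (b ^ k * ‖X i - Y i‖) ^ 2 = (b ^ (2 * k) * ‖X i - Y i‖) * ‖X i - Y i‖ := by ring
      _ ≤ ((C₁ + C₂) * (e i : ℝ) ^ (-Q)) * (volume.real K * (C₄ * C₃) * (e i : ℝ) ^ Q) :=
          mul_le_mul hbig hsmall (norm_nonneg _) (by positivity)
      _ = (C₁ + C₂) * (volume.real K * (C₄ * C₃)) * ((e i : ℝ) ^ (-Q) * (e i : ℝ) ^ Q) := by ring
      _ = _ := by
          rw [← Real.rpow_add he]
          simp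
  have hYk : b ^ k * ‖Y i‖ ≤ C₅ * (e i : ℝ) ^ (-(N + δ)) := by
    refine (hY5 i (Ξ i)).trans ((mul_le_mul_of_nonneg_right (hσ₅b i hi5) (hW i)).trans_eq ?_)
    rw [mul_assoc, ← Real.rpow_add he]
    congr 2
    ring
  have hone : 1 ≤ (e i : ℝ) ^ (-(N + δ)) := one_le_eps_rpow _ (by positivity)
  have hfin : b ^ k * ‖X i‖ ≤ (C₆ + C₅) * (e i : ℝ) ^ (-(N + δ)) := by
    calc b ^ k * ‖X i‖ ≤ b ^ k * (‖X i - Y i‖ + ‖Y i‖) := by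
          gcongr
          simpa using norm_add_le (X i - Y i) (Y i)
      _ = b ^ k * ‖X i - Y i‖ + b ^ k * ‖Y i‖ := mul_add _ _ _
      _ ≤ C₆ * (e i : ℝ) ^ (-(N + δ)) + C₅ * (e i : ℝ) ^ (-(N + δ)) :=
          add_le_add (hmid.trans (le_mul_of_one_le_right (Real.sqrt_nonneg _) hone)) hYk
      _ = _ := by ring
  beta_reduce
  rw [Real.rpow_neg hb0.le, Real.rpow_natCast, ← div_eq_mul_inv, le_div_iff₀ (pow_pos hb0 _),
    mul_comm]
  exact hfin

end Regularity

/-! ### Representatives and cut-off functions -/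

section Representatives

variable {F : Type*} [NormedAddCommGroup F] [NormedSpace ℝ F] {Ω : Opens F}

theorem IsRep.isModerate {r : Eps → F → ℂ} {u : G Ω} (h : IsRep r u) : IsModerate Ω r := h.1

theorem IsRep.isNegligible_sub {r r' : Eps → F → ℂ} {u : G Ω} (h : IsRep r u) (h' : IsRep r' u) :
    IsNegligible Ω (r - r') := by
  obtain ⟨m, hm⟩ := h
  obtain ⟨m', hm'⟩ := h'
  rw [← hm', Submodule.mkQ_apply, Submodule.mkQ_apply, Submodule.Quotient.eq] at hm
  exact hm

theorem exists_cutoff [FiniteDimensional ℝ F] {T : Set F} (hT : IsCompact T) (hTΩ : T ⊆ Ω) :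
    ∃ ψ : F → ℂ, IsTest Ω ψ ∧ ∀ y ∈ T, ∀ᶠ z in 𝓝 y, ψ z = 1 := by
  obtain ⟨L, hL, hTL, hLΩ⟩ := exists_compact_between hT Ω.isOpen hTΩ
  obtain ⟨f, hf1, hf0, -⟩ := exists_contMDiffMap_one_nhds_of_subset_interior
    (modelWithCornersSelf ℝ F) (n := (⊤ : ℕ∞)) hT.isClosed hTL
  have hsupp : tsupport (fun x => (f x : ℂ)) ⊆ L := closure_minimal (fun x hx => by
    by_contra h
    exact hx (by simp [hf0 x h])) hL.isClosed
  refine ⟨fun x => (f x : ℂ), ⟨Complex.ofRealCLM.contDiff.comp f.contMDiff.contDiff,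
    hL.of_isClosed_subset (isClosed_tsupport _) hsupp, hsupp.trans hLΩ⟩, fun y hy => ?_⟩
  filter_upwards [Filter.Eventually.filter_mono (nhds_le_nhdsSet hy) hf1] with z hz
  simp [hz]

end Representatives

/-! ### Quantization of symbols of order zero and of negligible symbols -/

section Symbols

variable {n : ℕ} {Ω : Opens (E n)}

theorem IsSymbolRep.isNegligible_sub {m : ℝ} {r r' : Eps → E n → E n → ℂ} {a : SlowScaleSymbol Ω m}
    (h : IsSymbolRep r a) (h' : IsSymbolRep r' a) : IsNegligibleSymbolNet Ω m (r - r') := by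
  obtain ⟨k, hk⟩ := h
  obtain ⟨k', hk'⟩ := h'
  rw [← hk', Submodule.mkQ_apply, Submodule.mkQ_apply, Submodule.Quotient.eq] at hk
  exact hk

theorem symDeriv_zero (α β : Fin 0 → Fin n) (a : E n → E n → ℂ) (x ξ : E n) :
    symDeriv α β a x ξ = a x ξ := iteratedFDeriv_zero_apply _

theorem SeminormLE.norm_le {K : Set (E n)} {α β : Fin 0 → Fin n} {a : E n → E n → ℂ} {B : ℝ}
    (h : SeminormLE 0 K α β a B) {x : E n} (hx : x ∈ K) (ξ : E n) : ‖a x ξ‖ ≤ B := by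
  have := h x hx ξ
  rwa [symDeriv_zero, neg_zero, Nat.cast_zero, zero_add, Real.rpow_zero, one_mul] at this

theorem IsSymbol.exists_bound {a : E n → E n → ℂ} (ha : IsSymbol Ω 0 a) {K : Set (E n)}
    (hK : IsCompact K) (hKΩ : K ⊆ Ω) : ∃ B, ∀ x ∈ K, ∀ ξ, ‖a x ξ‖ ≤ B := by
  obtain ⟨B, hB⟩ := ha.2 K hK hKΩ 0 0 Fin.elim0 Fin.elim0
  exact ⟨B, fun x hx ξ => hB.norm_le hx ξ⟩

theorem SymSmooth.continuous_right {a : E n → E n → ℂ} (ha : SymSmooth Ω a) {x : E n}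
    (hx : x ∈ Ω) : Continuous (a x) := by
  have h : ContinuousOn (fun p : E n × E n => a p.1 p.2) ((Ω : Set (E n)) ×ˢ Set.univ) :=
    ContDiffOn.continuousOn ha
  exact h.comp_continuous (f := fun ξ => (x, ξ)) (by fun_prop) fun ξ => ⟨hx, Set.mem_univ _⟩

theorem integrable_quantize {a : E n → E n → ℂ} (ha : IsSymbol Ω 0 a) {x : E n} (hx : x ∈ Ω)
    {w : E n → ℂ} (hw : Integrable (fourierT w)) :
    Integrable fun ξ => Complex.exp (Complex.I * ((inner ℝ x ξ : ℝ) : ℂ)) * a x ξ * fourierT w ξ := by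
  obtain ⟨B, hB⟩ := ha.exists_bound (K := {x}) isCompact_singleton (by simpa using hx)
  refine hw.bdd_mul (c := B) ?_ (Filter.Eventually.of_forall fun ξ => ?_)
  · have := ha.1.continuous_right hx
    exact Continuous.aestronglyMeasurable (by fun_prop)
  · rw [norm_mul, norm_cexp_I, one_mul]
    exact hB x rfl ξ

theorem norm_quantize_le {a : E n → E n → ℂ} {x : E n} {B : ℝ} (hB : ∀ ξ, ‖a x ξ‖ ≤ B)
    {w : E n → ℂ} (hw : Integrable (fourierT w)) :
    ‖quantize a w x‖ ≤ ‖twoPiInv n‖ * (B * ∫ ξ, ‖fourierT w ξ‖) := by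
  rw [quantize, norm_mul, twoPiInv, ← integral_const_mul]
  gcongr
  refine norm_integral_le_of_norm_le (hw.norm.const_mul B) (Filter.Eventually.of_forall fun ξ => ?_)
  rw [norm_mul, norm_mul, norm_cexp_I, one_mul]
  gcongr
  exact hB ξ

theorem quantize_sub {a b : E n → E n → ℂ} (ha : IsSymbol Ω 0 a) (hb : IsSymbol Ω 0 b) {x : E n}
    (hx : x ∈ Ω) {w : E n → ℂ} (hw : Integrable (fourierT w)) :
    quantize (a - b) w x = quantize a w x - quantize b w x := by
  simp only [quantize]
  rw [← mul_sub, ← integral_sub (integrable_quantize ha hx hw) (integrable_quantize hb hx hw)]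
  congr 2
  ext ξ
  simp only [Pi.sub_apply]
  ring

/-- A negligible net of symbols maps moderate nets to nets smaller than any power of `ε`. -/
theorem IsNegligibleSymbolNet.quantize {c : Eps → E n → E n → ℂ}
    (hc : IsNegligibleSymbolNet Ω 0 c) {K K' : Set (E n)} (hK : IsCompact K) (hKΩ : K ⊆ Ω)
    (hK' : IsCompact K') {w : Eps → E n → ℂ} (hw : IsModerateTestNet K' w) (q : ℝ) :
    UnifBigO K (fun ε x => Colombeau.quantize (c ε) (w ε) x) q := by
  obtain ⟨p, hp, C, hC, η, hη, hd⟩ := hw.fourierT_decay hK' (n + 1)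
  -- The smallness of the symbol has to produce the power q and to absorb the loss p of the Fourier
  -- transform.
  obtain ⟨N, hN⟩ := exists_nat_ge (p + q)
  obtain ⟨D, hD, hb⟩ := hc.2 K hK hKΩ 0 0 Fin.elim0 Fin.elim0 N
  set I : ℝ := ∫ η : E n, bracket η ^ (-((n : ℝ) + 1)) with hI
  have hI0 : 0 ≤ I := integral_nonneg fun η => bracket_rpow_nonneg _ _
  refine ⟨‖twoPiInv n‖ * (D * (C * I)), η, hη, fun ε hε x hx => ?_⟩
  have he := ε.pos
  have hwi := integrable_fourierT hK' (hw.smooth ε) (hw.support ε)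
  have h1 : ∫ ξ, ‖fourierT (w ε) ξ‖ ≤ C * (ε : ℝ) ^ (-p) * I := by
    rw [hI, ← integral_const_mul]
    refine integral_mono hwi.norm ((integrable_bracket_rpow (lt_add_one (n : ℝ))).const_mul _)
      fun ξ => ?_
    have h2 := hd ε hε ξ
    have hξ := bracket_pos ξ
    simp only
    rw [Real.rpow_neg hξ.le, ← div_eq_mul_inv, le_div_iff₀ (Real.rpow_pos_of_pos hξ _), mul_comm]
    rw [← Real.rpow_natCast] at h2
    push_cast at h2
    exact h2
  refine (norm_quantize_le (fun ξ => (hb ε).norm_le hx ξ) hwi).trans ?_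
  have h3 : (ε : ℝ) ^ N * (ε : ℝ) ^ (-p) ≤ (ε : ℝ) ^ q := by
    rw [← Real.rpow_natCast, ← Real.rpow_add he]
    exact Real.rpow_le_rpow_of_exponent_ge he ε.le_one (by linarith)
  calc ‖twoPiInv n‖ * (D * (ε : ℝ) ^ N * ∫ ξ, ‖fourierT (w ε) ξ‖)
      ≤ ‖twoPiInv n‖ * (D * (ε : ℝ) ^ N * (C * (ε : ℝ) ^ (-p) * I)) := by gcongr
    _ = ‖twoPiInv n‖ * (D * (C * I)) * ((ε : ℝ) ^ N * (ε : ℝ) ^ (-p)) := by ring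
    _ ≤ _ := by gcongr

end Symbols

/-! ### Micro-ellipticity implies microlocal regularity -/

section MicroEllipticity

variable {n : ℕ} {Ω : Opens (E n)}

theorem IsTestNet.mono {K : Set (E n)} {P Q : ℝ} {w : Eps → E n → ℂ} (h : IsTestNet K P w)
    (hPQ : P ≤ Q) : IsTestNet K Q w := by
  obtain ⟨C, hC, η, hη, hb⟩ := h.bound
  refine ⟨h.smooth, h.support, C, hC, η, hη, fun ε hε x => (hb ε hε x).trans ?_⟩
  exact mul_le_mul_of_nonneg_left
    (Real.rpow_le_rpow_of_exponent_ge ε.pos ε.le_one (by linarith)) hC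

theorem isAmplitude_const {ι : Type*} (e : ι → Eps) {U K : Set (E n)} (hK : IsCompact K)
    {φ : E n → ℂ} (hφ : ContDiff ℝ ∞ φ) (h0 : ∀ x, x ∉ K → φ x = 0) :
    IsAmplitude e U K fun _ => φ := by
  refine ⟨fun _ => hφ, fun _ => h0, fun _ => hφ.contDiffOn, fun l => ?_⟩
  obtain ⟨B, hB⟩ := exists_bound_dirD (v := stdB) hK hφ h0 l
  refine ⟨fun _ => |B|, Slow.const (abs_nonneg B), fun i x _ => ?_⟩
  simpa using (hB x).trans (le_abs_self B)

/-- The bootstrap is applied with one index for each pair (ε, ξ) in the elliptic region, which makes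
all bounds uniform in ξ. Ellipticity concerns the representative `r'`, whereas the image is formed
with `r`; the difference is negligible. -/
theorem isMicroRegular_of_elliptic {u v : G Ω} {r r' : Eps → E n → E n → ℂ}
    {a : SlowScaleSymbol Ω 0} (hr : IsSymbolRep r a) (hr' : IsSymbolRep r' a)
    (hprop : IsProperSubset Ω (genKernelSupport Ω r)) (hv : v ∈ GInf Ω) (himg : IsGenImage r u v)
    {x₀ ξ₀ : E n} {U : Opens (E n)} (hU : RelCompact Ω U) (hx₀ : x₀ ∈ U) {Γ : Set (E n)}
    (hΓ : IsConicNhd Γ ξ₀) {R s : Eps → ℝ} (hR : IsSlowScale R) (hs : IsSlowScale s)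
    (hell : ∀ ε, ∀ x ∈ U, ∀ ξ ∈ Γ, R ε ≤ ‖ξ‖ → 1 / s ε * bracket ξ ^ (0 : ℝ) ≤ ‖r' ε x ξ‖) :
    IsMicroRegular u x₀ ξ₀ := by
  have hUΩ : (U : Set (E n)) ⊆ Ω := subset_closure.trans hU.2
  obtain ⟨ρ, hρ, hρU⟩ := Metric.nhds_basis_closedBall.mem_iff.1 (U.isOpen.mem_nhds hx₀)
  set K := Metric.closedBall x₀ ρ with hKdef
  have hK : IsCompact K := isCompact_closedBall x₀ ρ
  -- the localizing function
  let B : ContDiffBump x₀ := ⟨ρ / 2, ρ, by positivity, by linarith⟩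
  set φ : E n → ℂ := fun x => (B x : ℂ) with hφdef
  have hφs : ContDiff ℝ ∞ φ := Complex.ofRealCLM.contDiff.comp B.contDiff
  have hφ0 : ∀ x, x ∉ K → φ x = 0 := fun x hx => by
    have : B x = 0 := by
      by_contra h
      have h1 : x ∈ Function.support B := h
      rw [B.support_eq] at h1
      exact hx (Metric.ball_subset_closedBall h1)
    simp [hφdef, this]
  have hφK : tsupport φ ⊆ K := closure_minimal (fun x hx => by
    by_contra h
    exact hx (hφ0 x h)) hK.isClosed
  have hφt : IsTest Ω φ := ⟨hφs, HasCompactSupport.intro hK hφ0,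
    hφK.trans (hρU.trans hUΩ)⟩
  have hφ1 : φ x₀ = 1 := by
    simp only [hφdef]
    rw [B.one_of_mem_closedBall (Metric.mem_closedBall_self (by positivity))]
    simp
  -- the cut-off
  obtain ⟨ru, rv, hru, hrv, hcut⟩ := himg
  set S := genKernelSupport Ω r
  -- The ball `K` is included so that the cut-off is 1 there, and φu agrees with φ times the cut-off
  -- net.
  set T : Set (E n) := Prod.snd '' (S ∩ closure (U : Set (E n)) ×ˢ (Ω : Set (E n))) ∪ K
  have hT : IsCompact T := ((hprop _ hU.1 hU.2).1.image continuous_snd).union hK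
  have hTΩ : T ⊆ Ω := by
    rintro y (⟨q, hq, rfl⟩ | hy)
    · exact hq.2.2
    · exact hUΩ (hρU hy)
  obtain ⟨ψ, hψ, hψ1⟩ := exists_cutoff hT hTΩ
  have hψcut : IsCutoffFor Ω S U ψ := ⟨hψ, fun x hx y hxy =>
    hψ1 y (Or.inl ⟨(x, y), ⟨hxy, hx, hxy.1.2⟩, rfl⟩)⟩
  have hneg := hcut U hU ψ hψcut
  set w : Eps → E n → ℂ := fun ε y => ψ y * ru ε y with hwdef
  have hw : IsModerateTestNet (tsupport ψ) w := hψ.isModerateTestNet hru.isModerate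
  have hK' : IsCompact (tsupport ψ) := hψ.2.1
  obtain ⟨P, hP, hwP⟩ := hw.exists_isTestNet
  -- the regular representative
  obtain ⟨f, hfv, hfreg⟩ := hv
  have hKΩ : K ⊆ Ω := hρU.trans hUΩ
  -- Three errors are added: between `rv` and the quantization by `r`, between `rv` and the regular
  -- representative `f`, and between the two symbol representatives.
  have herr : ∀ q : ℝ, UnifBigO K (fun ε x => quantize (r' ε) (w ε) x - f ε x) q := by
    intro q
    have h1 := hneg.2 K hK hρU q
    have h2 := (hrv.isNegligible_sub hfv).2 K hK hKΩ q
    have h3 := (hr'.isNegligible_sub hr).quantize hK hKΩ hK' hw q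
    have h4 : UnifBigO K (fun ε x => quantize (r' ε) (w ε) x - rv ε x) q :=
      h1.of_le_add h3 fun ε x hx => by
        have hwi := integrable_fourierT hK' (hw.smooth ε) (hw.support ε)
        have h5 := quantize_sub (hr'.1.1 ε) (hr.1.1 ε) (hKΩ hx) hwi
        rw [show (r' - r) ε = r' ε - r ε from rfl, h5]
        have h6 : quantize (r' ε) (w ε) x - rv ε x = -(rv ε x - quantize (r ε) (w ε) x)
            + (quantize (r' ε) (w ε) x - quantize (r ε) (w ε) x) := by ring
        rw [h6]
        refine (norm_add_le _ _).trans_eq ?_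
        rw [norm_neg]
    exact h4.of_le_add h2 fun ε x _ => by
      have h6 : quantize (r' ε) (w ε) x - f ε x = (quantize (r' ε) (w ε) x - rv ε x)
          + (rv - f) ε x := by simp
      rw [h6]
      exact norm_add_le _ _
  -- the bootstrap
  let ι := {q : Eps × E n // q.2 ∈ Γ ∧ R q.1 ≤ ‖q.2‖}
  let e : ι → Eps := fun i => i.1.1
  let Ξ : ι → E n := fun i => i.1.2
  have ha := slowSym_of_isSlowScaleNet hr'.1 hU e
  obtain ⟨N, hN, hf⟩ := slowPos_of_isRegularNet hfreg hU e
  set Q := max P N with hQ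
  have hspos : ∀ ε, 0 < s ε := fun ε => by
    obtain ⟨c, hc, hcs⟩ := hs.1
    exact hc.trans_le (hcs ε)
  have hlow : ∀ i, ∀ x ∈ (U : Set (E n)), 1 / s (e i) ≤ ‖r' (e i) x (Ξ i)‖ := fun i x hx => by
    simpa using hell (e i) x hx (Ξ i) i.2.1 i.2.2
  have hboot := elliptic_bootstrap U.isOpen hK hρU hK' (hwP.mono (le_max_left P N)) ha Ξ
    (τ := fun i => s (e i)) hs.slow
    (fun i x hx => norm_pos_iff.1 ((one_div_pos.2 (hspos _)).trans_le (hlow i x hx)))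
    (fun i x hx => by
      have h1 := hlow i x hx
      rw [one_div] at h1
      exact inv_le_of_inv_le₀ (hspos _) h1)
    (fun g hg k => (pairing_regular U.isOpen hK hρU hK' hw ha hN hf herr Ξ g hg k).mono_exp
      (fun i => bracket_rpow_nonneg _ _) (le_max_right P N))
  -- conclusion
  have hFeq : ∀ ε, (fun y => φ y * ru ε y) = fun y => w ε y * φ y := fun ε => by
    funext y
    by_cases hy : y ∈ K
    · have : ψ y = 1 := (hψ1 y (Or.inr hy)).self_of_nhds
      simp [hwdef, this, mul_comm]
    · simp [hφ0 y hy]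
  -- The bootstrap is used with δ = 1. The resulting exponent is chosen before the order of decay
  -- `l`.
  obtain ⟨M, hM⟩ := exists_nat_ge (Q + 1)
  refine ⟨ru, hru, φ, hφt, hφ1, Γ, hΓ, M, fun l => ?_⟩
  obtain ⟨k, hk⟩ := exists_nat_ge l
  obtain ⟨C, hC, η, hη, hb⟩ := hboot k (fun _ => φ) (isAmplitude_const e hK hφs hφ0) 1 one_pos
  have hR0 : ∀ ε, 0 < R ε := fun ε => by
    obtain ⟨c, hc, hcs⟩ := hR.1
    exact hc.trans_le (hcs ε)
  -- Frequencies below `R ε` are not covered by ellipticity. There ⟨ξ⟩^k is at most (1 + R)^k, hence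
  -- O(1/ε), and the trivial bound of the Fourier transform suffices.
  have hRs : Slow (fun ε : Eps => ε) fun ε => (1 + R ε) ^ k :=
    ((Slow.const zero_le_one).add (hR.slow (e := fun ε : Eps => ε))).pow k
  obtain ⟨D, hD, θ, hθ, hDb⟩ := hRs.2 1 one_pos
  obtain ⟨Cw, hCw, η', hη', hwb⟩ := (hwP.mono (le_max_left P N)).bound
  obtain ⟨Bφ, hBφ⟩ := exists_bound_dirD (v := stdB) hK hφs hφ0 []
  simp only [dirD_nil] at hBφ
  have hBφ0 : 0 ≤ Bφ := (norm_nonneg _).trans (hBφ 0)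
  refine ⟨C + D * (volume.real K * (Cw * Bφ)), min η (min θ η'), by positivity, fun ε hε ξ hξ => ?_⟩
  simp only [lt_min_iff] at hε
  obtain ⟨h1, h2, h3⟩ := hε
  have he := ε.pos
  have hM' : (ε : ℝ) ^ (-(Q + 1)) ≤ (ε : ℝ) ^ (-(M : ℝ)) :=
    Real.rpow_le_rpow_of_exponent_ge he ε.le_one (by linarith)
  have hbr := bracket_pos ξ
  have hlk : bracket ξ ^ l ≤ bracket ξ ^ (k : ℝ) := bracket_rpow_le_rpow ξ hk
  beta_reduce
  rw [hFeq ε, norm_mul, norm_norm, Real.norm_of_nonneg (bracket_rpow_nonneg _ _)]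
  rcases le_or_gt (R ε) ‖ξ‖ with hξR | hξR
  · have h4 := hb ⟨(ε, ξ), hξ, hξR⟩ h1
    simp only [e, Ξ] at h4
    calc bracket ξ ^ l * ‖fourierT (fun y => w ε y * φ y) ξ‖
        ≤ bracket ξ ^ (k : ℝ) * (C * (ε : ℝ) ^ (-(Q + 1)) * bracket ξ ^ (-(k : ℝ))) := by gcongr
      _ = C * (ε : ℝ) ^ (-(Q + 1)) * (bracket ξ ^ (k : ℝ) * bracket ξ ^ (-(k : ℝ))) := by ring
      _ = C * (ε : ℝ) ^ (-(Q + 1)) := by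
          rw [← Real.rpow_add hbr]
          simp
      _ ≤ (C + D * (volume.real K * (Cw * Bφ))) * (ε : ℝ) ^ (-(M : ℝ)) := by
          gcongr
          linarith [show 0 ≤ D * (volume.real K * (Cw * Bφ)) by positivity]
  · have h4 : bracket ξ ^ (k : ℝ) ≤ D * (ε : ℝ) ^ (-(1 : ℝ)) := by
      rw [Real.rpow_natCast]
      refine (pow_le_pow_left₀ hbr.le ?_ k).trans (hDb ε h2)
      exact (bracket_le_one_add_norm ξ).trans (by linarith)
    have h5 : ‖fourierT (fun y => w ε y * φ y) ξ‖ ≤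
        volume.real K * (Cw * (ε : ℝ) ^ (-Q) * Bφ) := by
      refine norm_fourierT_le hK (fun x hx => by rw [hφ0 x hx, mul_zero]) (fun x => ?_) ξ
      rw [norm_mul]
      exact mul_le_mul (hwb ε h3 x) (hBφ x) (norm_nonneg _) (by positivity)
    calc bracket ξ ^ l * ‖fourierT (fun y => w ε y * φ y) ξ‖
        ≤ (D * (ε : ℝ) ^ (-(1 : ℝ))) * (volume.real K * (Cw * (ε : ℝ) ^ (-Q) * Bφ)) :=
          mul_le_mul (hlk.trans h4) h5 (norm_nonneg _) (by positivity)
      _ = D * (volume.real K * (Cw * Bφ)) * ((ε : ℝ) ^ (-(1 : ℝ)) * (ε : ℝ) ^ (-Q)) := by ring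
      _ = D * (volume.real K * (Cw * Bφ)) * (ε : ℝ) ^ (-(Q + 1)) := by
          rw [← Real.rpow_add he]
          congr 2
          ring
      _ ≤ (C + D * (volume.real K * (Cw * Bφ))) * (ε : ℝ) ^ (-(M : ℝ)) := by
          gcongr
          linarith

theorem WFg_subset_Wsc (u : G Ω) : WFg u ⊆ Wsc u := by
  rintro p ⟨hp, hnr⟩
  refine ⟨hp, fun a ⟨r, hr, hprop, v, hv, himg⟩ hEll => hnr ?_⟩
  obtain ⟨-, r', hr', U, hU, hpU, Γ, hΓ, R, s, hR, hs, hell⟩ := hEll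
  exact isMicroRegular_of_elliptic hr hr' hprop hv himg hU hpU hΓ hR hs hell

end MicroEllipticity

/-! ### Classical symbols as constant nets -/

section ClassicalSymbols

variable {n : ℕ} {Ω : Opens (E n)}

theorem isSlowScale_const {c : ℝ} (hc : 0 < c) : IsSlowScale fun _ => c :=
  ⟨⟨c, hc, fun _ => le_rfl⟩, fun p _ => ⟨c ^ p, Real.rpow_pos_of_pos hc p, fun ε =>
    le_mul_of_one_le_right (Real.rpow_pos_of_pos hc p).le ((one_le_inv₀ ε.pos).2 ε.le_one)⟩⟩

theorem IsSymbol.isSlowScaleNet {m : ℝ} {a : E n → E n → ℂ} (ha : IsSymbol Ω m a) :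
    IsSlowScaleNet Ω m fun _ => a := by
  refine ⟨fun _ => ha, fun K hK hKΩ => ⟨fun _ => 1, IsSlowScale.one, fun j k α β => ?_⟩⟩
  obtain ⟨C, hC⟩ := ha.2 K hK hKΩ j k α β
  exact ⟨max C 1, by positivity, fun _ => hC.mono (by simp)⟩

theorem IsNullNet.eq_zero_of_const {z : ℂ} (h : IsNullNet fun _ => z) : z = 0 := by
  obtain ⟨C, η, hη, h⟩ := h 1
  by_contra hz
  have hz' : 0 < ‖z‖ := norm_pos_iff.2 hz
  -- An admissible ε below η at which |C| ε is at most ‖z‖ / 2, against the bound for q = 1.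
  set δ := min (min (η / 2) 1) (‖z‖ / (2 * (|C| + 1)))
  have hδ : 0 < δ := by positivity
  have h1 : δ ≤ 1 := (min_le_left _ _).trans (min_le_right _ _)
  have h2 : δ < η := ((min_le_left _ _).trans (min_le_left _ _)).trans_lt (half_lt_self hη)
  have h3 : δ ≤ ‖z‖ / (2 * (|C| + 1)) := min_le_right _ _
  have h4 := h ⟨δ, hδ, h1⟩ h2
  simp only [Real.rpow_one] at h4
  rw [le_div_iff₀ (by positivity)] at h3
  nlinarith [le_abs_self C, abs_nonneg C]

theorem IsTest.isCompactlySupportedNet {W : Opens (E n × E n)} {w : E n × E n → ℂ}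
    (hw : IsTest W w) : IsCompactlySupportedNet W fun _ => w := by
  refine ⟨fun _ => hw.1, ⟨fun _ => hw.1.contDiffOn, fun K hK _ k => ⟨0, ?_⟩⟩, tsupport w, hw.2.1,
    hw.2.2, fun _ x hx => image_eq_zero_of_notMem_tsupport hx⟩
  have hc : Continuous (iteratedFDeriv ℝ k w) :=
    hw.1.continuous_iteratedFDeriv (by exact_mod_cast le_top)
  obtain ⟨C, hC⟩ := hK.exists_bound_of_continuousOn hc.continuousOn
  exact ⟨C, 1, one_pos, fun ε _ x hx => by simpa using hC x hx⟩

theorem IsCompactlySupportedNet.isTest {W : Opens (E n × E n)} {w : Eps → E n × E n → ℂ}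
    (hw : IsCompactlySupportedNet W w) (ε : Eps) : IsTest W (w ε) := by
  obtain ⟨L, hL, hLW, h0⟩ := hw.2.2
  have hs : tsupport (w ε) ⊆ L := closure_minimal (fun x hx => by
    by_contra h
    exact hx (h0 ε x h)) hL.isClosed
  exact ⟨hw.1 ε, HasCompactSupport.intro hL (h0 ε), hs.trans hLW⟩

/-- A constant net is null only if it is zero, and every member of a compactly supported net is a
test function. So both notions of vanishing agree on each open set. -/
theorem genKernelSupport_const (a : E n → E n → ℂ) :
    genKernelSupport Ω (fun _ => a) = kernelSupport Ω a := by
  have key : ∀ W : Opens (E n × E n),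
      (∀ w, IsCompactlySupportedNet W w → IsNullNet fun ε => kernelPairing Ω a (w ε)) ↔
        ∀ w, IsTest W w → kernelPairing Ω a w = 0 := fun W => by
    refine ⟨fun h w hw => (h _ hw.isCompactlySupportedNet).eq_zero_of_const, fun h w hw q => ?_⟩
    exact ⟨0, 1, one_pos, fun ε _ => by simp [h _ (hw.isTest ε)]⟩
  simp only [genKernelSupport, kernelSupport, key]

theorem isNegligible_zero {F : Type*} [NormedAddCommGroup F] [NormedSpace ℝ F] (V : Opens F) :
    IsNegligible V (0 : Eps → F → ℂ) := (negligibleNets V).zero_mem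

theorem IsNegligible.congr {F : Type*} [NormedAddCommGroup F] [NormedSpace ℝ F] {V : Opens F}
    {u v : Eps → F → ℂ} (hu : IsNegligible V u) (h : ∀ ε, ∀ x ∈ V, v ε x = u ε x) :
    IsNegligible V v := by
  refine ⟨⟨fun ε => (hu.1.1 ε).congr (h ε), fun K hK hKV k => ?_⟩, fun K hK hKV q => ?_⟩
  · obtain ⟨p, C, η, hη, hb⟩ := hu.1.2 K hK hKV k
    refine ⟨p, C, η, hη, fun ε hε x hx => ?_⟩
    have : v ε =ᶠ[𝓝 x] u ε := by
      filter_upwards [V.isOpen.mem_nhds (hKV hx)] with y hy using h ε y hy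
    beta_reduce
    rw [(this.iteratedFDeriv ℝ k).self_of_nhds]
    exact hb ε hε x hx
  · obtain ⟨C, η, hη, hb⟩ := hu.2 K hK hKV q
    refine ⟨C, η, hη, fun ε hε x hx => ?_⟩
    rw [h ε x (hKV hx)]
    exact hb ε hε x hx

theorem IsClassicalImageG.isGenImage {a : E n → E n → ℂ} {u v : G Ω}
    (h : IsClassicalImageG a u v) : IsGenImage (fun _ => a) u v := by
  obtain ⟨ru, rv, hu, hv, h⟩ := h
  refine ⟨ru, rv, hu, hv, fun V hV ψ hψ => ?_⟩
  rw [genKernelSupport_const] at hψ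
  exact (isNegligible_zero V).congr fun ε x hx => by simp [h ε V hV ψ hψ x hx]

/-- A classical operator with elliptic constant c is a slow scale operator, by constant nets, with s
= 1/c. -/
theorem Wsc_subset_Wcl (u : G Ω) : Wsc u ⊆ Wcl u := by
  rintro p ⟨hp, h⟩
  refine ⟨hp, fun a ha hprop ⟨v, hv, himg⟩ => ⟨hp, ?_⟩⟩
  rintro ⟨U, hU, hpU, Γ, hΓ, R, c, hR, hc, hell⟩
  have hrep : IsSymbolRep (m := 0) (fun _ => a) (((negligibleSymbolNets Ω 0).submoduleOf
      (slowScaleNets Ω 0)).mkQ ⟨fun _ => a, ha.isSlowScaleNet⟩) := ⟨ha.isSlowScaleNet, rfl⟩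
  refine h _ ⟨_, hrep, ?_, v, hv, himg.isGenImage⟩ ⟨hp, _, hrep, U, hU, hpU, Γ, hΓ, fun _ => R,
    fun _ => c⁻¹, isSlowScale_const hR, isSlowScale_const (inv_pos.2 hc), fun ε x hx ξ hξ hξR => ?_⟩
  · rwa [genKernelSupport_const]
  · simpa using hell x hx ξ hξ hξR

end ClassicalSymbols

/-! ### Fourier multipliers and the symbol of φ χ(D) φ -/

section Multipliers

variable {n : ℕ} {m : ℝ} {χ G : E n → ℂ}

/-- Fourier multipliers of order `m`. -/
structure IsMultiplier (m : ℝ) (χ : E n → ℂ) : Prop where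
  smooth : ContDiff ℝ ∞ χ
  bound : ∀ k : ℕ, ∃ C : ℝ, 0 ≤ C ∧ ∀ ξ, ‖iteratedFDeriv ℝ k χ ξ‖ ≤ C * bracket ξ ^ (m - k)

theorem IsMultiplier.norm_le (h : IsMultiplier m χ) :
    ∃ C : ℝ, 0 ≤ C ∧ ∀ ξ, ‖χ ξ‖ ≤ C * bracket ξ ^ m := by
  obtain ⟨C, hC, hb⟩ := h.bound 0
  exact ⟨C, hC, fun ξ => by simpa using hb ξ⟩

theorem IsMultiplier.norm_fderiv_le (h : IsMultiplier m χ) :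
    ∃ C : ℝ, 0 ≤ C ∧ ∀ ξ, ‖fderiv ℝ χ ξ‖ ≤ C * bracket ξ ^ (m - 1) := by
  obtain ⟨C, hC, hb⟩ := h.bound 1
  refine ⟨C, hC, fun ξ => ?_⟩
  have := hb ξ
  rw [norm_iteratedFDeriv_one] at this
  simpa using this

theorem IsMultiplier.fderiv_apply (h : IsMultiplier m χ) (w : E n) :
    IsMultiplier (m - 1) fun ξ => fderiv ℝ χ ξ w := by
  refine ⟨contDiff_fderiv_apply h.smooth w, fun k => ?_⟩
  obtain ⟨C, hC, hb⟩ := h.bound (k + 1)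
  refine ⟨‖w‖ * C, by positivity, fun ξ => ?_⟩
  have hs : ContDiff ℝ ∞ (fderiv ℝ χ) := h.smooth.fderiv_right (by simp)
  refine (norm_iteratedFDeriv_clm_apply_const (n := k) (hs.contDiffAt (x := ξ))
    (by exact_mod_cast le_top)).trans ?_
  rw [norm_iteratedFDeriv_fderiv, mul_assoc]
  gcongr
  have := hb ξ
  push_cast at this
  rwa [show m - ((k : ℝ) + 1) = m - 1 - k by ring] at this

/-- Continuous functions decaying faster than any power. -/
structure IsRapid (G : E n → ℂ) : Prop where
  continuous : Continuous G
  decay : ∀ r : ℝ, ∃ C : ℝ, 0 ≤ C ∧ ∀ ζ, ‖G ζ‖ ≤ C * bracket ζ ^ (-r)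

theorem isRapid_fourierT {K : Set (E n)} (hK : IsCompact K) {h : E n → ℂ}
    (hh : ContDiff ℝ ∞ h) (h0 : ∀ x, x ∉ K → h x = 0) : IsRapid (fourierT h) :=
  ⟨continuous_fourierT (integrable_of_support hK hh.continuous h0), exists_fourierT_decay hK hh h0⟩

theorem IsRapid.integrable_mul (hG : IsRapid G) (r : ℝ) :
    Integrable fun ζ => bracket ζ ^ r * ‖G ζ‖ := by
  obtain ⟨C, hC, hb⟩ := hG.decay (r + (n + 1))
  have h1 : Integrable fun ζ : E n => C * bracket ζ ^ (-((n : ℝ) + 1)) :=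
    (integrable_bracket_rpow (lt_add_one (n : ℝ))).const_mul C
  refine h1.mono' (by
    have := hG.continuous
    exact ((continuous_bracket_rpow r).mul this.norm).aestronglyMeasurable)
    (Filter.Eventually.of_forall fun ζ => ?_)
  have hζ := bracket_pos ζ
  rw [norm_mul, norm_norm, Real.norm_of_nonneg (bracket_rpow_nonneg _ _)]
  calc bracket ζ ^ r * ‖G ζ‖ ≤ bracket ζ ^ r * (C * bracket ζ ^ (-(r + (n + 1)))) := by
        exact mul_le_mul_of_nonneg_left (hb ζ) (bracket_rpow_nonneg _ _)
    _ = C * (bracket ζ ^ r * bracket ζ ^ (-(r + (n + 1)))) := by ring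
    _ = C * bracket ζ ^ (-((n : ℝ) + 1)) := by
        rw [← Real.rpow_add hζ]
        congr 2
        ring

theorem IsRapid.integrable (hG : IsRapid G) : Integrable G := by
  have h := hG.integrable_mul 0
  simp only [Real.rpow_zero, one_mul] at h
  exact (integrable_norm_iff hG.continuous.aestronglyMeasurable).1 h

theorem IsRapid.inner_mul (hG : IsRapid G) (v : E n) :
    IsRapid fun ζ => Complex.I * ((inner ℝ v ζ : ℝ) : ℂ) * G ζ := by
  refine ⟨by have := hG.continuous; fun_prop, fun r => ?_⟩
  obtain ⟨C, hC, hb⟩ := hG.decay (r + 1)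
  refine ⟨‖v‖ * C, by positivity, fun ζ => ?_⟩
  have hζ := bracket_pos ζ
  have h1 : ‖Complex.I * ((inner ℝ v ζ : ℝ) : ℂ)‖ ≤ ‖v‖ * bracket ζ := by
    rw [norm_mul, Complex.norm_I, one_mul, Complex.norm_real]
    exact (norm_inner_le_norm v ζ).trans
      (mul_le_mul_of_nonneg_left (norm_le_bracket ζ) (norm_nonneg v))
  rw [norm_mul]
  calc _ ≤ ‖v‖ * bracket ζ * (C * bracket ζ ^ (-(r + 1))) :=
        mul_le_mul h1 (hb ζ) (norm_nonneg _) (by positivity)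
    _ = ‖v‖ * C * (bracket ζ ^ (1 : ℝ) * bracket ζ ^ (-(r + 1))) := by
        rw [Real.rpow_one]
        ring
    _ = _ := by
        rw [← Real.rpow_add hζ]
        congr 2
        ring

/-- The composition of a multiplier with the multiplication by the inverse Fourier transform of
`G`, up to normalization, on the level of symbols. -/
def oscInt (χ G : E n → ℂ) (p : E n × E n) : ℂ :=
  ∫ ζ, Complex.exp (Complex.I * ((inner ℝ p.1 ζ : ℝ) : ℂ)) * χ (p.2 + ζ) * G ζ

/-- Peetre's inequality replaces ⟨ξ + ζ⟩^m by ⟨ξ⟩^m at the price of ⟨ζ⟩^(-m), which the rapid decay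
of `G` absorbs. -/
theorem oscInt_bound (hm : m ≤ 0) (hχ : IsMultiplier m χ) (hG : IsRapid G) :
    ∃ C : ℝ, 0 ≤ C ∧ ∀ p, ‖oscInt χ G p‖ ≤ C * bracket p.2 ^ m := by
  obtain ⟨C, hC, hb⟩ := hχ.norm_le
  refine ⟨C * 2 ^ (-m) * ∫ ζ, bracket ζ ^ (-m) * ‖G ζ‖, mul_nonneg (by positivity)
    (integral_nonneg fun ζ => mul_nonneg (bracket_rpow_nonneg _ _) (norm_nonneg _)), fun p => ?_⟩
  rw [mul_right_comm, ← integral_const_mul]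
  refine norm_integral_le_of_norm_le ((hG.integrable_mul (-m)).const_mul _)
    (Filter.Eventually.of_forall fun ζ => ?_)
  rw [norm_mul, norm_mul, norm_cexp_I, one_mul, ← mul_assoc]
  gcongr
  refine (hb _).trans ?_
  have h1 := peetre p.2 ζ (neg_nonneg.2 hm)
  rw [neg_neg] at h1
  calc C * bracket (p.2 + ζ) ^ m ≤ C * (2 ^ (-m) * bracket p.2 ^ m * bracket ζ ^ (-m)) := by gcongr
    _ = _ := by ring

theorem hasFDerivAt_oscInt_integrand (hχ : ContDiff ℝ ∞ χ) (ζ : E n) (p : E n × E n) :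
    HasFDerivAt (fun p : E n × E n =>
        Complex.exp (Complex.I * ((inner ℝ p.1 ζ : ℝ) : ℂ)) * χ (p.2 + ζ) * G ζ)
      ((Complex.exp (Complex.I * ((inner ℝ p.1 ζ : ℝ) : ℂ)) * G ζ) •
        ((χ (p.2 + ζ)) • (Complex.I • (Complex.ofRealCLM.comp
          ((innerSL ℝ ζ).comp (ContinuousLinearMap.fst ℝ (E n) (E n)))))
        + (fderiv ℝ χ (p.2 + ζ)).comp (ContinuousLinearMap.snd ℝ (E n) (E n)))) p := by
  have h1 : HasFDerivAt (fun p : E n × E n => Complex.I * ((inner ℝ p.1 ζ : ℝ) : ℂ))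
      (Complex.I • (Complex.ofRealCLM.comp
          ((innerSL ℝ ζ).comp (ContinuousLinearMap.fst ℝ (E n) (E n))))) p := by
    refine HasFDerivAt.const_mul ?_ Complex.I
    refine ((Complex.ofRealCLM.comp ((innerSL ℝ ζ).comp
      (ContinuousLinearMap.fst ℝ (E n) (E n)))).hasFDerivAt (x := p)).congr_of_eventuallyEq
      (Filter.Eventually.of_forall fun q => ?_)
    simp [real_inner_comm]
  have h2 : HasFDerivAt (fun p : E n × E n => χ (p.2 + ζ))
      ((fderiv ℝ χ (p.2 + ζ)).comp (ContinuousLinearMap.snd ℝ (E n) (E n))) p := by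
    have h3 : HasFDerivAt χ (fderiv ℝ χ (p.2 + ζ)) (p.2 + ζ) :=
      (hχ.differentiable (by simp)).differentiableAt.hasFDerivAt
    exact HasFDerivAt.comp (g := χ) (f := fun p : E n × E n => p.2 + ζ) p h3
      (hasFDerivAt_snd.add_const ζ)
  refine ((h1.cexp.mul h2).mul_const (G ζ)).congr_fderiv ?_
  ext q <;> simp <;> ring

/-- A position derivative multiplies `G` by a linear factor and a frequency derivative falls on `χ`.
Both give integrals of the same kind, which drives the inductions for smoothness and for the symbol
estimates. -/
theorem hasFDerivAt_oscInt (hm : m ≤ 0) (hχ : IsMultiplier m χ) (hG : IsRapid G) (p : E n × E n) :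
    ∃ L : E n × E n →L[ℝ] ℂ, HasFDerivAt (oscInt χ G) L p ∧ ∀ v w : E n,
      L (v, w) = oscInt χ (fun ζ => Complex.I * ((inner ℝ v ζ : ℝ) : ℂ) * G ζ) p
        + oscInt (fun ξ => fderiv ℝ χ ξ w) G p := by
  obtain ⟨C, hC, hb⟩ := hχ.norm_le
  obtain ⟨D, hD, hb'⟩ := hχ.norm_fderiv_le
  have hcχ := hχ.smooth.continuous
  have hcχ' : Continuous (fderiv ℝ χ) := hχ.smooth.continuous_fderiv (by simp)
  have hcG := hG.continuous
  have hle : ∀ {r : ℝ}, r ≤ 0 → ∀ ξ : E n, bracket ξ ^ r ≤ 1 := fun hr ξ =>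
    Real.rpow_le_one_of_one_le_of_nonpos (one_le_bracket ξ) hr
  set F' : E n × E n → E n → (E n × E n →L[ℝ] ℂ) := fun p ζ =>
      (Complex.exp (Complex.I * ((inner ℝ p.1 ζ : ℝ) : ℂ)) * G ζ) •
        ((χ (p.2 + ζ)) • (Complex.I • (Complex.ofRealCLM.comp
          ((innerSL ℝ ζ).comp (ContinuousLinearMap.fst ℝ (E n) (E n)))))
        + (fderiv ℝ χ (p.2 + ζ)).comp (ContinuousLinearMap.snd ℝ (E n) (E n))) with hF'
  -- Since m ≤ 0, χ and its derivative are bounded; the factor |ζ| from the exponential is left to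
  -- `G`. The bound is uniform in `p`, as dominated convergence requires.
  have hF'b : ∀ p ζ, ‖F' p ζ‖ ≤ (C + D) * (bracket ζ ^ (1 : ℝ) * ‖G ζ‖) := by
    intro p ζ
    have hχ1 : ‖χ (p.2 + ζ)‖ ≤ C := (hb _).trans (mul_le_of_le_one_right hC (hle hm _))
    have hχ2 : ‖fderiv ℝ χ (p.2 + ζ)‖ ≤ D :=
      (hb' _).trans (mul_le_of_le_one_right hD (hle (by linarith) _))
    have h3 : ‖(Complex.ofRealCLM.comp ((innerSL ℝ ζ).comp
        (ContinuousLinearMap.fst ℝ (E n) (E n))))‖ ≤ ‖ζ‖ := by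
      refine ContinuousLinearMap.opNorm_le_bound _ (norm_nonneg _) fun q => ?_
      simp only [ContinuousLinearMap.comp_apply, ContinuousLinearMap.coe_fst', innerSL_apply_apply,
        Complex.ofRealCLM_apply, Complex.norm_real]
      exact (norm_inner_le_norm _ _).trans
        (mul_le_mul_of_nonneg_left (norm_fst_le q) (norm_nonneg _))
    have h4 : ‖(fderiv ℝ χ (p.2 + ζ)).comp (ContinuousLinearMap.snd ℝ (E n) (E n))‖ ≤ D := by
      refine (ContinuousLinearMap.opNorm_comp_le _ _).trans ?_
      exact (mul_le_of_le_one_right (norm_nonneg _) (ContinuousLinearMap.norm_snd_le ..)).trans hχ2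
    simp only [hF']
    rw [norm_smul, norm_mul, norm_cexp_I, one_mul, Real.rpow_one, mul_comm, ← mul_assoc]
    gcongr
    refine (norm_add_le _ _).trans ?_
    rw [norm_smul, norm_smul, Complex.norm_I, one_mul, add_mul]
    have h5 := one_le_bracket ζ
    have h6 := norm_le_bracket ζ
    exact add_le_add (mul_le_mul hχ1 (h3.trans h6) (norm_nonneg _) hC)
      (h4.trans (le_mul_of_one_le_right hD h5))
  have hF'c : ∀ p, Continuous (F' p) := by
    intro p
    simp only [hF']
    fun_prop
  have hF'i : ∀ p, Integrable (F' p) := fun p =>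
    ((hG.integrable_mul 1).const_mul (C + D)).mono' (hF'c p).aestronglyMeasurable
      (Filter.Eventually.of_forall fun ζ => hF'b p ζ)
  have hFi : Integrable fun ζ =>
      Complex.exp (Complex.I * ((inner ℝ p.1 ζ : ℝ) : ℂ)) * χ (p.2 + ζ) * G ζ := by
    refine hG.integrable.bdd_mul (c := C) ?_ (Filter.Eventually.of_forall fun ζ => ?_)
    · exact Continuous.aestronglyMeasurable (by fun_prop)
    · rw [norm_mul, norm_cexp_I, one_mul]
      exact (hb _).trans (mul_le_of_le_one_right hC (hle hm _))
  refine ⟨∫ ζ, F' p ζ, ?_, fun v w => ?_⟩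
  · refine hasFDerivAt_integral_of_dominated_of_fderiv_le (s := Set.univ) Filter.univ_mem
      (Filter.Eventually.of_forall fun q => Continuous.aestronglyMeasurable (by fun_prop)) hFi
      (hF'c p).aestronglyMeasurable (Filter.Eventually.of_forall fun ζ q _ => hF'b q ζ)
      ((hG.integrable_mul 1).const_mul (C + D)) (Filter.Eventually.of_forall fun ζ q _ => ?_)
    exact hasFDerivAt_oscInt_integrand hχ.smooth ζ q
  · rw [ContinuousLinearMap.integral_apply (hF'i p), oscInt, oscInt, ← integral_add]
    · refine integral_congr_ae (Filter.Eventually.of_forall fun ζ => ?_)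
      simp [hF', real_inner_comm]
      ring
    · refine (hG.inner_mul v).integrable.bdd_mul (c := C) ?_ (Filter.Eventually.of_forall fun ζ => ?_)
      · exact Continuous.aestronglyMeasurable (by fun_prop)
      · rw [norm_mul, norm_cexp_I, one_mul]
        exact (hb _).trans (mul_le_of_le_one_right hC (hle hm _))
    · refine hG.integrable.bdd_mul (c := D * ‖w‖) ?_ (Filter.Eventually.of_forall fun ζ => ?_)
      · exact Continuous.aestronglyMeasurable (by fun_prop)
      · rw [norm_mul, norm_cexp_I, one_mul]
        refine (ContinuousLinearMap.le_opNorm _ _).trans ?_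
        gcongr
        exact (hb' _).trans (mul_le_of_le_one_right hD (hle (by linarith) _))

theorem fderiv_oscInt (hm : m ≤ 0) (hχ : IsMultiplier m χ) (hG : IsRapid G) (p : E n × E n)
    (v w : E n) : fderiv ℝ (oscInt χ G) p (v, w) =
      oscInt χ (fun ζ => Complex.I * ((inner ℝ v ζ : ℝ) : ℂ) * G ζ) p
        + oscInt (fun ξ => fderiv ℝ χ ξ w) G p := by
  obtain ⟨L, hL, h⟩ := hasFDerivAt_oscInt hm hχ hG p
  rw [hL.fderiv, h]

theorem contDiff_oscInt (hm : m ≤ 0) (hχ : IsMultiplier m χ) (hG : IsRapid G) :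
    ContDiff ℝ ∞ (oscInt χ G) := by
  refine contDiff_infty.2 fun N => ?_
  induction N generalizing m χ G with
  | zero =>
    have : Continuous (oscInt χ G) := continuous_iff_continuousAt.2 fun p => by
      obtain ⟨L, hL, -⟩ := hasFDerivAt_oscInt hm hχ hG p
      exact hL.continuousAt
    exact contDiff_zero.2 this
  | succ N ih =>
    push_cast
    rw [contDiff_succ_iff_fderiv_apply]
    refine ⟨fun p => ?_, by simp, fun q => ?_⟩
    · obtain ⟨L, hL, -⟩ := hasFDerivAt_oscInt hm hχ hG p
      exact hL.differentiableAt
    · have : (fun p => fderiv ℝ (oscInt χ G) p q) = fun p =>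
          oscInt χ (fun ζ => Complex.I * ((inner ℝ q.1 ζ : ℝ) : ℂ) * G ζ) p
            + oscInt (fun ξ => fderiv ℝ χ ξ q.2) G p := by
        funext p
        exact fderiv_oscInt hm hχ hG p q.1 q.2
      rw [this]
      exact (ih hm hχ (hG.inner_mul q.1)).add
        (ih (by linarith) (hχ.fderiv_apply q.2) hG)

theorem oscInt_zero_left : oscInt (fun _ => 0) G = 0 := by
  funext p
  simp [oscInt]

theorem oscInt_zero_right : oscInt χ (fun _ => 0) = 0 := by
  funext p
  simp [oscInt]

/-- Each frequency derivative lowers the order of `χ` by one, which is exactly the weight allotted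
to it. -/
theorem exists_bound_dirD_oscInt (l : List (Fin n ⊕ Fin n)) (hm : m ≤ 0) (hχ : IsMultiplier m χ)
    (hG : IsRapid G) : ∃ C : ℝ, 0 ≤ C ∧ ∀ p, ‖dirD phaseDir l (oscInt χ G) p‖ ≤
      C * (bracket p.2 ^ m * (l.map fun j => phaseWeight j p).prod) := by
  induction l generalizing m χ G with
  | nil => simpa using oscInt_bound hm hχ hG
  | cons j l ih =>
    rcases j with i | i
    · have h1 : (fun p => fderiv ℝ (oscInt χ G) p (phaseDir (Sum.inl i))) =
          oscInt χ (fun ζ => Complex.I * ((inner ℝ (stdB i) ζ : ℝ) : ℂ) * G ζ) := by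
        funext p
        rw [phaseDir, Sum.elim_inl, fderiv_oscInt hm hχ hG]
        simp [oscInt_zero_left]
      rw [dirD_cons, h1]
      simpa [phaseWeight] using ih hm hχ (hG.inner_mul (stdB i))
    · have h1 : (fun p => fderiv ℝ (oscInt χ G) p (phaseDir (Sum.inr i))) =
          oscInt (fun ξ => fderiv ℝ χ ξ (stdB i)) G := by
        funext p
        rw [phaseDir, Sum.elim_inr, fderiv_oscInt hm hχ hG]
        simp [oscInt_zero_right]
      rw [dirD_cons, h1]
      obtain ⟨C, hC, hb⟩ := ih (by linarith) (hχ.fderiv_apply (stdB i)) hG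
      refine ⟨C, hC, fun p => (hb p).trans_eq ?_⟩
      have h2 : bracket p.2 ^ (m - 1) = bracket p.2 ^ m * (bracket p.2)⁻¹ := by
        rw [Real.rpow_sub_one (bracket_pos _).ne', div_eq_mul_inv]
      rw [List.map_cons, List.prod_cons, h2]
      simp only [phaseWeight, Sum.elim_inr]
      ring

/-- The symbol of the operator `φ ∘ χ(D) ∘ φ`. -/
def locSymbol (χ φ : E n → ℂ) (x ξ : E n) : ℂ :=
  φ x * (twoPiInv n * oscInt χ (fourierT φ) (x, ξ))

theorem isSymbol_locSymbol {Ω : Opens (E n)} (hχ : IsMultiplier 0 χ) {φ : E n → ℂ}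
    (hφ : IsTest Ω φ) : IsSymbol Ω 0 (locSymbol χ φ) := by
  have h0 : ∀ x, x ∉ tsupport φ → φ x = 0 := fun x hx => image_eq_zero_of_notMem_tsupport hx
  have hG : IsRapid (fourierT φ) := isRapid_fourierT hφ.2.1 hφ.1 h0
  -- With a single index the calculus of slow families is just the product rule for symbol
  -- estimates.
  let e : Unit → Eps := fun _ => ⟨1, one_pos, le_rfl⟩
  have h1 : SlowSym e (Set.univ : Set (E n)) (fun _ _ => 1) fun _ p => φ p.1 :=
    SlowPos.comp_fst (W := fun _ => 1) isOpen_univ (fun _ => zero_le_one)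
      ⟨fun _ => hφ.1.contDiffOn, fun l => by
        obtain ⟨B, hB⟩ := exists_bound_dirD (v := stdB) hφ.2.1 hφ.1 h0 l
        exact ⟨fun _ => |B|, Slow.const (abs_nonneg B), fun i x _ => by
          simpa using (hB x).trans (le_abs_self B)⟩⟩
  have h2 : SlowSym e (Set.univ : Set (E n)) (fun _ _ => 1) fun _ => oscInt χ (fourierT φ) :=
    ⟨fun _ => (contDiff_oscInt le_rfl hχ hG).contDiffOn, fun l => by
      obtain ⟨C, hC, hb⟩ := exists_bound_dirD_oscInt l le_rfl hχ hG
      exact ⟨fun _ => C, Slow.const hC, fun i p _ => by simpa using hb p⟩⟩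
  have h3 := SlowFam.mul (isOpen_univ.prod isOpen_univ) (fun _ _ _ => zero_le_one)
    (fun _ _ _ => zero_le_one) (fun j p _ => phaseWeight_nonneg j p) h1 (h2.const_mul (twoPiInv n))
  have hs : SymSmooth Ω (locSymbol χ φ) := (h3.1 ()).mono (Set.prod_mono (Set.subset_univ _) subset_rfl)
  refine ⟨hs, fun K hK hKΩ j k α β => ?_⟩
  obtain ⟨σ, hσ, hb⟩ := h3.2 ((List.ofFn α).map Sum.inr ++ (List.ofFn β).map Sum.inl)
  refine ⟨σ (), fun x hx ξ => ?_⟩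
  have h4 := hb () (x, ξ) ⟨Set.mem_univ _, Set.mem_univ _⟩
  rw [prod_phaseWeight_inr_inl, List.length_ofFn, one_mul, one_mul] at h4
  have h5 : dirD phaseDir ((List.ofFn α).map Sum.inr ++ (List.ofFn β).map Sum.inl)
      (fun p : E n × E n => locSymbol χ φ p.1 p.2) (x, ξ) = symDeriv α β (locSymbol χ φ) x ξ := by
    rw [symDeriv, iteratedFDeriv_apply_eq_dirD (Ω.isOpen.prod isOpen_univ) hs _ _
      (x := (x, ξ)) ⟨hKΩ hx, Set.mem_univ _⟩, List.ofFn_fin_append]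
    have h6 : (List.ofFn fun i => ((0 : E n), EuclideanSpace.single (α i) (1 : ℝ)))
        = ((List.ofFn α).map Sum.inr).map (phaseDir (n := n)) := by
      rw [List.map_ofFn, List.map_ofFn]
      rfl
    have h7 : (List.ofFn fun i => (EuclideanSpace.single (β i) (1 : ℝ), (0 : E n)))
        = ((List.ofFn β).map Sum.inl).map (phaseDir (n := n)) := by
      rw [List.map_ofFn, List.map_ofFn]
      rfl
    rw [h6, h7, ← List.map_append, dirD_map]
    rfl
  have h6 : ‖symDeriv α β (locSymbol χ φ) x ξ‖ ≤ σ () * (bracket ξ)⁻¹ ^ j := by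
    rw [← h5]
    exact h4
  have hξ := bracket_pos ξ
  rw [neg_zero, zero_add, Real.rpow_natCast]
  calc bracket ξ ^ j * ‖symDeriv α β (locSymbol χ φ) x ξ‖
      ≤ bracket ξ ^ j * (σ () * (bracket ξ)⁻¹ ^ j) := by gcongr
    _ = σ () := by
        rw [inv_pow]
        field_simp

end Multipliers

/-! ### Cut-offs to cones -/

section ConeMultipliers

variable {n : ℕ}

theorem contDiff_bracket : ContDiff ℝ ∞ (bracket : E n → ℝ) := by
  have h : ContDiff ℝ ∞ fun ξ : E n => 1 + ‖ξ‖ ^ 2 := contDiff_const.add (contDiff_norm_sq ℝ)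
  exact h.sqrt fun ξ => by positivity

/-- The function `(θ, η) ↦ b ((θ + η) / (1 + 2 θ η + |η|²)^{1/2})`, which describes
`ξ ↦ b (ξ / ⟨ξ⟩)` after rescaling. -/
def rescaled (b : E n → ℂ) (q : E n × E n) : ℂ :=
  b ((Real.sqrt (1 + 2 * inner ℝ q.1 q.2 + ‖q.2‖ ^ 2))⁻¹ • (q.1 + q.2))

/-- Put t = ⟨ξ₁⟩, θ = ξ₁/t and η = (ξ - ξ₁)/t. Then ξ = t(θ + η), and ⟨ξ⟩² = t²(1 + 2θ·η + |η|²)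
because 1 + |ξ₁|² = t². -/
theorem rescaled_eq (b : E n → ℂ) (ξ ξ₁ : E n) :
    rescaled b ((bracket ξ₁)⁻¹ • ξ₁, (bracket ξ₁)⁻¹ • (ξ - ξ₁)) = b ((bracket ξ)⁻¹ • ξ) := by
  have ht := bracket_pos ξ₁
  set t := bracket ξ₁ with hteq
  have h1 : 1 + 2 * inner ℝ (t⁻¹ • ξ₁) (t⁻¹ • (ξ - ξ₁)) + ‖t⁻¹ • (ξ - ξ₁)‖ ^ 2
      = (t⁻¹) ^ 2 * (1 + ‖ξ‖ ^ 2) := by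
    have h2 : t ^ 2 = 1 + ‖ξ₁‖ ^ 2 := bracket_sq ξ₁
    have h3 : ‖ξ - ξ₁‖ ^ 2 = ‖ξ‖ ^ 2 - 2 * inner ℝ ξ₁ ξ + ‖ξ₁‖ ^ 2 := by
      rw [norm_sub_sq_real, real_inner_comm]
    have h4 : (t⁻¹) ^ 2 * t ^ 2 = 1 := by
      rw [← mul_pow, inv_mul_cancel₀ ht.ne', one_pow]
    rw [real_inner_smul_left, real_inner_smul_right, norm_smul, mul_pow, norm_inv,
      Real.norm_of_nonneg ht.le, h3, inner_sub_right, real_inner_self_eq_norm_sq]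
    rw [h2] at h4
    linear_combination -h4
  rw [rescaled, h1, Real.sqrt_mul (by positivity), Real.sqrt_sq (by positivity), ← smul_add,
    add_sub_cancel, smul_smul, mul_inv, inv_inv, mul_comm t, mul_assoc, mul_inv_cancel₀ ht.ne',
    mul_one]
  rfl

/-- After rescaling by t = ⟨ξ₁⟩, derivatives at ξ₁ become derivatives of one fixed smooth function
at (ξ₁/t, 0), a point of a fixed compact set, and each brings a factor 1/t. -/
theorem isMultiplier_comp_div_bracket {b : E n → ℂ} (hb : ContDiff ℝ ∞ b) :
    IsMultiplier 0 fun ξ => b ((bracket ξ)⁻¹ • ξ) := by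
  have hsm : ContDiff ℝ ∞ fun ξ : E n => b ((bracket ξ)⁻¹ • ξ) :=
    hb.comp ((contDiff_bracket.inv fun ξ => (bracket_pos ξ).ne').smul contDiff_id)
  refine ⟨hsm, fun k => ?_⟩
  set g : E n × E n → ℝ := fun q => 1 + 2 * inner ℝ q.1 q.2 + ‖q.2‖ ^ 2 with hg
  have hgs : ContDiff ℝ ∞ g := by
    refine (contDiff_const.add (contDiff_const.mul (contDiff_fst.inner ℝ contDiff_snd))).add ?_
    exact (contDiff_norm_sq ℝ).comp contDiff_snd
  set O : Set (E n × E n) := {q | 0 < g q} with hOdef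
  have hO : IsOpen O := isOpen_lt continuous_const hgs.continuous
  have hΨ : ContDiffOn ℝ ∞ (rescaled b) O := by
    have h1 : ContDiffOn ℝ ∞ (fun q => (Real.sqrt (g q))⁻¹) O :=
      (hgs.contDiffOn.sqrt fun q hq => (show 0 < g q from hq).ne').inv
        fun q hq => (Real.sqrt_pos.2 hq).ne'
    have h2 : ContDiffOn ℝ ∞ (fun q : E n × E n => q.1 + q.2) O :=
      (contDiff_fst.add contDiff_snd).contDiffOn
    exact hb.comp_contDiffOn (h1.smul h2)
  set K : Set (E n × E n) := Metric.closedBall 0 1 ×ˢ {0} with hKdef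
  have hK : IsCompact K := (isCompact_closedBall 0 1).prod isCompact_singleton
  have hKO : K ⊆ O := by
    rintro ⟨θ, η⟩ ⟨-, hη⟩
    simp only [Set.mem_singleton_iff] at hη
    simp [hOdef, hg, hη]
  have hcont : ContinuousOn (iteratedFDeriv ℝ k (rescaled b)) O :=
    (hΨ.continuousOn_iteratedFDerivWithin (m := k) (by exact_mod_cast le_top)
      hO.uniqueDiffOn).congr fun q hq => (iteratedFDerivWithin_of_isOpen k hO hq).symm
  obtain ⟨C, hC⟩ := hK.exists_bound_of_continuousOn (hcont.mono hKO)
  refine ⟨|C|, abs_nonneg C, fun ξ₁ => ?_⟩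
  have ht := bracket_pos ξ₁
  set t := bracket ξ₁ with hteq
  set L : E n →L[ℝ] E n × E n := (ContinuousLinearMap.inr ℝ (E n) (E n)).comp
    (t⁻¹ • ContinuousLinearMap.id ℝ (E n)) with hL
  have hLn : ∀ v, ‖L v‖ = t⁻¹ * ‖v‖ := fun v => by
    simp [hL, Prod.norm_def, norm_smul, abs_of_pos ht]
    positivity
  have hfun : (fun ξ => b ((bracket ξ)⁻¹ • ξ)) =
      fun ξ => rescaled b (L ξ + (t⁻¹ • ξ₁, -(t⁻¹ • ξ₁))) := by
    funext ξ
    rw [← rescaled_eq b ξ ξ₁]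
    congr 1
    simp [hL, sub_eq_add_neg]
    exact ⟨rfl, rfl⟩
  have hpt : L ξ₁ + (t⁻¹ • ξ₁, -(t⁻¹ • ξ₁)) = (t⁻¹ • ξ₁, 0) := by
    simp [hL]
  have hmem : ((t⁻¹ • ξ₁, 0) : E n × E n) ∈ K := by
    refine ⟨?_, rfl⟩
    rw [mem_closedBall_zero_iff, norm_smul, norm_inv, Real.norm_of_nonneg ht.le,
      inv_mul_le_iff₀ ht, mul_one]
    exact norm_le_bracket ξ₁
  refine ContinuousMultilinearMap.opNorm_le_bound (by positivity) fun v => ?_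
  rw [iteratedFDeriv_apply_eq_dirD isOpen_univ hsm.contDiffOn k v (Set.mem_univ _), hfun,
    dirD_comp_affine hO hΨ L _ _ (by rw [hpt]; exact hKO hmem), hpt]
  have h1 : dirD (L ∘ id) (List.ofFn v) (rescaled b) (t⁻¹ • ξ₁, 0)
      = iteratedFDeriv ℝ k (rescaled b) (t⁻¹ • ξ₁, 0) fun i => L (v i) := by
    rw [iteratedFDeriv_apply_eq_dirD hO hΨ k _ (hKO hmem)]
    rw [show (List.ofFn fun i => L (v i)) = (List.ofFn v).map L by rw [List.map_ofFn]; rfl, dirD_map]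
    rfl
  rw [h1]
  refine (ContinuousMultilinearMap.le_opNorm _ _).trans ?_
  simp only [hLn, Finset.prod_mul_distrib, Finset.prod_const, Finset.card_univ, Fintype.card_fin]
  rw [zero_sub, Real.rpow_neg ht.le, Real.rpow_natCast, ← inv_pow, ← mul_assoc]
  gcongr
  exact (hC _ hmem).trans (le_abs_self C)

/-- Cut-offs to conic neighbourhoods. -/
theorem exists_cone_multiplier {ξ₀ : E n} {Γ : Set (E n)} (hΓ : IsConicNhd Γ ξ₀) :
    ∃ χ : E n → ℂ, IsMultiplier 0 χ ∧ (∀ ξ, χ ξ ≠ 0 → ξ ∈ Γ) ∧ ∃ Γ', IsConicNhd Γ' ξ₀ ∧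
      ∃ R : ℝ, 0 < R ∧ ∀ ξ ∈ Γ', R ≤ ‖ξ‖ → χ ξ = 1 := by
  obtain ⟨hΓo, hξΓ, h0Γ, hcone⟩ := hΓ
  have hξ₀ : ξ₀ ≠ 0 := fun h => h0Γ (h ▸ hξΓ)
  have hn : 0 < ‖ξ₀‖ := norm_pos_iff.2 hξ₀
  set v : E n := ‖ξ₀‖⁻¹ • ξ₀ with hv
  have hvΓ : v ∈ Γ := hcone _ hξΓ _ (inv_pos.2 hn)
  have hvn : ‖v‖ = 1 := by rw [hv, norm_smul, norm_inv, norm_norm, inv_mul_cancel₀ hn.ne']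
  obtain ⟨δ, hδ, hball⟩ := Metric.isOpen_iff.1 hΓo v hvΓ
  let b : ContDiffBump v := ⟨δ / 2, δ, by positivity, by linarith⟩
  refine ⟨fun ξ => (b ((bracket ξ)⁻¹ • ξ) : ℂ), isMultiplier_comp_div_bracket
    (b := fun y => (b y : ℂ)) (Complex.ofRealCLM.contDiff.comp b.contDiff), fun ξ hξ => ?_,
    {ξ | ‖ξ - ‖ξ‖ • v‖ < δ / 4 * ‖ξ‖}, ⟨?_, ?_, by simp, fun ξ hξ t ht => ?_⟩, 4 / δ, by positivity,
    fun ξ hξ hξR => ?_⟩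
  · have h1 : (bracket ξ)⁻¹ • ξ ∈ Function.support b := fun h => hξ (by simp [h])
    rw [b.support_eq] at h1
    have h2 := hcone _ (hball h1) _ (bracket_pos ξ)
    rwa [smul_smul, mul_inv_cancel₀ (bracket_pos ξ).ne', one_smul] at h2
  · exact isOpen_lt (by fun_prop) (by fun_prop)
  · have : ξ₀ - ‖ξ₀‖ • v = 0 := by
      rw [hv, smul_smul, mul_inv_cancel₀ hn.ne', one_smul, sub_self]
    simp only [Set.mem_ofPred_eq, this, norm_zero]
    positivity
  · simp only [Set.mem_ofPred_eq] at hξ ⊢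
    rw [norm_smul, Real.norm_of_nonneg ht.le, mul_smul, ← smul_sub, norm_smul,
      Real.norm_of_nonneg ht.le]
    nlinarith
  · have hξ' : ‖ξ - ‖ξ‖ • v‖ < δ / 4 * ‖ξ‖ := hξ
    have hb := bracket_pos ξ
    have h1 := norm_le_bracket ξ
    have h2 := bracket_le_one_add_norm ξ
    -- The distance to `v` is at most δ/4 from the angle, plus (⟨ξ⟩ - |ξ|)/⟨ξ⟩ ≤ 1/⟨ξ⟩ ≤ δ/4 by the
    -- choice of the radius 4/δ.
    have hmem : (bracket ξ)⁻¹ • ξ ∈ Metric.closedBall v b.rIn := by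
      rw [mem_closedBall_iff_norm]
      change _ ≤ δ / 2
      have h3 : (bracket ξ)⁻¹ • ξ - v =
          (bracket ξ)⁻¹ • ((ξ - ‖ξ‖ • v) + (‖ξ‖ - bracket ξ) • v) := by
        rw [sub_smul, smul_add, smul_sub, smul_sub, smul_smul (bracket ξ)⁻¹ (bracket ξ),
          inv_mul_cancel₀ hb.ne', one_smul]
        abel
      rw [h3, norm_smul, norm_inv, Real.norm_of_nonneg hb.le, inv_mul_le_iff₀ hb]
      refine (norm_add_le _ _).trans ?_
      rw [norm_smul, hvn, mul_one, Real.norm_eq_abs, abs_of_nonpos (by linarith)]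
      rw [div_le_iff₀ hδ] at hξR
      nlinarith
    simp only
    rw [b.one_of_mem_closedBall hmem]
    simp

end ConeMultipliers

/-! ### Ellipticity and action of φ χ(D) φ -/

section LocalizedMultipliers

variable {n : ℕ} {Ω : Opens (E n)} {χ φ : E n → ℂ}

/-- Mean value inequality on the segment. One factor ⟨ζ⟩ is its length; the other comes from
Peetre's inequality, which moves the decay of the gradient back to ξ. -/
theorem IsMultiplier.norm_sub_le (hχ : IsMultiplier 0 χ) :
    ∃ C : ℝ, 0 ≤ C ∧ ∀ ξ ζ, ‖χ (ξ + ζ) - χ ξ‖ ≤ C * (bracket ξ)⁻¹ * bracket ζ ^ (2 : ℝ) := by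
  obtain ⟨D, hD, hb⟩ := hχ.norm_fderiv_le
  refine ⟨2 * D, by positivity, fun ξ ζ => ?_⟩
  have hξ := bracket_pos ξ
  have hζ := bracket_pos ζ
  have h1 : ∀ y ∈ segment ℝ ξ (ξ + ζ), ‖fderiv ℝ χ y‖ ≤ 2 * D * (bracket ξ)⁻¹ * bracket ζ := by
    intro y hy
    rw [segment_eq_image'] at hy
    obtain ⟨s, ⟨hs0, hs1⟩, rfl⟩ := hy
    rw [add_sub_cancel_left]
    have h2 := peetre ξ (s • ζ) zero_le_one
    simp only [Real.rpow_one, Real.rpow_neg_one] at h2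
    have h3 : bracket (s • ζ) ≤ bracket ζ := bracket_le_of_norm_le (by
      rw [norm_smul, Real.norm_of_nonneg hs0]
      exact mul_le_of_le_one_left (norm_nonneg _) hs1)
    refine (hb _).trans ?_
    rw [zero_sub, Real.rpow_neg_one]
    calc D * (bracket (ξ + s • ζ))⁻¹ ≤ D * (2 * (bracket ξ)⁻¹ * bracket ζ) := by
          gcongr
          exact h2.trans (by gcongr)
      _ = _ := by ring
  have h4 := Convex.norm_image_sub_le_of_norm_fderiv_le (𝕜 := ℝ) (f := χ)
    (fun y _ => (hχ.smooth.differentiable (by simp)).differentiableAt) h1 (convex_segment _ _)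
    (left_mem_segment ℝ ξ (ξ + ζ)) (right_mem_segment ℝ ξ (ξ + ζ))
  rw [add_sub_cancel_left] at h4
  refine h4.trans ?_
  rw [Real.rpow_two, sq, ← mul_assoc]
  gcongr
  exact norm_le_bracket ζ

/-- By Fourier inversion φ(x)χ(ξ) is the same integral with χ(ξ) in place of χ(ξ + ζ). So φ²χ is the
principal part of the symbol of φ χ(D) φ. -/
theorem norm_oscInt_sub_le (hχ : IsMultiplier 0 χ) (hφ : IsTest Ω φ) :
    ∃ C : ℝ, 0 ≤ C ∧ ∀ x ξ, ‖twoPiInv n * oscInt χ (fourierT φ) (x, ξ) - φ x * χ ξ‖ ≤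
      C * (bracket ξ)⁻¹ := by
  have h0 : ∀ x, x ∉ tsupport φ → φ x = 0 := fun x hx => image_eq_zero_of_notMem_tsupport hx
  have hG : IsRapid (fourierT φ) := isRapid_fourierT hφ.2.1 hφ.1 h0
  obtain ⟨C, hC, hb⟩ := hχ.norm_sub_le
  obtain ⟨B, hB, hχB⟩ := hχ.norm_le
  simp only [Real.rpow_zero, mul_one] at hχB
  refine ⟨‖twoPiInv n‖ * (C * ∫ ζ, bracket ζ ^ (2 : ℝ) * ‖fourierT φ ζ‖), mul_nonneg (norm_nonneg _)
    (mul_nonneg hC (integral_nonneg fun ζ => mul_nonneg (bracket_rpow_nonneg _ _) (norm_nonneg _))),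
    fun x ξ => ?_⟩
  have hcχ := hχ.smooth.continuous
  have h1 : ∀ g : E n → ℂ, Continuous g → (∀ ζ, ‖g ζ‖ ≤ B) → Integrable fun ζ =>
      Complex.exp (Complex.I * ((inner ℝ x ζ : ℝ) : ℂ)) * g ζ * fourierT φ ζ := fun g hg hgB =>
    hG.integrable.bdd_mul (c := B) (Continuous.aestronglyMeasurable (by fun_prop))
      (Filter.Eventually.of_forall fun ζ => by
        rw [norm_mul, norm_cexp_I, one_mul]
        exact hgB ζ)
  have h2 : φ x * χ ξ = twoPiInv n * ∫ ζ, Complex.exp (Complex.I * ((inner ℝ x ζ : ℝ) : ℂ)) * χ ξ *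
      fourierT φ ζ := by
    conv_lhs => rw [← quantize_one hφ.2.1 hφ.1 h0 x, quantize, mul_assoc, ← integral_mul_const]
    rw [twoPiInv]
    congr 2
    ext ζ
    ring
  rw [h2, oscInt, ← mul_sub, ← integral_sub (h1 (fun ζ => χ (ξ + ζ)) (by fun_prop) fun ζ => hχB _)
    (h1 (fun _ => χ ξ) continuous_const fun _ => hχB ξ), norm_mul, mul_assoc]
  refine mul_le_mul_of_nonneg_left ?_ (norm_nonneg _)
  rw [mul_right_comm, ← integral_const_mul]
  refine norm_integral_le_of_norm_le ((hG.integrable_mul 2).const_mul _)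
    (Filter.Eventually.of_forall fun ζ => ?_)
  rw [← sub_mul, ← mul_sub, norm_mul, norm_mul, norm_cexp_I, one_mul, ← mul_assoc]
  gcongr
  exact hb ξ ζ

theorem notMem_charSet_locSymbol (hχ : IsMultiplier 0 χ) (hφ : IsTest Ω φ) {x₀ ξ₀ : E n}
    (hx₀ : x₀ ∈ Ω) (hφ1 : φ x₀ = 1) {Γ : Set (E n)} (hΓ : IsConicNhd Γ ξ₀) {R : ℝ} (hR : 0 < R)
    (hχ1 : ∀ ξ ∈ Γ, R ≤ ‖ξ‖ → χ ξ = 1) : (x₀, ξ₀) ∉ charSet Ω 0 (locSymbol χ φ) := by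
  rintro ⟨-, hno⟩
  refine hno ?_
  obtain ⟨C, hC, hb⟩ := norm_oscInt_sub_le hχ hφ
  have hopen : IsOpen ((Ω : Set (E n)) ∩ {x | 1 / 2 < ‖φ x‖}) :=
    Ω.isOpen.inter (isOpen_lt continuous_const hφ.1.continuous.norm)
  obtain ⟨ρ, hρ, hsub⟩ := Metric.nhds_basis_closedBall.mem_iff.1
    (hopen.mem_nhds (x := x₀) ⟨hx₀, by simp [hφ1]; norm_num⟩)
  have hcl : closure (Metric.ball x₀ ρ) ⊆ Metric.closedBall x₀ ρ := Metric.closure_ball_subset_closedBall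
  -- On the ball |φ| > 1/2, and for |ξ| ≥ 4C the error is at most 1/4. The inner factor is then at
  -- least 1/4 and the symbol at least 1/8.
  refine ⟨⟨Metric.ball x₀ ρ, Metric.isOpen_ball⟩, ⟨(isCompact_closedBall x₀ ρ).of_isClosed_subset
    isClosed_closure hcl, fun x hx => (hsub (hcl hx)).1⟩, Metric.mem_ball_self hρ, Γ, hΓ,
    max R (4 * C), 1 / 8, by positivity, by norm_num, fun x hx ξ hξ hξR => ?_⟩
  have hφx : 1 / 2 < ‖φ x‖ := (hsub (Metric.ball_subset_closedBall hx)).2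
  have h1 := hb x ξ
  have hpos := bracket_pos ξ
  rw [hχ1 ξ hξ ((le_max_left _ _).trans hξR), mul_one] at h1
  have h2 : C * (bracket ξ)⁻¹ ≤ 1 / 4 := by
    rw [← div_eq_mul_inv, div_le_iff₀ hpos]
    have := (le_max_right R (4 * C)).trans (hξR.trans (norm_le_bracket ξ))
    linarith
  have h3 : 1 / 4 ≤ ‖twoPiInv n * oscInt χ (fourierT φ) (x, ξ)‖ := by
    have := norm_sub_norm_le (φ x) (φ x - twoPiInv n * oscInt χ (fourierT φ) (x, ξ))
    rw [sub_sub_cancel, norm_sub_rev] at this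
    linarith
  rw [Real.rpow_zero, mul_one, locSymbol, norm_mul]
  nlinarith

/-- Substitute η = ξ + ζ and interchange the integrals: the inner one is the convolution that
represents the Fourier transform of φf at η. -/
theorem quantize_locSymbol (hχ : IsMultiplier 0 χ) (hφ : IsTest Ω φ) {K : Set (E n)}
    (hK : IsCompact K) {f : E n → ℂ} (hf : ContDiff ℝ ∞ f) (f0 : ∀ x, x ∉ K → f x = 0) (x : E n) :
    quantize (locSymbol χ φ) f x =
      φ x * (twoPiInv n * oscInt χ (fourierT fun y => φ y * f y) (x, 0)) := by
  have h0 : ∀ x, x ∉ tsupport φ → φ x = 0 := fun x hx => image_eq_zero_of_notMem_tsupport hx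
  have hG : IsRapid (fourierT φ) := isRapid_fourierT hφ.2.1 hφ.1 h0
  have hH : IsRapid (fourierT f) := isRapid_fourierT hK hf f0
  obtain ⟨B, hB, hχB⟩ := hχ.norm_le
  simp only [Real.rpow_zero, mul_one] at hχB
  have hcχ := hχ.smooth.continuous
  set Φ : E n → E n → ℂ := fun η ξ => (Complex.exp (Complex.I * ((inner ℝ x η : ℝ) : ℂ)) * χ η) *
    (fourierT f ξ * fourierT φ (η - ξ)) with hΦ
  have hΦi : Integrable (Function.uncurry Φ) (volume.prod volume) := by
    have h1 : Integrable (fun p : E n × E n => fourierT f p.2 * fourierT φ (p.1 - p.2))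
        (volume.prod volume) :=
      Integrable.convolution_integrand (ContinuousLinearMap.mul ℝ ℂ) hH.integrable hG.integrable
    exact h1.bdd_mul (c := B) (f := fun p : E n × E n =>
        Complex.exp (Complex.I * ((inner ℝ x p.1 : ℝ) : ℂ)) * χ p.1)
      (Continuous.aestronglyMeasurable (by fun_prop)) (Filter.Eventually.of_forall fun p => by
        rw [norm_mul, norm_cexp_I, one_mul]
        exact hχB _)
  have h2 : ∀ ξ, Complex.exp (Complex.I * ((inner ℝ x ξ : ℝ) : ℂ)) * locSymbol χ φ x ξ *
      fourierT f ξ = φ x * twoPiInv n * ∫ η, Φ η ξ := by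
    intro ξ
    have h3 : ∫ η, Φ η ξ = ∫ ζ, Φ (ζ + ξ) ξ := (integral_add_right_eq_self (fun η => Φ η ξ) ξ).symm
    have h4 : ∫ ζ, Φ (ζ + ξ) ξ = Complex.exp (Complex.I * ((inner ℝ x ξ : ℝ) : ℂ)) * fourierT f ξ *
        oscInt χ (fourierT φ) (x, ξ) := by
      rw [oscInt, ← integral_const_mul]
      congr 1
      ext ζ
      simp only [hΦ]
      rw [add_sub_cancel_right, inner_add_right, Complex.ofReal_add, mul_add, Complex.exp_add,
        add_comm ζ ξ]
      ring
    rw [h3, h4, locSymbol]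
    ring
  have h5 : ∀ η, ∫ ξ, Φ η ξ = Complex.exp (Complex.I * ((inner ℝ x η : ℝ) : ℂ)) * χ η *
      ∫ ξ, fourierT f ξ * fourierT φ (η - ξ) := fun η => integral_const_mul _ _
  have h6 : ∀ η, fourierT (fun y => φ y * f y) η =
      twoPiInv n * ∫ ξ, fourierT f ξ * fourierT φ (η - ξ) := fun η => by
    rw [← fourierT_mul hφ.2.1 hK hf f0 hφ.1 h0 η]
    simp only [mul_comm]
  simp only [quantize, h2, oscInt, zero_add, h6]
  rw [integral_const_mul, ← integral_integral_swap hΦi]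
  simp only [h5]
  have h7 : ∫ η, Complex.exp (Complex.I * ((inner ℝ x η : ℝ) : ℂ)) * χ η *
      (twoPiInv n * ∫ ξ, fourierT f ξ * fourierT φ (η - ξ)) = twoPiInv n * ∫ η,
        Complex.exp (Complex.I * ((inner ℝ x η : ℝ) : ℂ)) * χ η *
          ∫ ξ, fourierT f ξ * fourierT φ (η - ξ) := by
    rw [← integral_const_mul]
    congr 1
    ext η
    ring
  rw [h7, ← twoPiInv]
  ring

end LocalizedMultipliers

/-! ### The kernel of a classical operator and its support -/

section KernelSupport

variable {n : ℕ} {Ω : Opens (E n)} {a : E n → E n → ℂ}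

theorem fourierT_add {f g : E n → ℂ} (hf : Integrable f) (hg : Integrable g) (ξ : E n) :
    fourierT (fun y => f y + g y) ξ = fourierT f ξ + fourierT g ξ := by
  have hb : ∀ {u : E n → ℂ}, Integrable u → Integrable fun y : E n =>
      Complex.exp (-(Complex.I * ((inner ℝ y ξ : ℝ) : ℂ))) * u y := fun hu =>
    hu.bdd_mul (c := 1) (Continuous.aestronglyMeasurable (by fun_prop))
      (Filter.Eventually.of_forall fun y => (norm_cexp_neg_I _).le)
  simp only [fourierT, mul_add]
  exact integral_add (hb hf) (hb hg)

theorem fourierT_const_mul (c : ℂ) (f : E n → ℂ) (ξ : E n) :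
    fourierT (fun y => c * f y) ξ = c * fourierT f ξ := by
  simp only [fourierT, ← integral_const_mul]
  congr 1
  ext y
  ring

theorem quantize_const_mul (c : ℂ) (f : E n → ℂ) (x : E n) :
    quantize a (fun y => c * f y) x = c * quantize a f x := by
  simp only [quantize, fourierT_const_mul]
  rw [mul_left_comm, ← integral_const_mul c]
  congr 2
  ext ξ
  ring

theorem quantize_add (ha : IsSymbol Ω 0 a) {x : E n} (hx : x ∈ Ω) {K : Set (E n)}
    (hK : IsCompact K) {f g : E n → ℂ} (hf : ContDiff ℝ ∞ f) (f0 : ∀ y, y ∉ K → f y = 0)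
    (hg : ContDiff ℝ ∞ g) (g0 : ∀ y, y ∉ K → g y = 0) :
    quantize a (fun y => f y + g y) x = quantize a f x + quantize a g x := by
  simp only [quantize, fourierT_add (integrable_of_support hK hf.continuous f0)
    (integrable_of_support hK hg.continuous g0), mul_add]
  rw [integral_add (integrable_quantize ha hx (integrable_fourierT hK hf f0))
    (integrable_quantize ha hx (integrable_fourierT hK hg g0)), mul_add]

theorem quantize_zero (x : E n) : quantize a (fun _ => 0) x = 0 := by
  simp [quantize, fourierT]

theorem quantize_sum {ι : Type*} (s : Finset ι) (ha : IsSymbol Ω 0 a) {x : E n} (hx : x ∈ Ω)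
    {K : Set (E n)} (hK : IsCompact K) {f : ι → E n → ℂ} (hf : ∀ i ∈ s, ContDiff ℝ ∞ (f i))
    (f0 : ∀ i ∈ s, ∀ y, y ∉ K → f i y = 0) :
    quantize a (fun y => ∑ i ∈ s, f i y) x = ∑ i ∈ s, quantize a (f i) x := by
  classical
  induction s using Finset.induction_on with
  | empty => simpa using quantize_zero x
  | insert i s hi ih =>
    simp only [Finset.mem_insert, forall_eq_or_imp] at hf f0
    simp only [Finset.sum_insert hi]
    rw [quantize_add ha hx hK hf.1 f0.1 (ContDiff.sum hf.2)
      (fun y hy => Finset.sum_eq_zero fun j hj => f0.2 j hj y hy), ih hf.2 f0.2]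

theorem IsTest.slice_contDiff {W : Opens (E n × E n)} {w : E n × E n → ℂ} (hw : IsTest W w)
    (x : E n) : ContDiff ℝ ∞ fun y => w (x, y) :=
  hw.1.comp (contDiff_const.prodMk contDiff_id)

theorem slice_eq_zero {w : E n × E n → ℂ} (x y : E n) (hy : y ∉ Prod.snd '' tsupport w) :
    w (x, y) = 0 :=
  image_eq_zero_of_notMem_tsupport fun h => hy ⟨(x, y), h, rfl⟩

theorem slice_eq_zero' {w : E n × E n → ℂ} (x y : E n) (hx : x ∉ Prod.fst '' tsupport w) :
    w (x, y) = 0 :=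
  image_eq_zero_of_notMem_tsupport fun h => hx ⟨(x, y), h, rfl⟩

theorem IsTest.exists_fourierT_slice_decay {W : Opens (E n × E n)} {w : E n × E n → ℂ}
    (hw : IsTest W w) :
    ∃ D : ℝ, ∀ x ξ, ‖fourierT (fun y => w (x, y)) ξ‖ ≤ D * bracket ξ ^ (-((n : ℝ) + 1)) := by
  have hK₂ : IsCompact (Prod.snd '' tsupport w) := hw.2.1.image continuous_snd
  obtain ⟨B, hB, hBl⟩ := exists_uniform_bound (J := Fin n) (n + 1)
    (P := fun l B => ∀ p, ‖dirD (fun i => ((0 : E n), stdB i)) l w p‖ ≤ B)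
    (fun l B B' hBB h p => (h p).trans hBB)
    (fun l => exists_bound_dirD hw.2.1 hw.1 (fun p hp => image_eq_zero_of_notMem_tsupport hp) l)
  have hslice : ∀ x (l : List (Fin n)) y, dirD stdB l (fun y => w (x, y)) y
      = dirD (fun i => ((0 : E n), stdB i)) l w (x, y) := fun x l y => by
    have h := dirD_comp_affine (w := stdB) isOpen_univ hw.1.contDiffOn
      (ContinuousLinearMap.inr ℝ (E n) (E n)) (x, 0) l (x := y) (Set.mem_univ _)
    simpa [Function.comp_def] using h
  refine ⟨(1 + n : ℝ) ^ (n + 1) * volume.real (Prod.snd '' tsupport w) * B, fun x ξ => ?_⟩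
  have h := fourierT_decay hK₂ (n + 1) (hw.slice_contDiff x) (slice_eq_zero x) (B := B)
    (fun l hl y => by rw [hslice]; exact hBl l hl _) ξ
  have hξ := bracket_pos ξ
  rw [Real.rpow_neg hξ.le, ← div_eq_mul_inv, le_div_iff₀ (Real.rpow_pos_of_pos hξ _), mul_comm]
  rw [← Real.rpow_natCast] at h
  push_cast at h
  exact h

theorem continuousOn_quantize_slice (ha : IsSymbol Ω 0 a) {W : Opens (E n × E n)}
    {w : E n × E n → ℂ} (hw : IsTest W w) {K : Set (E n)} (hK : IsCompact K) (hKΩ : K ⊆ Ω) :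
    ContinuousOn (fun x => quantize a (fun y => w (x, y)) x) K := by
  obtain ⟨C, hC⟩ := ha.exists_bound hK hKΩ
  have hC' : ∀ x ∈ K, ∀ ξ, ‖a x ξ‖ ≤ |C| := fun x hx ξ => (hC x hx ξ).trans (le_abs_self C)
  obtain ⟨D, hdec⟩ := hw.exists_fourierT_slice_decay
  have hcont : Continuous fun q : E n × E n => fourierT (fun y => w (q.2, y)) q.1 :=
    continuous_partialF (hw.2.1.image continuous_snd) (A := fun p => w (p.2, p.1))
      (hw.1.continuous.comp (continuous_snd.prodMk continuous_fst))
      (fun p hp => slice_eq_zero p.2 p.1 hp)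
  have hint : ContinuousOn (fun x => ∫ ξ, Complex.exp (Complex.I * ((inner ℝ x ξ : ℝ) : ℂ)) *
      a x ξ * fourierT (fun y => w (x, y)) ξ) K := by
    refine continuousOn_of_dominated
      (bound := fun ξ => |C| * (D * bracket ξ ^ (-((n : ℝ) + 1)))) (fun x hx => ?_) (fun x hx => ?_)
      (((integrable_bracket_rpow (lt_add_one (n : ℝ))).const_mul D).const_mul _) ?_
    · have h1 := ha.1.continuous_right (hKΩ hx)
      have h2 : Continuous fun ξ => fourierT (fun y => w (x, y)) ξ :=
        hcont.comp (f := fun ξ : E n => (ξ, x)) (by fun_prop)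
      have h3 : Continuous fun ξ : E n => Complex.exp (Complex.I * ((inner ℝ x ξ : ℝ) : ℂ)) := by
        fun_prop
      exact ((h3.mul h1).mul h2).aestronglyMeasurable
    · refine Filter.Eventually.of_forall fun ξ => ?_
      rw [norm_mul, norm_mul, norm_cexp_I, one_mul]
      exact mul_le_mul (hC' x hx ξ) (hdec x ξ) (norm_nonneg _) (abs_nonneg C)
    · refine Filter.Eventually.of_forall fun ξ => ?_
      have h1 : ContinuousOn (fun x => a x ξ) K :=
        (ContDiffOn.continuousOn ha.1).comp (f := fun x => (x, ξ))
          (continuous_id.prodMk continuous_const).continuousOn fun x hx => ⟨hKΩ hx, Set.mem_univ _⟩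
      have h2 : Continuous fun x => fourierT (fun y => w (x, y)) ξ :=
        hcont.comp (f := fun x : E n => (ξ, x)) (by fun_prop)
      have h3 : Continuous fun x : E n => Complex.exp (Complex.I * ((inner ℝ x ξ : ℝ) : ℂ)) := by
        fun_prop
      exact (h3.continuousOn.mul h1).mul h2.continuousOn
  simp only [quantize]
  exact continuousOn_const.mul hint

/-- Continuity on the compact projection of the support and vanishing elsewhere. This allows the
kernel pairing of a sum to be split. -/
theorem integrableOn_quantize_slice (ha : IsSymbol Ω 0 a) {w : E n × E n → ℂ}
    (hw : IsTest (prodOpens Ω) w) :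
    IntegrableOn (fun x => quantize a (fun y => w (x, y)) x) (Ω : Set (E n)) := by
  have hKΩ : Prod.fst '' tsupport w ⊆ Ω := by
    rintro _ ⟨q, hq, rfl⟩
    exact (hw.2.2 hq).1
  have hK : IsCompact (Prod.fst '' tsupport w) := hw.2.1.image continuous_fst
  refine IntegrableOn.of_forall_sdiff_eq_zero (s := Prod.fst '' tsupport w)
    ((continuousOn_quantize_slice ha hw hK hKΩ).integrableOn_compact hK)
    Ω.isOpen.measurableSet fun x hx => ?_
  have : (fun y => w (x, y)) = fun _ => 0 := funext fun y => slice_eq_zero' x y hx.2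
  simp only [this, quantize_zero]

theorem kernelPairing_sum {ι : Type*} (s : Finset ι) (ha : IsSymbol Ω 0 a)
    {w : ι → E n × E n → ℂ} (hw : ∀ i ∈ s, IsTest (prodOpens Ω) (w i)) {L : Set (E n × E n)}
    (hL : IsCompact L) (hwL : ∀ i ∈ s, tsupport (w i) ⊆ L) :
    kernelPairing Ω a (fun p => ∑ i ∈ s, w i p) = ∑ i ∈ s, kernelPairing Ω a (w i) := by
  have hq : ∀ x ∈ (Ω : Set (E n)), quantize a (fun y => ∑ i ∈ s, w i (x, y)) x =
      ∑ i ∈ s, quantize a (fun y => w i (x, y)) x := fun x hx =>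
    quantize_sum s ha hx (hL.image continuous_snd) (fun i hi => (hw i hi).slice_contDiff x)
      fun i hi y hy => slice_eq_zero x y fun h => hy (Set.image_mono (hwL i hi) h)
  simp only [kernelPairing]
  rw [setIntegral_congr_fun Ω.isOpen.measurableSet hq, integral_finsetSum]
  exact fun i hi => integrableOn_quantize_slice ha (hw i hi)

/-- The largest open set on which the kernel vanishes. -/
def kernelComplement (Ω : Opens (E n)) (a : E n → E n → ℂ) : Opens (E n × E n) :=
  sSup {W | W ≤ prodOpens Ω ∧ ∀ w, IsTest W w → kernelPairing Ω a w = 0}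

theorem kernelSupport_eq : kernelSupport Ω a = (prodOpens Ω : Set (E n × E n)) \ kernelComplement Ω a := by
  ext p
  simp only [kernelSupport, kernelComplement, Set.mem_sdiff, Opens.coe_sSup, Set.mem_iUnion,
    SetLike.mem_coe, exists_prop, Set.mem_ofPred_eq, not_exists, not_and]
  exact ⟨fun h => ⟨h.1, fun W hW hp => h.2 W hW.1 hp hW.2⟩,
    fun h => ⟨h.1, fun W hW hp hv => h.2 W ⟨hW, hv⟩ hp⟩⟩

/-- The kernel still vanishes on the union of all open sets on which it vanishes: finitely many of
them cover the support of `w`, and a subordinate partition of unity splits `w`. -/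
theorem kernelPairing_eq_zero (ha : IsSymbol Ω 0 a) {w : E n × E n → ℂ}
    (hw : IsTest (kernelComplement Ω a) w) : kernelPairing Ω a w = 0 := by
  set 𝒲 := {W | W ≤ prodOpens Ω ∧ ∀ w, IsTest W w → kernelPairing Ω a w = 0} with h𝒲
  have hcov : tsupport w ⊆ ⋃ i : 𝒲, ((i : Opens (E n × E n)) : Set (E n × E n)) := by
    intro p hp
    have := hw.2.2 hp
    rw [kernelComplement, Opens.coe_sSup] at this
    simpa [h𝒲] using this
  obtain ⟨t, ht⟩ := hw.2.1.elim_finite_subcover _ (fun i : 𝒲 => i.1.isOpen) hcov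
  obtain ⟨f, hf⟩ := SmoothPartitionOfUnity.exists_isSubordinate
    (modelWithCornersSelf ℝ (E n × E n)) (isClosed_tsupport w)
    (fun i : t => ((i.1 : Opens (E n × E n)) : Set (E n × E n))) (fun i => i.1.1.isOpen)
    (fun p hp => by simpa using ht hp)
  have hfs : ∀ i, ContDiff ℝ ∞ fun p => (f i p : ℂ) := fun i =>
    Complex.ofRealCLM.contDiff.comp (f i).contMDiff.contDiff
  have hsub : ∀ i, tsupport (fun p => (f i p : ℂ) * w p) ⊆ tsupport w := fun i =>
    tsupport_mul_subset_right
  have htest : ∀ i : t, IsTest (i.1 : Opens (E n × E n)) fun p => (f i p : ℂ) * w p := fun i => by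
    refine ⟨(hfs i).mul hw.1, hw.2.1.of_isClosed_subset (isClosed_tsupport _) (hsub i),
      tsupport_mul_subset_left.trans (subset_trans ?_ (hf i))⟩
    exact closure_mono fun p hp h => hp (by simp [h])
  have hsum : ∀ p, w p = ∑ i : t, (f i p : ℂ) * w p := fun p => by
    by_cases hp : p ∈ tsupport w
    · have h1 := f.sum_eq_one hp
      rw [finsum_eq_sum_of_fintype] at h1
      rw [← Finset.sum_mul, ← Complex.ofReal_sum, h1, Complex.ofReal_one, one_mul]
    · simp [image_eq_zero_of_notMem_tsupport hp]
  rw [show w = fun p => ∑ i : t, (f i p : ℂ) * w p from funext hsum,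
    kernelPairing_sum Finset.univ ha (w := fun (i : t) p => (f i p : ℂ) * w p)
      (fun i _ => ⟨(htest i).1, (htest i).2.1, (htest i).2.2.trans i.1.2.1⟩)
      hw.2.1 fun i _ => hsub i]
  exact Finset.sum_eq_zero fun i _ => i.1.2.2 _ (htest i)

/-- Tensor products g(x)f(y) with g supported in `V` live off the kernel support. So the continuous
function a(x,D)f annihilates every test function on `V`. -/
theorem quantize_eq_zero_of_disjoint (ha : IsSymbol Ω 0 a) {f : E n → ℂ} (hf : IsTest Ω f)
    {V : Opens (E n)} (hVΩ : V ≤ Ω) (hc : ContinuousOn (quantize a f) V)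
    (hd : ∀ x ∈ V, ∀ y ∈ tsupport f, (x, y) ∉ kernelSupport Ω a) :
    ∀ x ∈ V, quantize a f x = 0 := by
  have h1 : ∀ g : E n → ℝ, ContDiff ℝ ∞ g → HasCompactSupport g → tsupport g ⊆ V →
      ∫ x, g x • quantize a f x = 0 := by
    intro g hg hgc hgV
    set w : E n × E n → ℂ := fun p => (g p.1 : ℂ) * f p.2 with hw
    have hsupp : tsupport w ⊆ tsupport g ×ˢ tsupport f := by
      refine closure_minimal (fun p hp => ⟨subset_tsupport _ fun h => hp ?_,
        subset_tsupport _ fun h => hp ?_⟩) ((isClosed_tsupport g).prod (isClosed_tsupport f))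
      · simp [hw, h]
      · simp [hw, h]
    have hwt : IsTest (kernelComplement Ω a) w := by
      refine ⟨((Complex.ofRealCLM.contDiff.comp hg).comp contDiff_fst).mul (hf.1.comp contDiff_snd),
        (IsCompact.prod hgc hf.2.1).of_isClosed_subset (isClosed_tsupport _) hsupp, fun p hp => ?_⟩
      obtain ⟨h2, h3⟩ := hsupp hp
      have h4 := hd p.1 (hgV h2) p.2 h3
      rw [kernelSupport_eq] at h4
      by_contra h5
      exact h4 ⟨⟨hVΩ (hgV h2), hf.2.2 h3⟩, h5⟩
    have h2 := kernelPairing_eq_zero ha hwt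
    rw [kernelPairing, setIntegral_eq_integral_of_forall_compl_eq_zero] at h2
    · rw [← h2]
      congr 1
      ext x
      simp only [hw]
      rw [quantize_const_mul, Complex.real_smul]
    · intro x hx
      have : g x = 0 := image_eq_zero_of_notMem_tsupport fun h => hx (hVΩ (hgV h))
      simp only [hw, this, Complex.ofReal_zero, zero_mul, quantize_zero]
  have h2 := V.isOpen.ae_eq_zero_of_integral_contDiff_smul_eq_zero
    (hc.locallyIntegrableOn V.isOpen.measurableSet) h1
  have h3 : quantize a f =ᵐ[volume.restrict (V : Set (E n))] fun _ => 0 :=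
    (ae_restrict_iff' V.isOpen.measurableSet).2 h2
  exact fun x hx => Measure.eqOn_open_of_ae_eq h3 V.isOpen hc continuousOn_const hx

end KernelSupport

/-! ### The operator φ χ(D) φ detects microlocal regularity -/

section MicrolocalCutoffs

variable {n : ℕ} {Ω : Opens (E n)} {χ φ G : E n → ℂ}

theorem kernelSupport_locSymbol_subset (hχ : IsMultiplier 0 χ) (hφ : IsTest Ω φ) :
    kernelSupport Ω (locSymbol χ φ) ⊆ tsupport φ ×ˢ tsupport φ := by
  rintro p ⟨hp, hW⟩
  by_contra hpT
  have hT : IsClosed (tsupport φ ×ˢ tsupport φ) := (isClosed_tsupport φ).prod (isClosed_tsupport φ)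
  refine hW (prodOpens Ω ⊓ ⟨(tsupport φ ×ˢ tsupport φ)ᶜ, hT.isOpen_compl⟩) inf_le_left
    ⟨hp, hpT⟩ fun w hw => ?_
  have h1 : ∀ x, quantize (locSymbol χ φ) (fun y => w (x, y)) x = 0 := fun x => by
    rw [quantize_locSymbol hχ hφ (hw.2.1.image continuous_snd) (hw.slice_contDiff x)
      (slice_eq_zero x)]
    by_cases hx : x ∈ tsupport φ
    · have h2 : (fun y => φ y * w (x, y)) = fun _ => 0 := funext fun y => by
        by_cases hy : y ∈ tsupport φ
        · rw [image_eq_zero_of_notMem_tsupport (fun h => (hw.2.2 h).2 ⟨hx, hy⟩), mul_zero]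
        · rw [image_eq_zero_of_notMem_tsupport hy, zero_mul]
      rw [h2, show fourierT (fun _ : E n => (0 : ℂ)) = fun _ => 0 by ext; simp [fourierT],
        oscInt_zero_right]
      simp
    · rw [image_eq_zero_of_notMem_tsupport hx, zero_mul]
  simp [kernelPairing, h1]

/-- The kernel support is closed only relative to Ω × Ω. Inside the compact `T ×ˢ T` its pieces are
compact products minus an open set, hence compact. -/
theorem isProperSubset_kernelSupport {a : E n → E n → ℂ} {T : Set (E n)} (hT : IsCompact T)
    (hTΩ : T ⊆ Ω) (h : kernelSupport Ω a ⊆ T ×ˢ T) : IsProperSubset Ω (kernelSupport Ω a) := by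
  intro K hK hKΩ
  have key : ∀ A B : Set (E n), IsCompact (T ∩ A) → IsCompact (T ∩ B) →
      IsCompact (kernelSupport Ω a ∩ A ×ˢ B) := fun A B hA hB => by
    have h1 : kernelSupport Ω a ∩ A ×ˢ B
        = ((T ∩ A) ×ˢ (T ∩ B)) \ (kernelComplement Ω a : Set (E n × E n)) := by
      have h2 := h
      rw [kernelSupport_eq] at h2 ⊢
      ext p
      constructor
      · rintro ⟨hp, hpA, hpB⟩
        exact ⟨⟨⟨(h2 hp).1, hpA⟩, (h2 hp).2, hpB⟩, hp.2⟩
      · rintro ⟨⟨⟨hp1, hpA⟩, hp2, hpB⟩, hp⟩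
        exact ⟨⟨⟨hTΩ hp1, hTΩ hp2⟩, hp⟩, hpA, hpB⟩
    rw [h1]
    exact (hA.prod hB).diff (kernelComplement Ω a).isOpen
  have hTT : IsCompact (T ∩ (Ω : Set (E n))) := by rwa [Set.inter_eq_left.2 hTΩ]
  exact ⟨key _ _ (hT.inter hK) hTT, key _ _ hTT (hT.inter hK)⟩

/-- A derivative along v brings down at most |v|⟨ζ⟩. The product of χ and G is kept inside the norm,
so only values of G on the support of χ matter. -/
theorem norm_dirD_oscInt_le (hχ : IsMultiplier 0 χ) (l : List (E n)) (hG : IsRapid G) (x : E n) :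
    ‖dirD id l (fun x => oscInt χ G (x, 0)) x‖ ≤
      (l.map norm).prod * ∫ ζ, bracket ζ ^ (l.length : ℝ) * ‖χ ζ * G ζ‖ := by
  obtain ⟨B, hB, hχB⟩ := hχ.norm_le
  simp only [Real.rpow_zero, mul_one] at hχB
  have hint : ∀ {G : E n → ℂ}, IsRapid G → ∀ r : ℝ,
      Integrable fun ζ => bracket ζ ^ r * ‖χ ζ * G ζ‖ := fun {G} hG r => by
    have h1 := (hG.integrable_mul r).bdd_mul (c := B) (f := fun ζ => ‖χ ζ‖)
      hχ.smooth.continuous.norm.aestronglyMeasurable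
      (Filter.Eventually.of_forall fun ζ => by rw [norm_norm]; exact hχB ζ)
    refine h1.congr (Filter.Eventually.of_forall fun ζ => ?_)
    simp only [norm_mul]
    ring
  induction l generalizing G with
  | nil =>
    simp only [dirD_nil, oscInt, zero_add, List.map_nil, List.prod_nil, one_mul, List.length_nil,
      Nat.cast_zero, Real.rpow_zero]
    refine norm_integral_le_of_norm_le (by simpa using hint hG 0)
      (Filter.Eventually.of_forall fun ζ => ?_)
    rw [mul_assoc, norm_mul, norm_cexp_I, one_mul]
  | cons v l ih =>
    have h1 : (fun x => fderiv ℝ (fun x => oscInt χ G (x, 0)) x (id v)) =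
        fun x => oscInt χ (fun ζ => Complex.I * ((inner ℝ v ζ : ℝ) : ℂ) * G ζ) (x, 0) := by
      funext x
      have h2 : HasFDerivAt (fun x : E n => ((x, 0) : E n × E n))
          (ContinuousLinearMap.inl ℝ (E n) (E n)) x :=
        (hasFDerivAt_id x).prodMk (hasFDerivAt_const (0 : E n) x)
      have h3 : HasFDerivAt (oscInt χ G) (fderiv ℝ (oscInt χ G) (x, 0)) (x, 0) :=
        ((contDiff_oscInt le_rfl hχ hG).differentiable (by simp)).differentiableAt.hasFDerivAt
      have h4 : HasFDerivAt (fun x => oscInt χ G (x, 0)) ((fderiv ℝ (oscInt χ G) (x, 0)).comp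
          (ContinuousLinearMap.inl ℝ (E n) (E n))) x :=
        HasFDerivAt.comp (g := oscInt χ G) (f := fun x : E n => ((x, 0) : E n × E n)) x h3 h2
      rw [h4.fderiv, ContinuousLinearMap.comp_apply]
      change fderiv ℝ (oscInt χ G) (x, 0) (v, 0) = _
      rw [fderiv_oscInt le_rfl hχ hG]
      simp [oscInt_zero_left]
    rw [dirD_cons, h1]
    refine (ih (hG.inner_mul v)).trans ?_
    rw [List.map_cons, List.prod_cons, mul_comm ‖v‖, mul_assoc, ← integral_const_mul ‖v‖]
    refine mul_le_mul_of_nonneg_left ?_ (List.prod_nonneg fun r hr => by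
      obtain ⟨z, -, rfl⟩ := List.mem_map.1 hr
      exact norm_nonneg z)
    refine integral_mono (hint (hG.inner_mul v) _) ((hint hG _).const_mul _) fun ζ => ?_
    have hζ := bracket_pos ζ
    have h4 : ‖Complex.I * ((inner ℝ v ζ : ℝ) : ℂ)‖ ≤ ‖v‖ * bracket ζ := by
      rw [norm_mul, Complex.norm_I, one_mul, Complex.norm_real]
      exact (norm_inner_le_norm v ζ).trans
        (mul_le_mul_of_nonneg_left (norm_le_bracket ζ) (norm_nonneg v))
    simp only [List.length_cons, Nat.cast_add, Nat.cast_one]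
    rw [Real.rpow_add_one hζ.ne', norm_mul, norm_mul, norm_mul (χ ζ)]
    calc bracket ζ ^ (l.length : ℝ) * (‖χ ζ‖ * (‖Complex.I * ((inner ℝ v ζ : ℝ) : ℂ)‖ * ‖G ζ‖))
        ≤ bracket ζ ^ (l.length : ℝ) * (‖χ ζ‖ * (‖v‖ * bracket ζ * ‖G ζ‖)) := by gcongr
      _ = _ := by ring

theorem contDiff_oscInt_left (hχ : IsMultiplier 0 χ) (hG : IsRapid G) :
    ContDiff ℝ ∞ fun x => oscInt χ G (x, 0) :=
  (contDiff_oscInt le_rfl hχ hG).comp (contDiff_id.prodMk contDiff_const)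

theorem norm_iteratedFDeriv_oscInt_le (hχ : IsMultiplier 0 χ) (k : ℕ) (hG : IsRapid G) (x : E n) :
    ‖iteratedFDeriv ℝ k (fun x => oscInt χ G (x, 0)) x‖ ≤
      ∫ ζ, bracket ζ ^ (k : ℝ) * ‖χ ζ * G ζ‖ := by
  refine ContinuousMultilinearMap.opNorm_le_bound
    (integral_nonneg fun ζ => mul_nonneg (bracket_rpow_nonneg _ _) (norm_nonneg _)) fun v => ?_
  rw [iteratedFDeriv_apply_eq_dirD isOpen_univ (contDiff_oscInt_left hχ hG).contDiffOn k v
    (Set.mem_univ _), mul_comm]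
  refine (norm_dirD_oscInt_le hχ _ hG x).trans_eq ?_
  rw [List.length_ofFn, List.map_ofFn, List.prod_ofFn]
  rfl

/-- Derivatives of order k cost ⟨ζ⟩^k, and only on the set where χ is nonzero, hence inside `Γ`.
There one exponent `N` serves every weight, so it serves every derivative. -/
theorem isRegularNet_locSymbol (hχ : IsMultiplier 0 χ) {Γ : Set (E n)}
    (hχΓ : ∀ ξ, χ ξ ≠ 0 → ξ ∈ Γ) (hφ : ContDiff ℝ ∞ φ) {G : Eps → E n → ℂ}
    (hG : ∀ ε, IsRapid (G ε)) {N : ℝ}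
    (hN : ∀ l : ℝ, UnifBigO Γ (fun ε ξ => bracket ξ ^ l * ‖G ε ξ‖) (-N)) :
    IsRegularNet Ω fun ε x => φ x * (twoPiInv n * oscInt χ (G ε) (x, 0)) := by
  obtain ⟨B, hB, hχB⟩ := hχ.norm_le
  simp only [Real.rpow_zero, mul_one] at hχB
  have hs : ∀ ε, ContDiff ℝ ∞ fun x => twoPiInv n * oscInt χ (G ε) (x, 0) := fun ε =>
    contDiff_const.mul (contDiff_oscInt_left hχ (hG ε))
  refine ⟨fun ε => (hφ.mul (hs ε)).contDiffOn, fun K hK _ => ⟨N, fun k => ?_⟩⟩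
  have hM : ∀ i : ℕ, ∃ M : ℝ, ∀ x ∈ K, ‖iteratedFDeriv ℝ i φ x‖ ≤ M := fun i =>
    hK.exists_bound_of_continuousOn
      (hφ.continuous_iteratedFDeriv (by exact_mod_cast le_top)).continuousOn
  choose M hM using hM
  -- The weight has k powers for the derivatives and n + 1 for integrability.
  obtain ⟨C, hC, η, hη, hb⟩ := (hN (k + (n + 1))).exists_nonneg
  set I : ℝ := ∫ ζ : E n, bracket ζ ^ (-((n : ℝ) + 1)) with hI
  have hI0 : 0 ≤ I := integral_nonneg fun ζ => bracket_rpow_nonneg _ _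
  refine ⟨∑ i ∈ Finset.range (k + 1), (k.choose i : ℝ) * |M i| * (‖twoPiInv n‖ * (B * C * I)), η, hη,
    fun ε hε x hx => ?_⟩
  have he := Real.rpow_pos_of_pos ε.pos (-N)
  have h1 : ∀ j ≤ k, ‖iteratedFDeriv ℝ j (fun x => twoPiInv n * oscInt χ (G ε) (x, 0)) x‖ ≤
      ‖twoPiInv n‖ * (B * C * I) * (ε : ℝ) ^ (-N) := by
    intro j hj
    have h2 : iteratedFDeriv ℝ j (fun x => twoPiInv n * oscInt χ (G ε) (x, 0)) x
        = twoPiInv n • iteratedFDeriv ℝ j (fun x => oscInt χ (G ε) (x, 0)) x :=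
      iteratedFDeriv_const_smul_apply (a := twoPiInv n)
        ((contDiff_oscInt_left hχ (hG ε)).of_le (by exact_mod_cast le_top)).contDiffAt
    rw [h2, norm_smul, mul_assoc]
    refine mul_le_mul_of_nonneg_left ?_ (norm_nonneg _)
    refine (norm_iteratedFDeriv_oscInt_le hχ j (hG ε) x).trans ?_
    rw [mul_right_comm, hI, ← integral_const_mul]
    refine integral_mono_of_nonneg (Filter.Eventually.of_forall fun ζ =>
      mul_nonneg (bracket_rpow_nonneg _ _) (norm_nonneg _))
      ((integrable_bracket_rpow (lt_add_one (n : ℝ))).const_mul _)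
      (Filter.Eventually.of_forall fun ζ => ?_)
    have hζ := bracket_pos ζ
    by_cases h0 : χ ζ = 0
    · simp only [h0, zero_mul, norm_zero, mul_zero]
      exact mul_nonneg (by positivity) (bracket_rpow_nonneg _ _)
    · have h3 := hb ε hε ζ (hχΓ ζ h0)
      rw [norm_mul, norm_norm, Real.norm_of_nonneg (bracket_rpow_nonneg _ _)] at h3
      have h4 : bracket ζ ^ (j : ℝ) ≤ bracket ζ ^ ((k : ℝ) + (n + 1)) * bracket ζ ^ (-((n : ℝ) + 1)) := by
        rw [← Real.rpow_add hζ, add_neg_cancel_right]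
        exact bracket_rpow_le_rpow ζ (by exact_mod_cast hj)
      simp only [norm_mul]
      calc bracket ζ ^ (j : ℝ) * (‖χ ζ‖ * ‖G ε ζ‖)
          ≤ bracket ζ ^ ((k : ℝ) + (n + 1)) * bracket ζ ^ (-((n : ℝ) + 1)) * (B * ‖G ε ζ‖) := by
            have := hχB ζ
            gcongr
        _ = B * (bracket ζ ^ ((k : ℝ) + (n + 1)) * ‖G ε ζ‖) * bracket ζ ^ (-((n : ℝ) + 1)) := by ring
        _ ≤ B * (C * (ε : ℝ) ^ (-N)) * bracket ζ ^ (-((n : ℝ) + 1)) := by gcongr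
        _ = _ := by ring
  refine (norm_iteratedFDeriv_mul_le hφ (hs ε) x (n := k) (by exact_mod_cast le_top)).trans ?_
  rw [Finset.sum_mul]
  refine Finset.sum_le_sum fun i _ => ?_
  rw [mul_assoc (_ * _)]
  have h2 := (hM i x hx).trans (le_abs_self _)
  have h3 := h1 (k - i) (Nat.sub_le _ _)
  gcongr

theorem IsRegularNet.isModerate {r : Eps → E n → ℂ} (h : IsRegularNet Ω r) : IsModerate Ω r :=
  ⟨h.1, fun K hK hKΩ k => by
    obtain ⟨p, hp⟩ := h.2 K hK hKΩ
    exact ⟨p, hp k⟩⟩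

/-- Every cut-off ψ that is 1 near the relevant part of the kernel support is admitted, and ψ need
not be 1 on the support of φ. Hence κ(1 - ψ)f, with κ = 1 near the support of φ, must be shown to be
annihilated over `V`. -/
theorem isClassicalImage_locSymbol (hχ : IsMultiplier 0 χ) (hφ : IsTest Ω φ) {f : E n → ℂ}
    (hf : ContDiffOn ℝ ∞ f Ω) : IsClassicalImage Ω (locSymbol χ φ) f fun x =>
      φ x * (twoPiInv n * oscInt χ (fourierT fun y => φ y * f y) (x, 0)) := by
  intro V hV ψ hψ
  have hVΩ : V ≤ Ω := fun x hx => hV.2 (subset_closure hx)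
  obtain ⟨κ, hκ, hκ1⟩ := exists_cutoff hφ.2.1 hφ.2.2
  have hφκ : ∀ y, φ y * κ y = φ y := fun y => by
    by_cases hy : y ∈ tsupport φ
    · rw [(hκ1 y hy).self_of_nhds, mul_one]
    · rw [image_eq_zero_of_notMem_tsupport hy, zero_mul]
  have hψf : ContDiff ℝ ∞ fun y => ψ y * f y := hψ.1.contDiff_mul hf
  have hz : ∀ y, y ∉ tsupport κ → κ y = 0 := fun y hy => image_eq_zero_of_notMem_tsupport hy
  have hzψ : ∀ y, y ∉ tsupport ψ → ψ y * f y = 0 := fun y hy => by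
    rw [image_eq_zero_of_notMem_tsupport hy, zero_mul]
  have hg₁ : ContDiff ℝ ∞ fun y => κ y * ((1 - ψ y) * f y) :=
    hκ.contDiff_mul ((contDiff_const.sub hψ.1.1).contDiffOn.mul hf)
  have hg₂ : ContDiff ℝ ∞ fun y => κ y * (ψ y * f y) := hκ.1.mul hψf
  have hg₁t : IsTest Ω fun y => κ y * ((1 - ψ y) * f y) := by
    have h1 : tsupport (fun y => κ y * ((1 - ψ y) * f y)) ⊆ tsupport κ := tsupport_mul_subset_left
    exact ⟨hg₁, hκ.2.1.of_isClosed_subset (isClosed_tsupport _) h1, h1.trans hκ.2.2⟩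
  have ha := isSymbol_locSymbol (Ω := Ω) hχ hφ
  have h0 := quantize_eq_zero_of_disjoint ha hg₁t hVΩ (by
      have h1 := funext (quantize_locSymbol hχ hφ hg₁t.2.1 hg₁
        fun y hy => image_eq_zero_of_notMem_tsupport
          (f := fun y => κ y * ((1 - ψ y) * f y)) hy)
      rw [h1]
      refine Continuous.continuousOn (hφ.1.continuous.mul (continuous_const.mul
        (contDiff_oscInt_left hχ (isRapid_fourierT hκ.2.1 (hφ.1.mul hg₁) fun y hy => ?_)).continuous))
      rw [hz y hy, zero_mul, mul_zero])
    (fun x hx y hy hxy => by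
      have h1 := hψ.2 x (subset_closure hx) y hxy
      refine (notMem_tsupport_iff_eventuallyEq.2 ?_) hy
      filter_upwards [h1] with z hz
      simp [hz])
  intro x hx
  have h1 : quantize (locSymbol χ φ) (fun y => κ y * f y) x = quantize (locSymbol χ φ)
      (fun y => κ y * ((1 - ψ y) * f y)) x + quantize (locSymbol χ φ)
        (fun y => κ y * (ψ y * f y)) x := by
    rw [← quantize_add ha (hVΩ hx) hκ.2.1 hg₁ (fun y hy => by rw [hz y hy, zero_mul]) hg₂
      (fun y hy => by rw [hz y hy, zero_mul])]
    congr 1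
    funext y
    ring
  rw [h0 x hx, zero_add, quantize_locSymbol hχ hφ hκ.2.1 (hκ.contDiff_mul hf)
    (fun y hy => by rw [hz y hy, zero_mul]), quantize_locSymbol hχ hφ hκ.2.1 hg₂
    (fun y hy => by rw [hz y hy, zero_mul])] at h1
  simp only [← mul_assoc (φ _) (κ _), hφκ] at h1
  rw [quantize_locSymbol hχ hφ hψ.1.2.1 hψf hzψ]
  exact h1

end MicrolocalCutoffs

/-- At a microlocally regular point the operator φ χ(D) φ, with χ supported in the cone of rapid
decay, is elliptic and maps u to a regular element. -/
theorem Wcl_subset_WFg {n : ℕ} {Ω : Opens (E n)} (u : G Ω) : Wcl u ⊆ WFg u := by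
  rintro p ⟨hp, h⟩
  refine ⟨hp, fun ⟨r, hr, φ, hφ, hφ1, Γ, hΓ, N, hN⟩ => ?_⟩
  obtain ⟨χ, hχ, hχΓ, Γ', hΓ', R, hR, hχ1⟩ := exists_cone_multiplier hΓ
  have hG : ∀ ε, IsRapid (fourierT fun y => φ y * r ε y) := fun ε =>
    isRapid_fourierT hφ.2.1 (hφ.contDiff_mul (hr.isModerate.1 ε)) fun y hy => by
      rw [image_eq_zero_of_notMem_tsupport hy, zero_mul]
  have hreg := isRegularNet_locSymbol (Ω := Ω) hχ hχΓ hφ.1 hG hN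
  refine notMem_charSet_locSymbol hχ hφ hp.1 hφ1 hΓ' hR hχ1 (h _ (isSymbol_locSymbol hχ hφ)
    (isProperSubset_kernelSupport hφ.2.1 hφ.2.2 (kernelSupport_locSymbol_subset hχ hφ))
    ⟨((negligibleNets Ω).submoduleOf (moderateNets Ω)).mkQ ⟨_, hreg.isModerate⟩,
      ⟨_, ⟨hreg.isModerate, rfl⟩, hreg⟩, r, _, hr, ⟨hreg.isModerate, rfl⟩, fun ε => ?_⟩)
  exact isClassicalImage_locSymbol hχ hφ (hr.isModerate.1 ε)

end

end Colombeau

theorem theorem2p8 (n : ℕ) (Ω : TopologicalSpace.Opens (Colombeau.E n)) (u : Colombeau.G Ω) :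
    Colombeau.Wcl u = Colombeau.Wsc u ∧ Colombeau.Wsc u = Colombeau.WFg u := by
  have h1 := Colombeau.Wcl_subset_WFg u
  have h2 := Colombeau.WFg_subset_Wsc u
  have h3 := Colombeau.Wsc_subset_Wcl u
  exact ⟨(h1.trans h2).antisymm h3, (h3.trans h1).antisymm h2⟩
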